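/- Let $B(3)\le \mathrm{GL}_2(\mathbf F_3)$ be the group of upper triangular matrices, and let $H_{3,1}=\{\begin{pmatrix}1&*\\0&*\end{pmatrix}\}$ and $H_{3,2}=\{\begin{pmatrix}*&*\\0&1\end{pmatrix}\}$ be its two index-$2$ subgroups not containing $-I$. For an elliptic curve $E/\mathbf Q$ let $\rho_{E,n}$ be the representation of $G_{\mathbf Q}=\mathrm{Gal}(\overline{\mathbf Q}/\mathbf Q)$ on $E[n]$, and $\mathbf Q(E[n])\subset\overline{\mathbf Q}$ the fixed field of its kernel. $E$ is non-CM if $\mathrm{End}_{\overline{\mathbf Q}}(E)=\mathbf Z$. All fields below are subfields of $\overline{\mathbf Q}$, and $\mathbf Q(\zeta_3,\Delta_E^{1/3})$ is generated by the primitive cube roots of unity and the cube roots of the discriminant $\Delta_E$. There exists a surjective homomorphism $\theta\colon B(3)\to \mathrm{GL}_2(\mathbf F_2)$. Let $\theta$ be any such homomorphism and let $$H''=\{(g_2,g_3)\in \mathrm{GL}_2(\mathbf F_2)\times B(3) : g_2=\theta(g_3)\}$$ be its graph, a subgroup of $\mathrm{GL}_2(\mathbf F_2)\times\mathrm{GL}_2(\mathbf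 F_3)$. Then: (1) There are infinitely many rational numbers that are the $j$-invariant of some non-CM elliptic curve $E/\mathbf Q$ for which $(\rho_{E,2}\times\rho_{E,3})(G_{\mathbf Q})$ is conjugate to $H''$ (so that it projects onto $\mathrm{GL}_2(\mathbf F_2)$ and onto $B(3)$). (2) For a non-CM elliptic curve $E/\mathbf Q$ the following are equivalent: (a) $(\rho_{E,2}\times\rho_{E,3})(G_{\mathbf Q})$ is conjugate to a subgroup of $H''$; (b) there are $s,t\in\mathbf Q$, $t\ne0$, with $$j_E=2^{10}3^3s^3(1-4s^3)=\frac{27(t+1)(t+9)^3}{t^3};$$ (c) there is $v\in\mathbf Q$, $v^3\neq -1$, with $$j_E=\frac{27\,v^3(v^3+2)(2-v^3)^3(v^3+4)^3}{(v^3+1)^6}.$$ Moreover, the plane curve $X_{H''}\colon 2^{10}3^3s^3(1-4s^3)\,t^3=27(t+1)(t+9)^3$ is birational over $\mathbf Q$ to $\mathbf P^1_{\mathbf Q}$ (its function field is isomorphic to $\mathbf Q(v)$ over $\mathbf Q$); in particular it has genus $0$. (3) Every non-CM elliptic curve $E/\mathbf Q$ as in (2)(a) has surjective mod $2$ image, its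 mod $3$ image is conjugate to $B(3)$, $H_{3,1}$ or $H_{3,2}$, and $$\mathbf Q(E[2])\cap\mathbf Q(E[3])=\mathbf Q(\zeta_3,\Delta_E^{1/3})$$ is a Galois extension of $\mathbf Q$ with non-abelian Galois group. If $\rho_{E,3}(G_{\mathbf Q})$ is conjugate to $B(3)$, this intersection equals $\mathbf Q(x(E[3]))$, the field generated by the $x$-coordinates of the nonzero $3$-torsion points; if $\rho_{E,3}(G_{\mathbf Q})$ is conjugate to $H_{3,1}$ or $H_{3,2}$, it equals $\mathbf Q(E[3])$. -/

import Mathlib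

open scoped Polynomial WeierstrassCurve MatrixGroups

noncomputable section

/-- A fixed algebraic closure of `ℚ`. -/
abbrev Qbar : Type := AlgebraicClosure ℚ

instance instDecidableEqQbar : DecidableEq Qbar := Classical.decEq _

/-- The absolute Galois group of `ℚ`. -/
abbrev GQ : Type := Qbar ≃ₐ[ℚ] Qbar

/-- The group `E(ℚ̄)`. -/
abbrev QbarPoints (E : WeierstrassCurve ℚ) : Type := (E⁄Qbar).toAffine.Point

/-! ### Complex multiplication -/

/-- A group endomorphism of `E(ℚ̄)` is algebraic if it is zero or, away from finitely many points,
it is given by rational functions of the affine coordinates `(x, y)`. These are precisely the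
endomorphisms of the elliptic curve `E` over `ℚ̄`. -/
def IsAlgebraicEnd (E : WeierstrassCurve ℚ) (φ : QbarPoints E →+ QbarPoints E) : Prop :=
  φ = 0 ∨ ∃ p q r s : Qbar[X][X],
    {P : QbarPoints E | ¬ ∃ (x y x' y' : Qbar) (h : (E⁄Qbar).toAffine.Nonsingular x y)
        (h' : (E⁄Qbar).toAffine.Nonsingular x' y'),
      P = .some x y h ∧ φ P = .some x' y' h' ∧
      q.evalEval x y ≠ 0 ∧ x' = p.evalEval x y / q.evalEval x y ∧
      s.evalEval x y ≠ 0 ∧ y' = r.evalEval x y / s.evalEval x y}.Finite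

/-- `E` has complex multiplication: over `ℚ̄` it has an endomorphism that is not multiplication
by an integer. -/
def HasCM (E : WeierstrassCurve ℚ) : Prop :=
  ∃ φ : QbarPoints E →+ QbarPoints E, IsAlgebraicEnd E φ ∧
    ∀ n : ℤ, φ ≠ n • AddMonoidHom.id (QbarPoints E)

/-! ### Torsion, Galois representations and division fields -/

/-- The `n`-torsion subgroup `E[n]` of `E(ℚ̄)`. -/
abbrev Tors (E : WeierstrassCurve ℚ) (n : ℕ) : AddSubgroup (QbarPoints E) :=
  AddSubgroup.torsionBy (QbarPoints E) (n : ℤ)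

instance instModuleTors (E : WeierstrassCurve ℚ) (n : ℕ) : Module (ZMod n) (Tors E n) :=
  AddSubgroup.torsionBy.zmodModule

/-- The action of `σ` on `E(ℚ̄)`, coordinate by coordinate. -/
def galPoint (E : WeierstrassCurve ℚ) (σ : GQ) : QbarPoints E →+ QbarPoints E :=
  WeierstrassCurve.Affine.Point.map (W' := E) (σ : Qbar →ₐ[ℚ] Qbar)

theorem galPoint_mem_tors (E : WeierstrassCurve ℚ) (n : ℕ) (σ : GQ) (P : Tors E n) :
    galPoint E σ P ∈ Tors E n := by
  rw [AddSubgroup.torsionBy.nsmul_iff, ← map_nsmul,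
    AddSubgroup.torsionBy.nsmul_iff.mp P.2, map_zero]

/-- The action of `σ` on `E[n]`. -/
def galTors (E : WeierstrassCurve ℚ) (n : ℕ) (σ : GQ) : Tors E n →+ Tors E n :=
  ((galPoint E σ).comp (Tors E n).subtype).codRestrict (Tors E n) (galPoint_mem_tors E n σ)

/-- The mod `n` representation of the absolute Galois group on `E[n]`, without a choice of
basis. -/
def galRepLin (E : WeierstrassCurve ℚ) (n : ℕ) : GQ →* Module.End (ZMod n) (Tors E n) where
  toFun σ := (galTors E n σ).toZModLinearMap n
  map_one' := by
    ext P
    rcases P with ⟨_ | _, h⟩ <;> rfl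
  map_mul' σ τ := by
    ext P
    rcases P with ⟨_ | _, h⟩ <;> rfl

/-- The mod `n` representation `ρ_{E,n}` with respect to a basis `b` of `E[n]`. Changing the basis
replaces it by a conjugate. -/
def galRep (E : WeierstrassCurve ℚ) (n : ℕ) (b : Module.Basis (Fin 2) (ZMod n) (Tors E n)) :
    GQ →* GL (Fin 2) (ZMod n) :=
  ((LinearMap.toMatrixAlgEquiv b : Module.End (ZMod n) (Tors E n) →*
    Matrix (Fin 2) (Fin 2) (ZMod n)).comp (galRepLin E n)).toHomUnits

/-- The image of `ρ_{E,n}` is conjugate to `H`, i.e. equal to `H` for some basis of `E[n]`. -/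
def ModImageConj (E : WeierstrassCurve ℚ) (n : ℕ) (H : Subgroup (GL (Fin 2) (ZMod n))) : Prop :=
  ∃ b : Module.Basis (Fin 2) (ZMod n) (Tors E n), (galRep E n b).range = H

/-- The image of `ρ_{E,2} × ρ_{E,3}` is conjugate to `H`. -/
def CompositeImageConj (E : WeierstrassCurve ℚ)
    (H : Subgroup (GL (Fin 2) (ZMod 2) × GL (Fin 2) (ZMod 3))) : Prop :=
  ∃ (b₂ : Module.Basis (Fin 2) (ZMod 2) (Tors E 2)) (b₃ : Module.Basis (Fin 2) (ZMod 3) (Tors E 3)),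
    ((galRep E 2 b₂).prod (galRep E 3 b₃)).range = H

/-- The image of `ρ_{E,2} × ρ_{E,3}` is conjugate to a subgroup of `H`. -/
def CompositeImageConjLE (E : WeierstrassCurve ℚ)
    (H : Subgroup (GL (Fin 2) (ZMod 2) × GL (Fin 2) (ZMod 3))) : Prop :=
  ∃ (b₂ : Module.Basis (Fin 2) (ZMod 2) (Tors E 2)) (b₃ : Module.Basis (Fin 2) (ZMod 3) (Tors E 3)),
    ((galRep E 2 b₂).prod (galRep E 3 b₃)).range ≤ H

/-- The `n`-division field `ℚ(E[n])`: the fixed field of the kernel of the mod `n`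
representation. -/
def divisionField (E : WeierstrassCurve ℚ) (n : ℕ) : IntermediateField ℚ Qbar :=
  IntermediateField.fixedField (galRepLin E n).ker

/-- The field `ℚ(x(E[n]))` generated by the `x`-coordinates of the nonzero points of `E[n]`. -/
def xDivisionField (E : WeierstrassCurve ℚ) (n : ℕ) : IntermediateField ℚ Qbar :=
  IntermediateField.adjoin ℚ
    {x : Qbar | ∃ (y : Qbar) (h : (E⁄Qbar).toAffine.Nonsingular x y),
      WeierstrassCurve.Affine.Point.some x y h ∈ Tors E n}

/-- The field `ℚ(ζ₃, Δ_E^{1/3})`. As it contains `ζ₃`, it contains all cube roots of `Δ_E` as soon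
as it contains one of them. -/
def zetaCubeRootField (E : WeierstrassCurve ℚ) : IntermediateField ℚ Qbar :=
  IntermediateField.adjoin ℚ
    ({z : Qbar | IsPrimitiveRoot z 3} ∪ {d : Qbar | d ^ 3 = algebraMap ℚ Qbar E.Δ})

/-! ### Groups of level 3 and 6 -/

/-- The Borel subgroup `B(3)` of upper triangular matrices in `GL₂(𝔽₃)`. -/
def borel3 : Subgroup (GL (Fin 2) (ZMod 3)) where
  carrier := {g | g 1 0 = 0}
  one_mem' := by simp
  mul_mem' {a b} ha hb := by
    simp only [Set.mem_ofPred_eq] at ha hb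
    simp [Matrix.mul_apply, Fin.sum_univ_two, ha, hb]
  inv_mem' {a} ha := by
    simp only [Set.mem_ofPred_eq] at ha
    simp [Matrix.inv_def, Matrix.adjugate_fin_two, ha]

/-- The subgroup of matrices `(1 *; 0 *)` in `GL₂(𝔽₃)`. -/
def borel3Left : Subgroup (GL (Fin 2) (ZMod 3)) where
  carrier := {g | g 1 0 = 0 ∧ g 0 0 = 1}
  one_mem' := by simp
  mul_mem' {a b} ha hb := by
    simp only [Set.mem_ofPred_eq] at ha hb
    simp [Matrix.mul_apply, Fin.sum_univ_two, ha, hb]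
  inv_mem' {a} ha := by
    simp only [Set.mem_ofPred_eq] at ha
    have hd : IsUnit (a.val.det) := (Matrix.isUnit_iff_isUnit_det _).mp a.isUnit
    have h1 : a.val.det = a 1 1 := by simp [Matrix.det_fin_two, ha]
    rw [h1] at hd
    simp [Matrix.inv_def, Matrix.adjugate_fin_two, ha, h1, inv_mul_cancel₀ hd.ne_zero]

/-- The subgroup of matrices `(* *; 0 1)` in `GL₂(𝔽₃)`. -/
def borel3Right : Subgroup (GL (Fin 2) (ZMod 3)) where
  carrier := {g | g 1 0 = 0 ∧ g 1 1 = 1}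
  one_mem' := by simp
  mul_mem' {a b} ha hb := by
    simp only [Set.mem_ofPred_eq] at ha hb
    simp [Matrix.mul_apply, Fin.sum_univ_two, ha, hb]
  inv_mem' {a} ha := by
    simp only [Set.mem_ofPred_eq] at ha
    have hd : IsUnit (a.val.det) := (Matrix.isUnit_iff_isUnit_det _).mp a.isUnit
    have h1 : a.val.det = a 0 0 := by simp [Matrix.det_fin_two, ha]
    rw [h1] at hd
    simp [Matrix.inv_def, Matrix.adjugate_fin_two, ha, h1, inv_mul_cancel₀ hd.ne_zero]

/-- The graph `{(g₂, g₃) ∈ GL₂(𝔽₂) × B(3) : g₂ = θ(g₃)}` of `θ : B(3) → GL₂(𝔽₂)`, as a subgroup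
of `GL₂(𝔽₂) × GL₂(𝔽₃)`. -/
def graphSubgroup (θ : borel3 →* GL (Fin 2) (ZMod 2)) :
    Subgroup (GL (Fin 2) (ZMod 2) × GL (Fin 2) (ZMod 3)) :=
  (θ.prod borel3.subtype).range

/-! ### The model of the level 6 modular curve -/

/-- The equation `2¹⁰ 3³ s³ (1 - 4 s³) t³ = 27 (t + 1) (t + 9)³` in the variables `s, t`. -/
def levelSixPoly : MvPolynomial (Fin 2) ℚ :=
  let s : MvPolynomial (Fin 2) ℚ := MvPolynomial.X 0
  let t : MvPolynomial (Fin 2) ℚ := MvPolynomial.X 1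
  2 ^ 10 * 3 ^ 3 * s ^ 3 * (1 - 4 * s ^ 3) * t ^ 3 - 27 * (t + 1) * (t + 9) ^ 3

/-- The function field over `ℚ` of the plane curve `levelSixPoly = 0`. -/
abbrev LevelSixFunctionField : Type :=
  FractionRing (MvPolynomial (Fin 2) ℚ ⧸ Ideal.span {levelSixPoly})

end

noncomputable section

/-! The kernel of a surjection `θ` is `{±1}`, and `B(3)/{±1}` is the full group of permutations of
the three lines of `𝔽₃²` other than the stable one. Through `θ` these lines correspond to the three
nonzero vectors of `𝔽₂²` (`exists_equivariant_of_surjective`). Hence the image of `ρ₂ × ρ₃` is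
conjugate into the graph exactly when the 3-division polynomial has a rational root `x₁` and its
other roots `X k` are permuted by Galois in the same way as the roots `e k` of the 2-division
polynomial (`IsLevelSix`, `compositeImageConjLE_iff`).

Given `x₁`, an explicit polynomial `D k` in `X k` runs through the three cube roots of `Δ`. The
condition therefore says `e k = A + P D k + Q (D k)²` with rational `A`, `P`, `Q`. Comparing `c₄`
and `c₆` turns this into the formula for `j` in `s`, while the root `x₁` gives the formula in `t`.
The two expressions for `j - 1728` show that `-t = r²`; then `64 s³ r³ = (r - 1)(r + 3)³` shows that
`r - 1 = v³`. This gives the equivalences. In the function field the same formulas recover `v` from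
`s` and `t`, and a degree count identifies the ideal of the curve.

For a non-CM curve of this kind `Δ` is not a cube: otherwise `j = x³`, and `(-x/12)³ + 1 = (1 -
8s³)²` is a rational point on `Y² = X³ + 1`. A descent leaves `X = -1, 0, 2`; the first two mean `j
= 1728, 0`, which have CM, and the third contradicts the formula in `t`. So the mod 3 image fixes
none of the three lines. It induces an odd permutation of them, because `-27 Δ²` is not a square, so
it induces all of them. It is thus `B(3)` or one of the two subgroups missing `-1`. As `ker ρ₂` is
the preimage of `{±1}` under `ρ₃`, the statements on fields follow by Galois theory.

For infinitely many `j`, take `y² = x³ + 2(x + b)²`. Its 3-torsion point `(0, b√2)` forces the whole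
of `B(3)`. Absence of CM is proved from multiplicative reduction at 5
(`IsNodal.eq_zsmul_of_isRationalMap`), with elementary estimates for `|x|` in place of the Tate
curve. For `|x(P)| = ρ` just below 1, a nonzero endomorphism satisfies `|x(φ P)| = C ρ^a`. If `φ` is
not an integer, adding an integer gives a nonzero `ψ` with `a = 0` and `C ≥ 1`. Then `ψ` preserves
the points of smooth reduction, and counting zeros in the open unit disc shows that `x ∘ ψ` is
bounded near the origin of the group, which is impossible. -/

/-! ### Descent on a quartic, and the rational points of `Y² = X³ + 1`. -/

theorem Int.exists_pow_four_of_mul_eq {A B q : ℤ} (h : A * B = 3 * q ^ 4) (hc : IsCoprime A B)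
    (hA : 0 ≤ A) (hB : 0 ≤ B) :
    ∃ u w : ℤ, (u * w) ^ 2 = q ^ 2 ∧ ((A = u ^ 4 ∧ B = 3 * w ^ 4) ∨ (A = 3 * w ^ 4 ∧ B = u ^ 4)) := by
  have key : ∀ A B : ℤ, A * B = 3 * q ^ 4 → IsCoprime A B → 0 ≤ A → 0 ≤ B → (3 : ℤ) ∣ B →
      ∃ u w : ℤ, (u * w) ^ 2 = q ^ 2 ∧ A = u ^ 4 ∧ B = 3 * w ^ 4 := by
    rintro A _ h hc hA hB ⟨B, rfl⟩
    have h' : A * B = q ^ 4 := by linarith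
    have hc' : IsCoprime A B := hc.of_mul_right_right
    have hB' : 0 ≤ B := by linarith
    obtain ⟨u, hu⟩ := exists_associated_pow_of_mul_eq_pow' hc' h'
    obtain ⟨w, hw⟩ := exists_associated_pow_of_mul_eq_pow' hc'.symm (by rw [mul_comm]; exact h')
    have hu' : A = u ^ 4 := by
      rcases Int.associated_iff.1 hu with h | h
      · exact h.symm
      · have : 0 ≤ u ^ 4 := by positivity
        linarith
    have hw' : B = w ^ 4 := by
      rcases Int.associated_iff.1 hw with h | h
      · exact h.symm
      · have : 0 ≤ w ^ 4 := by positivity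
        linarith
    refine ⟨u, w, ?_, hu', by rw [hw']⟩
    have : ((u * w) ^ 2) ^ 2 = (q ^ 2) ^ 2 := by rw [← pow_mul, ← pow_mul, mul_pow, ← hu', ← hw', h']
    exact (sq_eq_sq₀ (by positivity) (by positivity)).1 this
  have h3 : (3 : ℤ) ∣ A * B := ⟨_, h⟩
  rcases (Int.prime_three.dvd_mul).1 h3 with h3 | h3
  · obtain ⟨u, w, h1, h2, h4⟩ := key B A (by rw [mul_comm]; exact h) hc.symm hB hA h3
    exact ⟨u, w, h1, Or.inr ⟨h4, h2⟩⟩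
  · obtain ⟨u, w, h1, h2, h4⟩ := key A B h hc hA hB h3
    exact ⟨u, w, h1, Or.inl ⟨h2, h4⟩⟩

/-- A common prime `p` divides `q`, since otherwise `p² ∣ 3`; by `hs` it then divides `s` as well.
-/
theorem Int.isCoprime_of_mul_eq_three_mul_pow {A B q s : ℤ} (h : A * B = 3 * q ^ 4) (hq : q ≠ 0)
    (hs : ∀ p : ℤ, Prime p → p ∣ A → p ∣ B → p ∣ q → p ∣ s) (hc : IsCoprime s q) :
    IsCoprime A B := by
  refine isCoprime_of_prime_dvd ?_ ?_
  · rintro ⟨rfl, rfl⟩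
    simp [hq] at h
  · intro p hp hA hB
    have hpq : p ∣ q := by
      by_contra hpq
      have h1 : p * p ∣ 3 * q ^ 4 := h ▸ mul_dvd_mul hA hB
      have h2 : IsCoprime (p * p) (q ^ 4) := by
        have := (hp.coprime_iff_not_dvd).2 hpq
        exact (this.mul_left this).pow_right
      have h3 : p * p ∣ 3 := h2.dvd_of_dvd_mul_right h1
      have h4 := Int.le_of_dvd (by norm_num) h3
      have h5 : p = 1 ∨ p = -1 := by
        have : -2 < p := by nlinarith
        have : p < 2 := by nlinarith
        have := hp.ne_zero
        omega
      exact hp.not_isUnit (Int.isUnit_iff.2 h5)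
    exact hp.not_isUnit (hc.isUnit_of_dvd' (hs p hp hA hB hpq) hpq)

theorem Int.three_dvd_of_sq_add_sq {a b : ℤ} (h : (3 : ℤ) ∣ a ^ 2 + b ^ 2) : (3 : ℤ) ∣ a ∧ (3 : ℤ) ∣ b := by
  have h1 : (((a ^ 2 + b ^ 2 : ℤ)) : ZMod 3) = 0 := (ZMod.intCast_zmod_eq_zero_iff_dvd _ 3).2 h
  push_cast at h1
  have : ∀ x y : ZMod 3, x ^ 2 + y ^ 2 = 0 → x = 0 ∧ y = 0 := by decide
  obtain ⟨h2, h3⟩ := this _ _ h1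
  exact ⟨(ZMod.intCast_zmod_eq_zero_iff_dvd _ 3).1 h2, (ZMod.intCast_zmod_eq_zero_iff_dvd _ 3).1 h3⟩

/-- The descent step: the factors are `e⁴` and `3f⁴` with `(ef)² = w²`, so the equation for their
sum is the original quartic at `(e, f, u)`. -/
theorem Int.exists_quartic_of_mul_eq {u w A B : ℤ} (hw : w ≠ 0) (hAB : A * B = 3 * w ^ 4)
    (hsum : A + B = u ^ 2 + 3 * w ^ 2) (hc : IsCoprime A B) :
    ∃ e f : ℤ, IsCoprime e f ∧ f ≠ 0 ∧ (e * f) ^ 2 = w ^ 2 ∧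
      e ^ 4 - 3 * e ^ 2 * f ^ 2 + 3 * f ^ 4 = u ^ 2 := by
  have hpos : 0 < A * B := by rw [hAB]; positivity
  have hpos' : 0 < A + B := by rw [hsum]; positivity
  have hA : 0 ≤ A := by
    by_contra hA
    nlinarith
  have hB : 0 ≤ B := by
    by_contra hB
    nlinarith
  obtain ⟨e, f, h1, h2⟩ := Int.exists_pow_four_of_mul_eq hAB hc hA hB
  have hf : f ≠ 0 := by
    rintro rfl
    simp at h1
    exact hw ((pow_eq_zero_iff two_ne_zero).1 h1.symm)
  have hef : IsCoprime e f := by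
    rcases h2 with ⟨rfl, rfl⟩ | ⟨rfl, rfl⟩
    · exact (IsCoprime.pow_iff (by norm_num) (by norm_num)).1 hc.of_mul_right_right
    · exact (IsCoprime.pow_iff (by norm_num) (by norm_num)).1 hc.symm.of_mul_right_right
  refine ⟨e, f, hef, hf, h1, ?_⟩
  have h3 : e ^ 4 + 3 * f ^ 4 = u ^ 2 + 3 * w ^ 2 := by
    rcases h2 with ⟨rfl, rfl⟩ | ⟨rfl, rfl⟩ <;> linarith
  rw [mul_pow] at h1
  linear_combination h3 - 3 * h1

/-- The only coprime integral points on `s⁴ - 3s²q² + 3q⁴ = t²` with `q ≠ 0` have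
`s² = q² = 1`. -/
theorem Int.sq_eq_one_of_quartic {s q t : ℤ} (hc : IsCoprime s q) (hq : q ≠ 0)
    (h : s ^ 4 - 3 * s ^ 2 * q ^ 2 + 3 * q ^ 4 = t ^ 2) : s ^ 2 = 1 ∧ q ^ 2 = 1 := by
  induction hn : q.natAbs using Nat.strong_induction_on generalizing s q t with
  | _ n ih =>
  wlog ht : 0 ≤ t generalizing t
  · exact this (t := -t) (by rw [h]; ring) (by linarith)
  have ht0 : 0 < t := by
    rcases ht.eq_or_lt with rfl | h0
    · have : (2 * s ^ 2 - 3 * q ^ 2) ^ 2 + 3 * q ^ 4 = 0 := by linear_combination 4 * h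
      have : 0 < q ^ 4 := by positivity
      nlinarith [sq_nonneg (2 * s ^ 2 - 3 * q ^ 2)]
    · exact h0
  -- the final step, common to both parities
  have final : ∀ u w A B : ℤ, w ≠ 0 → w.natAbs ≤ n → (w.natAbs = n → u ^ 2 = 1) →
      A * B = 3 * w ^ 4 → A + B = u ^ 2 + 3 * w ^ 2 →
      IsCoprime A B → u ^ 2 = 1 ∧ w ^ 2 = 1 := by
    intro u w A B hw hwn hu hAB hsum hAc
    obtain ⟨e, f, hef, hf, h1, h2⟩ := Int.exists_quartic_of_mul_eq hw hAB hsum hAc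
    have hfw : f.natAbs ≤ w.natAbs := by
      apply Int.natAbs_le_iff_sq_le.2
      have he : e ≠ 0 := by
        rintro rfl
        simp at h1
        exact hw ((pow_eq_zero_iff two_ne_zero).1 h1.symm)
      have : 1 ≤ e ^ 2 := by
        have : 0 < e ^ 2 := by positivity
        linarith
      nlinarith [sq_nonneg f]
    -- The descent need not make `f` smaller. If `|f| = n`, then `e² = u² = 1`, and the quartic
    -- itself reads `3f²(f² - 1) = 0`.
    have hef1 : e ^ 2 = 1 ∧ f ^ 2 = 1 := by
      rcases lt_or_ge f.natAbs n with hlt | hge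
      · exact ih _ hlt hef hf h2 rfl
      · have hu1 := hu (by omega)
        have hfw' : f ^ 2 = w ^ 2 := Int.natAbs_eq_iff_sq_eq.1 (by omega)
        have he1 : e ^ 2 = 1 := by
          have : f ^ 2 ≠ 0 := by positivity
          rw [mul_pow, hfw'] at h1
          rw [hfw'] at this
          exact mul_right_cancel₀ this (by rw [h1, one_mul])
        refine ⟨he1, ?_⟩
        have h4 : f ^ 2 * (f ^ 2 - 1) = 0 := by
          have : e ^ 4 = 1 := by rw [show e ^ 4 = (e ^ 2) ^ 2 by ring, he1]; norm_num
          rw [this, he1, hu1] at h2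
          linarith [h2]
        rcases mul_eq_zero.1 h4 with h5 | h5
        · exact absurd h5 (by positivity)
        · linarith
    obtain ⟨he1, hf1⟩ := hef1
    rw [mul_pow, he1, hf1] at h1
    rw [show e ^ 4 = (e ^ 2) ^ 2 by ring, show f ^ 4 = (f ^ 2) ^ 2 by ring, he1, hf1] at h2
    exact ⟨by linarith, by linarith⟩
  have hpq : ∀ p : ℤ, Prime p → p ∣ q → ¬ p ∣ s := fun p hp h1 h2 =>
    hp.not_isUnit (hc.isUnit_of_dvd' h2 h1)
  have hodd : ∀ p x : ℤ, Prime p → p ∣ x → Odd x → ¬ p ∣ 2 := by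
    rintro p x hp hx ⟨k, rfl⟩ h2
    exact hp.not_isUnit (IsCoprime.isUnit_of_dvd' (a := 2) (b := 2 * k + 1) ⟨-k, 1, by ring⟩ h2 hx)
  -- excludes one of the two signs
  have sign : ∀ u w x : ℤ, (u * w) ^ 2 ∣ q ^ 2 → x ∣ 2 → (x * s) ^ 2 = -u ^ 4 + 6 * u ^ 2 * w ^ 2 + 3 * w ^ 4 →
      False := by
    intro u w x huw hx2 hx
    -- Modulo 3 the equation says that a sum of two squares vanishes.
    obtain ⟨h1, h2⟩ := Int.three_dvd_of_sq_add_sq (a := x * s) (b := u ^ 2)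
      ⟨2 * u ^ 2 * w ^ 2 + w ^ 4, by rw [hx]; ring⟩
    have h3 := Int.prime_three.dvd_of_dvd_pow h2
    have h4 : (3 : ℤ) ∣ q :=
      (h3.mul_right w).trans ((Int.pow_dvd_pow_iff two_ne_zero).1 huw)
    rcases Int.prime_three.dvd_mul.1 h1 with h5 | h5
    · exact absurd (h5.trans hx2) (by norm_num)
    · exact hpq 3 Int.prime_three h4 h5
  rcases Int.even_or_odd' q with ⟨q', rfl | hq'⟩
  · -- `q` even
    have hq0 : q' ≠ 0 := by rintro rfl; simp at hq
    have hso : Odd s := by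
      rw [← Int.not_even_iff_odd, even_iff_two_dvd]
      exact hpq 2 Int.prime_two ⟨q', rfl⟩
    have hto : Odd t := by
      have : Odd (t ^ 2) := by
        rw [← h, show s ^ 4 - 3 * s ^ 2 * (2 * q') ^ 2 + 3 * (2 * q') ^ 4
          = s ^ 4 + 2 * (24 * q' ^ 4 - 6 * s ^ 2 * q' ^ 2) by ring]
        exact (hso.pow).add_even (even_two_mul _)
      exact (Int.odd_pow' two_ne_zero).1 this
    -- Completing the square gives `t² - (s² - 6q'²)² = 12 q'⁴`, and both factors on the left are
    -- even.
    obtain ⟨A, hA⟩ : (2 : ℤ) ∣ t - s ^ 2 + 6 * q' ^ 2 :=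
      dvd_add (even_iff_two_dvd.1 (hto.sub_odd hso.pow)) ⟨3 * q' ^ 2, by ring⟩
    obtain ⟨B, hB⟩ : (2 : ℤ) ∣ t + s ^ 2 - 6 * q' ^ 2 :=
      dvd_sub (even_iff_two_dvd.1 (hto.add_odd hso.pow)) ⟨3 * q' ^ 2, by ring⟩
    have hAB : A * B = 3 * q' ^ 4 := by
      have : (2 * A) * (2 * B) = 12 * q' ^ 4 := by
        rw [← hA, ← hB]
        linear_combination -h
      linarith
    have hcAB : IsCoprime A B := by
      refine Int.isCoprime_of_mul_eq_three_mul_pow hAB hq0 (s := s) ?_ hc.of_mul_right_right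
      intro p hp h1 h2 h3
      have : p ∣ s ^ 2 := by
        have h4 : s ^ 2 = B - A + 6 * q' ^ 2 := by linarith
        rw [h4]
        exact dvd_add (dvd_sub h2 h1) (Dvd.dvd.mul_left (dvd_pow h3 two_ne_zero) _)
      exact hp.dvd_of_dvd_pow this
    have hs' : 0 < A * B ∧ 0 < A + B := ⟨by rw [hAB]; positivity, by linarith⟩
    have hA0 : 0 ≤ A := by by_contra hA; nlinarith [hs'.1, hs'.2]
    have hB0 : 0 ≤ B := by by_contra hA; nlinarith [hs'.1, hs'.2]
    obtain ⟨u, w, huw, hABuw⟩ := Int.exists_pow_four_of_mul_eq hAB hcAB hA0 hB0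
    have hu : s ^ 2 = u ^ 4 + 6 * u ^ 2 * w ^ 2 - 3 * w ^ 4 := by
      rw [mul_pow] at huw
      rcases hABuw with ⟨rfl, rfl⟩ | ⟨rfl, rfl⟩
      · exfalso
        refine sign u w 1 ⟨4, by rw [mul_pow, mul_pow, huw]; ring⟩ (by norm_num) ?_
        linarith
      · linarith
    have hw : w ≠ 0 := by
      rintro rfl
      simp only [mul_zero] at huw
      exact hq0 ((pow_eq_zero_iff two_ne_zero).1 (by rw [← huw]; norm_num))
    have hu0 : u ≠ 0 := by
      rintro rfl
      simp only [zero_mul] at huw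
      exact hq0 ((pow_eq_zero_iff two_ne_zero).1 (by rw [← huw]; norm_num))
    have hwn : w.natAbs < n := by
      rw [← hn]
      apply Int.natAbs_lt_iff_sq_lt.2
      have : 1 ≤ u ^ 2 := by
        have : 0 < u ^ 2 := by positivity
        linarith
      have hw2 : 0 < w ^ 2 := by positivity
      nlinarith
    have hsum : Odd (u ^ 2 + 3 * w ^ 2) := by
      have : Odd ((u ^ 2 + 3 * w ^ 2) ^ 2) := by
        rw [show (u ^ 2 + 3 * w ^ 2) ^ 2 = s ^ 2 + 2 * (6 * w ^ 4) by rw [hu]; ring]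
        exact hso.pow.add_even (even_two_mul _)
      exact (Int.odd_pow' two_ne_zero).1 this
    -- A second factorization, from `(u² + 3w²)² - s² = 12 w⁴`.
    obtain ⟨A', hA'⟩ := even_iff_two_dvd.1 (hsum.sub_odd hso)
    obtain ⟨B', hB'⟩ := even_iff_two_dvd.1 (hsum.add_odd hso)
    have hAB' : A' * B' = 3 * w ^ 4 := by
      have : (2 * A') * (2 * B') = 12 * w ^ 4 := by
        rw [← hA', ← hB']
        linear_combination -hu
      linarith
    have hwq : w ∣ q' := by
      rw [← Int.pow_dvd_pow_iff two_ne_zero, ← huw, mul_pow]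
      exact dvd_mul_left _ _
    obtain ⟨h5, h6⟩ := final u w A' B' hw hwn.le (fun h => absurd h hwn.ne) hAB' (by linarith) <| by
      refine Int.isCoprime_of_mul_eq_three_mul_pow hAB' hw (s := s) ?_
        (hc.of_mul_right_right.of_isCoprime_of_dvd_right hwq)
      intro p hp h1 h2 h3
      rw [show s = B' - A' by linarith]
      exact dvd_sub h2 h1
    rw [show u ^ 4 = (u ^ 2) ^ 2 by ring, show w ^ 4 = (w ^ 2) ^ 2 by ring, h5, h6] at hu
    -- Now `s² = 1 + 6 - 3 = 4`, although `s` is odd.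
    obtain ⟨k, rfl⟩ := hso
    ring_nf at hu
    omega
  · -- `q` odd
    have hqo : Odd q := ⟨q', hq'⟩
    have hAB : (2 * t - (2 * s ^ 2 - 3 * q ^ 2)) * (2 * t + (2 * s ^ 2 - 3 * q ^ 2)) = 3 * q ^ 4 := by
      linear_combination -4 * h
    set A := 2 * t - (2 * s ^ 2 - 3 * q ^ 2) with hA
    set B := 2 * t + (2 * s ^ 2 - 3 * q ^ 2) with hB
    have hcAB : IsCoprime A B := by
      refine Int.isCoprime_of_mul_eq_three_mul_pow hAB hq (s := s) ?_ hc
      intro p hp h1 h2 h3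
      have : p ∣ 2 * 2 * s ^ 2 := by
        have h4 : 2 * 2 * s ^ 2 = B - A + 6 * q ^ 2 := by rw [hA, hB]; ring
        rw [h4]
        exact dvd_add (dvd_sub h2 h1) (Dvd.dvd.mul_left (dvd_pow h3 two_ne_zero) _)
      have h2' := hodd p q hp h3 hqo
      rcases hp.dvd_mul.1 this with h5 | h5
      · exact absurd (hp.dvd_mul.1 h5) (by tauto)
      · exact hp.dvd_of_dvd_pow h5
    have hs' : 0 < A * B ∧ 0 < A + B := ⟨by rw [hAB]; positivity, by rw [hA, hB]; linarith⟩
    have hA0 : 0 ≤ A := by by_contra hA; nlinarith [hs'.1, hs'.2]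
    have hB0 : 0 ≤ B := by by_contra hA; nlinarith [hs'.1, hs'.2]
    obtain ⟨u, w, huw, hABuw⟩ := Int.exists_pow_four_of_mul_eq hAB hcAB hA0 hB0
    have hBA : B - A = 4 * s ^ 2 - 6 * q ^ 2 := by rw [hA, hB]; ring
    have hu : 4 * s ^ 2 = u ^ 4 + 6 * u ^ 2 * w ^ 2 - 3 * w ^ 4 := by
      have huw' := huw
      rw [mul_pow] at huw
      rcases hABuw with ⟨h1, h2⟩ | ⟨h1, h2⟩ <;> rw [h1, h2] at hBA
      · exfalso
        refine sign u w 2 (by rw [huw']) (by norm_num) ?_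
        linear_combination - hBA - 6 * huw
      · linear_combination - hBA - 6 * huw
    have hw : w ≠ 0 := by
      rintro rfl
      simp only [mul_zero] at huw
      exact hq ((pow_eq_zero_iff two_ne_zero).1 (by rw [← huw]; norm_num))
    have hu0 : u ≠ 0 := by
      rintro rfl
      simp only [zero_mul] at huw
      exact hq ((pow_eq_zero_iff two_ne_zero).1 (by rw [← huw]; norm_num))
    have huwo : Odd (u * w) := by
      have : Odd ((u * w) ^ 2) := by rw [huw]; exact hqo.pow
      exact (Int.odd_pow' two_ne_zero).1 this
    obtain ⟨huo, hwo⟩ := Int.odd_mul.1 huwo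
    obtain ⟨m, hm⟩ : (2 : ℤ) ∣ u ^ 2 + 3 * w ^ 2 :=
      even_iff_two_dvd.1 (huo.pow.add_odd ((by decide : Odd (3 : ℤ)).mul hwo.pow))
    have hAB' : (m - s) * (m + s) = 3 * w ^ 4 := by
      have : (2 * m) ^ 2 - 4 * s ^ 2 = 12 * w ^ 4 := by
        rw [← hm, hu]
        ring
      linarith
    have hwq : w ∣ q := by
      rw [← Int.pow_dvd_pow_iff two_ne_zero, ← huw, mul_pow]
      exact dvd_mul_left _ _
    have hwn : w.natAbs ≤ n := by
      rw [← hn]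
      exact Int.natAbs_le_of_dvd_ne_zero hwq hq
    have hu1 : w.natAbs = n → u ^ 2 = 1 := by
      intro h1
      rw [← hn, Int.natAbs_eq_iff_sq_eq] at h1
      rw [mul_pow, ← h1] at huw
      exact mul_right_cancel₀ (b := w ^ 2) (by positivity) (by rw [huw, one_mul])
    obtain ⟨h5, h6⟩ := final u w (m - s) (m + s) hw hwn hu1 hAB' (by linarith) <| by
      refine Int.isCoprime_of_mul_eq_three_mul_pow hAB' hw (s := s) ?_
        (hc.of_isCoprime_of_dvd_right hwq)
      intro p hp h1 h2 h3
      have : p ∣ 2 * s := by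
        rw [show 2 * s = (m + s) - (m - s) by ring]
        exact dvd_sub h2 h1
      exact (hp.dvd_mul.1 this).resolve_left (hodd p w hp h3 hwo)
    rw [show u ^ 4 = (u ^ 2) ^ 2 by ring, show w ^ 4 = (w ^ 2) ^ 2 by ring, h5, h6] at hu
    rw [mul_pow, h5, h6] at huw
    exact ⟨by linarith, by linarith⟩

/-- The rational points of `Y² = X³ + 1`. -/
theorem Rat.eq_of_cube_add_one_eq_sq {X Y : ℚ} (h : X ^ 3 + 1 = Y ^ 2) :
    X = -1 ∨ X = 0 ∨ X = 2 := by
  obtain ⟨n, hn⟩ : ∃ n : ℤ, n = X.den := ⟨_, rfl⟩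
  obtain ⟨m, hm⟩ : ∃ m : ℤ, m = X.num := ⟨_, rfl⟩
  have hn0 : 0 < n := by rw [hn]; exact_mod_cast X.den_pos
  have hX : X = m / n := by rw [hm, hn]; exact_mod_cast (Rat.num_div_den X).symm
  have hmn : IsCoprime m n := by
    rw [hm, hn]
    exact Int.isCoprime_iff_nat_coprime.2 X.reduced
  have hnQ : (n : ℚ) ≠ 0 := by exact_mod_cast hn0.ne'
  -- Multiply the equation by `n⁴`. The factor `n` is prime to the others, hence a square.
  obtain ⟨z, hz⟩ : ∃ z : ℤ, n * ((m + n) * (m ^ 2 - m * n + n ^ 2)) = z ^ 2 := by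
    have h1 : ((n * ((m + n) * (m ^ 2 - m * n + n ^ 2)) : ℤ) : ℚ) = (Y * n ^ 2) ^ 2 := by
      push_cast
      rw [mul_pow, ← h, hX]
      field_simp
      ring
    have h2 : IsSquare ((n * ((m + n) * (m ^ 2 - m * n + n ^ 2)) : ℤ) : ℚ) := ⟨_, h1.trans (sq _)⟩
    rw [Rat.isSquare_intCast_iff] at h2
    obtain ⟨z, hz⟩ := h2
    exact ⟨z, by rw [hz, sq]⟩
  have sq_of : ∀ a b c : ℤ, 0 ≤ a → IsCoprime a b → a * b = c ^ 2 → ∃ d, a = d ^ 2 := by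
    intro a b c ha hab hc
    obtain ⟨d, hd | hd⟩ := Int.sq_of_isCoprime hab hc
    · exact ⟨d, hd⟩
    · exact ⟨0, by nlinarith [sq_nonneg d]⟩
  have hc1 : IsCoprime n (m + n) := by
    have := hmn.symm.add_mul_left_right 1
    simpa using this
  have hc2 : IsCoprime n (m ^ 2 - m * n + n ^ 2) := by
    have := (hmn.symm.pow_right (n := 2)).add_mul_left_right (n - m)
    rwa [show m ^ 2 + n * (n - m) = m ^ 2 - m * n + n ^ 2 by ring] at this
  have hpos : 0 < m ^ 2 - m * n + n ^ 2 := by nlinarith [sq_nonneg (2 * m - n)]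
  have hmn0 : 0 ≤ m + n := by
    by_contra hneg
    have : (m + n) * (m ^ 2 - m * n + n ^ 2) < 0 := by nlinarith
    nlinarith [sq_nonneg z]
  obtain ⟨q, hq⟩ := sq_of n _ z hn0.le (hc1.mul_right hc2) hz
  have hq0 : q ≠ 0 := by rintro rfl; simp [hq] at hn0
  have hz2 : ∃ z : ℤ, (m + n) * (m ^ 2 - m * n + n ^ 2) = z ^ 2 := by
    have : q ∣ z := by
      rw [← Int.pow_dvd_pow_iff two_ne_zero, ← hz, hq]
      exact dvd_mul_right _ _
    obtain ⟨z', rfl⟩ := this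
    refine ⟨z', mul_left_cancel₀ hn0.ne' ?_⟩
    rw [hz, hq]
    ring
  obtain ⟨z, hz⟩ := hz2
  -- The gcd of the two remaining factors divides 3. If `m + n = 3c`, then `c = s²` and the quartic
  -- holds at `(q, s)`; otherwise `m + n = s²` and it holds at `(s, q)`.
  by_cases h3 : (3 : ℤ) ∣ m + n
  · obtain ⟨c, hc⟩ := h3
    have hm' : m = 3 * c - n := by linarith
    obtain ⟨z', rfl⟩ : (3 : ℤ) ∣ z := by
      refine Int.prime_three.dvd_of_dvd_pow (n := 2) ?_
      rw [← hz, hc]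
      exact ⟨_, mul_assoc _ _ _⟩
    have hcn : IsCoprime c n := by
      rw [hc] at hc1
      exact hc1.symm.of_mul_left_right
    have hcd : IsCoprime c (3 * c ^ 2 - 3 * c * n + n ^ 2) := by
      have := (hcn.pow_right (n := 2)).add_mul_left_right (3 * c - 3 * n)
      rwa [show n ^ 2 + c * (3 * c - 3 * n) = 3 * c ^ 2 - 3 * c * n + n ^ 2 by ring] at this
    have hcdz : c * (3 * c ^ 2 - 3 * c * n + n ^ 2) = z' ^ 2 := by
      rw [hm'] at hz
      linarith
    obtain ⟨s, hs⟩ := sq_of _ _ _ (by linarith) hcd hcdz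
    obtain ⟨t, ht⟩ := sq_of _ _ _ (by nlinarith [sq_nonneg (2 * m - n)]) hcd.symm
      ((mul_comm _ _).trans hcdz)
    rcases eq_or_ne s 0 with rfl | hs0
    · left
      have : m = - n := by rw [hm', hs]; ring
      rw [hX, this]
      push_cast
      field_simp
    · right; right
      have hcsq : IsCoprime q s := by
        rw [hs, hq] at hcn
        exact ((IsCoprime.pow_iff (by norm_num) (by norm_num)).1 hcn).symm
      obtain ⟨h1, h2⟩ := Int.sq_eq_one_of_quartic hcsq hs0 (t := t)
        (by rw [← ht, hs, hq]; ring)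
      rw [hX, hm', hq, hs, h1, h2]
      norm_num
  · right; left
    have hc3 : IsCoprime (m + n) (m ^ 2 - m * n + n ^ 2) := by
      have h1 : IsCoprime (m + n) 3 :=
        ((Int.prime_three.coprime_iff_not_dvd).2 h3).symm
      have h2 := (h1.mul_right (hc1.symm.pow_right (n := 2))).add_mul_left_right (m - 2 * n)
      rwa [show 3 * n ^ 2 + (m + n) * (m - 2 * n) = m ^ 2 - m * n + n ^ 2 by ring] at h2
    obtain ⟨s, hs⟩ := sq_of _ _ _ hmn0 hc3 hz
    obtain ⟨t, ht⟩ := sq_of _ _ _ hpos.le hc3.symm ((mul_comm _ _).trans hz)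
    have hcsq : IsCoprime s q := by
      rw [hs, hq] at hc1
      exact ((IsCoprime.pow_iff (by norm_num) (by norm_num)).1 hc1).symm
    obtain ⟨h1, h2⟩ := Int.sq_eq_one_of_quartic hcsq hq0 (t := t) <| by
      rw [← ht, show m = s ^ 2 - q ^ 2 by linarith, hq]
      ring
    rw [hX, show m = 0 by linarith]
    norm_num

/-! ### The function field of the level 6 curve. -/

namespace LevelSix

section

variable (F : Type*) [Field F]

/-- The coordinate `s` as a rational function of the parameter. -/
def sParam (F : Type*) [Field F] : RatFunc F := RatFunc.X * (RatFunc.X ^ 3 + 4) / (4 * (RatFunc.X ^ 3 + 1))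

/-- The coordinate `t` as a rational function of the parameter. -/
def tParam (F : Type*) [Field F] : RatFunc F := -(RatFunc.X ^ 3 + 1) ^ 2

theorem algebraMap_ne_zero_of_eval {p : F[X]} (x : F) (h : p.eval x ≠ 0) :
    algebraMap F[X] (RatFunc F) p ≠ 0 := by
  refine RatFunc.algebraMap_ne_zero ?_
  rintro rfl
  simp at h

theorem sParam_eq : sParam F = algebraMap F[X] (RatFunc F) (Polynomial.X ^ 4 + 4 * Polynomial.X) /
    algebraMap F[X] (RatFunc F) (4 * Polynomial.X ^ 3 + 4) := by
  rw [sParam]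
  simp only [map_add, map_mul, map_pow, RatFunc.algebraMap_X, map_ofNat]
  congr 1 <;> ring

theorem RatFunc.natDegree_num_div_of_isCoprime {p q : F[X]} (hq : q ≠ 0) (h : IsCoprime p q) :
    (algebraMap F[X] (RatFunc F) p / algebraMap F[X] (RatFunc F) q).num.natDegree = p.natDegree := by
  set f := algebraMap F[X] (RatFunc F) p / algebraMap F[X] (RatFunc F) q with hf
  have h1 : f.num * q = p * f.denom := by
    apply RatFunc.algebraMap_injective F
    have hd := RatFunc.algebraMap_ne_zero f.denom_ne_zero
    have hq' := RatFunc.algebraMap_ne_zero hq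
    have := f.num_div_denom
    rw [map_mul, map_mul]
    nth_rewrite 3 [hf] at this
    rwa [div_eq_div_iff hd hq'] at this
  have h2 : f.num ∣ p := f.isCoprime_num_denom.dvd_of_dvd_mul_right (h1 ▸ dvd_mul_right _ _)
  have h3 : p ∣ f.num := h.dvd_of_dvd_mul_right (h1 ▸ dvd_mul_right _ _)
  exact Polynomial.natDegree_eq_of_degree_eq
    (Polynomial.degree_eq_degree_of_associated (associated_of_dvd_dvd h2 h3))

variable [CharZero F]

theorem X_cube_add_one_ne_zero : (RatFunc.X ^ 3 + 1 : RatFunc F) ≠ 0 := by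
  have := algebraMap_ne_zero_of_eval F (p := Polynomial.X ^ 3 + 1) 1 (by norm_num)
  simpa using this

theorem sParam_tParam :
    2 ^ 10 * 3 ^ 3 * sParam F ^ 3 * (1 - 4 * sParam F ^ 3) * tParam F ^ 3 =
      27 * (tParam F + 1) * (tParam F + 9) ^ 3 := by
  have h := X_cube_add_one_ne_zero F
  rw [sParam, tParam]
  field_simp
  ring

/-- The function `s` has degree 4 in the parameter: its numerator has degree 4 and is prime to the
denominator. -/
theorem finrank_adjoin_sParam :
    4 ≤ Module.finrank (IntermediateField.adjoin F {sParam F}) (RatFunc F) := by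
  rw [RatFunc.finrank_eq_max_natDegree]
  refine le_max_of_le_left (Eq.ge ?_)
  rw [sParam_eq, RatFunc.natDegree_num_div_of_isCoprime]
  · compute_degree!
  · intro h
    have := congrArg (Polynomial.eval 0) h
    simp at this
  -- An explicit Bézout identity for `X⁴ + 4X` and `4X³ + 4`.
  · refine ⟨Polynomial.C (-1/3) * Polynomial.X ^ 2, Polynomial.C (1/12) * Polynomial.X ^ 3 + Polynomial.C (1/4), ?_⟩
    apply Polynomial.funext
    intro x
    simp
    ring

/-- With `r = X³ + 1` one has `t = -r²` and `8t(1 - 8s³) r = t² - 18t - 27`, so `r` is rational in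
`s` and `t`; then `X = 4sr/(r + 3)`. -/
theorem adjoin_sParam_tParam : IntermediateField.adjoin F {sParam F, tParam F} = ⊤ := by
  set K := IntermediateField.adjoin F {sParam F, tParam F} with hK
  have hs : sParam F ∈ K := IntermediateField.subset_adjoin _ _ (by simp)
  have ht : tParam F ∈ K := IntermediateField.subset_adjoin _ _ (by simp)
  have h0 := X_cube_add_one_ne_zero F
  have h1 : (RatFunc.X ^ 3 + 4 : RatFunc F) ≠ 0 := by
    have := algebraMap_ne_zero_of_eval F (p := Polynomial.X ^ 3 + Polynomial.C 4) 1 (by norm_num)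
    simpa [map_ofNat] using this
  have h2 : ((RatFunc.X ^ 3 + 1) ^ 4 + 18 * (RatFunc.X ^ 3 + 1) ^ 2 - 27 : RatFunc F) ≠ 0 := by
    have := algebraMap_ne_zero_of_eval F
      (p := (Polynomial.X ^ 3 + 1) ^ 4 + Polynomial.C 18 * (Polynomial.X ^ 3 + 1) ^ 2 - Polynomial.C 27) 0 (by norm_num)
    simpa [map_ofNat] using this
  have h3 : 8 * tParam F * (1 - 8 * sParam F ^ 3) =
      ((RatFunc.X ^ 3 + 1) ^ 4 + 18 * (RatFunc.X ^ 3 + 1) ^ 2 - 27) / (RatFunc.X ^ 3 + 1) := by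
    rw [sParam, tParam]
    field_simp
    ring
  have hr : (RatFunc.X ^ 3 + 1 : RatFunc F) =
      (tParam F ^ 2 - 18 * tParam F - 27) / (8 * tParam F * (1 - 8 * sParam F ^ 3)) := by
    rw [h3, eq_div_iff (div_ne_zero h2 h0), tParam]
    field_simp
    ring
  have hn : ∀ n : ℕ, (n : RatFunc F) ∈ K := fun n => natCast_mem K n
  have hrK : (RatFunc.X ^ 3 + 1 : RatFunc F) ∈ K := by
    rw [hr]
    exact div_mem (sub_mem (sub_mem (pow_mem ht 2) (mul_mem (hn 18) ht)) (hn 27))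
      (mul_mem (mul_mem (hn 8) ht) (sub_mem (one_mem K) (mul_mem (hn 8) (pow_mem hs 3))))
  have hX : (RatFunc.X : RatFunc F) = 4 * sParam F * (RatFunc.X ^ 3 + 1) / (RatFunc.X ^ 3 + 1 + 3) := by
    rw [show (RatFunc.X ^ 3 + 1 + 3 : RatFunc F) = RatFunc.X ^ 3 + 4 by ring, sParam]
    field_simp
  have hXK : (RatFunc.X : RatFunc F) ∈ K := by
    rw [hX]
    exact div_mem (mul_mem (mul_mem (hn 4) hs) hrK) (add_mem hrK (hn 3))
  rw [_root_.eq_top_iff, ← RatFunc.adjoin_X, IntermediateField.adjoin_simple_le_iff]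
  exact hXK

theorem natDegree_minpoly_tParam :
    4 ≤ (minpoly (IntermediateField.adjoin F {sParam F}) (tParam F)).natDegree := by
  have hfd : 4 ≤ Module.finrank (IntermediateField.adjoin F {sParam F}) (RatFunc F) :=
    finrank_adjoin_sParam F
  have : FiniteDimensional (IntermediateField.adjoin F {sParam F}) (RatFunc F) :=
    FiniteDimensional.of_finrank_pos (by omega)
  have htop : IntermediateField.adjoin (IntermediateField.adjoin F {sParam F}) {tParam F} = ⊤ := by
    rw [← IntermediateField.restrictScalars_eq_top_iff (K := F),
      IntermediateField.adjoin_adjoin_left, Set.singleton_union, adjoin_sParam_tParam F]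
  have hint : IsIntegral (IntermediateField.adjoin F {sParam F}) (tParam F) :=
    Algebra.IsIntegral.isIntegral _
  rw [← IntermediateField.adjoin.finrank hint, htop, IntermediateField.finrank_top']
  exact hfd

theorem transcendental_sParam : Transcendental F (sParam F) := by
  apply RatFunc.transcendental_of_ne_C
  rintro ⟨c, hc⟩
  have := finrank_adjoin_sParam F
  rw [hc, RatFunc.finrank_eq_max_natDegree, RatFunc.num_C, RatFunc.denom_C] at this
  simp at this

/-- Over `F(s)` the minimal polynomial of `t` has degree at least 4, so `1, t, t², t³` are
independent; `s` is transcendental, so the coefficients vanish as polynomials. -/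
theorem eq_zero_of_sum_eq_zero (p : Fin 4 → F[X])
    (h : ∑ i : Fin 4, Polynomial.eval₂ RatFunc.C (sParam F) (p i) * tParam F ^ (i : ℕ) = 0) : p = 0 := by
  let K := IntermediateField.adjoin F {sParam F}
  let σ : K := IntermediateField.AdjoinSimple.gen F (sParam F)
  let Q : K[X] := ∑ i : Fin 4, Polynomial.C (Polynomial.aeval σ (p i)) * Polynomial.X ^ (i : ℕ)
  have hσ : ∀ q : F[X], algebraMap K (RatFunc F) (Polynomial.aeval σ q) = Polynomial.aeval (sParam F) q := by
    intro q
    rw [← Polynomial.aeval_algebraMap_apply]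
    rfl
  have hQ : Polynomial.aeval (tParam F) Q = 0 := by
    rw [← h]
    simp only [Q, map_sum, map_mul, map_pow, Polynomial.aeval_X, Polynomial.aeval_C, hσ]
    rfl
  have hdeg : Q.natDegree ≤ 3 := by
    refine Polynomial.natDegree_sum_le_of_forall_le _ _ fun i _ => ?_
    refine (Polynomial.natDegree_C_mul_X_pow_le _ _).trans ?_
    omega
  have hQ0 : Q = 0 := by
    by_contra hne
    have h1 := Polynomial.natDegree_le_natDegree (minpoly.degree_le_of_ne_zero K (tParam F) hne hQ)
    exact absurd ((natDegree_minpoly_tParam F).trans (h1.trans hdeg)) (by norm_num)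
  funext i
  have hc : Q.coeff i = Polynomial.aeval σ (p i) := by
    simp only [Q, Polynomial.finsetSum_coeff, Polynomial.coeff_C_mul_X_pow]
    simp [Fin.val_inj]
  rw [hQ0, Polynomial.coeff_zero] at hc
  have : Polynomial.aeval (sParam F) (p i) = 0 := by rw [← hσ, ← hc, map_zero]
  exact (transcendental_iff.1 (transcendental_sParam F)) _ this

theorem exists_eq_div (z : RatFunc F) : ∃ r s : MvPolynomial (Fin 2) F,
    z = MvPolynomial.eval₂Hom RatFunc.C ![sParam F, tParam F] r /
      MvPolynomial.eval₂Hom RatFunc.C ![sParam F, tParam F] s := by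
  have hz : z ∈ IntermediateField.adjoin F (Set.range ![sParam F, tParam F]) := by
    rw [show Set.range ![sParam F, tParam F] = {sParam F, tParam F} by simp [Set.pair_comm],
      adjoin_sParam_tParam F]
    trivial
  exact (IntermediateField.mem_adjoin_range_iff F _ z).1 hz

end

/-- The parametrization of the curve, on the level of coordinate rings. -/
def param : MvPolynomial (Fin 2) ℚ →+* RatFunc ℚ :=
  MvPolynomial.eval₂Hom RatFunc.C ![sParam ℚ, tParam ℚ]

theorem param_levelSixPoly : param levelSixPoly = 0 := by
  rw [param, levelSixPoly]
  simp only [map_sub, map_mul, map_pow, map_ofNat, map_one, map_add, MvPolynomial.eval₂Hom_X']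
  simp only [Matrix.cons_val_zero, Matrix.cons_val_one]
  rw [sub_eq_zero]
  exact sParam_tParam ℚ

/-- Every polynomial is congruent to one of degree at most `3` in `t`. -/
theorem exists_reduced (F : MvPolynomial (Fin 2) ℚ) : ∃ p : Fin 4 → ℚ[X],
    F - ∑ i : Fin 4, Polynomial.aeval (MvPolynomial.X 0 : MvPolynomial (Fin 2) ℚ) (p i) *
      MvPolynomial.X 1 ^ (i : ℕ) ∈ Ideal.span {levelSixPoly} := by
  induction F using MvPolynomial.induction_on with
  | C a => exact ⟨![Polynomial.C a, 0, 0, 0], by simp [Fin.sum_univ_four, MvPolynomial.algebraMap_eq]⟩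
  | add F G hF hG =>
    obtain ⟨p, hp⟩ := hF
    obtain ⟨q, hq⟩ := hG
    refine ⟨p + q, ?_⟩
    convert add_mem hp hq using 1
    simp only [Pi.add_apply, map_add, add_mul, Finset.sum_add_distrib]
    ring
  | mul_X F n hF =>
    obtain ⟨p, hp⟩ := hF
    fin_cases n
    · refine ⟨fun i => p i * Polynomial.X, ?_⟩
      convert Ideal.mul_mem_right (MvPolynomial.X 0) _ hp using 1
      simp only [Fin.sum_univ_four, map_mul, Polynomial.aeval_X]
      simp
      ring
    -- Here `t⁴` is eliminated with `(t + 1)(t + 9)³ = t⁴ + 28t³ + 270t² + 972t + 729`; the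
    -- coefficient of `t⁴` in the equation is `-27`.
    · refine ⟨![-729 * p 3, p 0 - 972 * p 3, p 1 - 270 * p 3,
        p 2 + (2 ^ 10 * Polynomial.X ^ 3 * (1 - 4 * Polynomial.X ^ 3) - 28) * p 3], ?_⟩
      convert add_mem (Ideal.mul_mem_right (MvPolynomial.X 1) _ hp)
        (Ideal.mul_mem_left _ (MvPolynomial.C (-1/27) * Polynomial.aeval (MvPolynomial.X 0) (p 3))
          (Ideal.mem_span_singleton_self levelSixPoly)) using 1
      have h27 : (MvPolynomial.C (-1/27) : MvPolynomial (Fin 2) ℚ) * 27 = -1 := by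
        rw [← map_ofNat (MvPolynomial.C), ← map_mul]
        norm_num
      have hnum : ∀ n : ℕ, Polynomial.aeval (MvPolynomial.X 0 : MvPolynomial (Fin 2) ℚ) (n : ℚ[X]) = n :=
        fun n => map_natCast _ n
      have h2 := hnum 2
      have h4 := hnum 4
      have h28 := hnum 28
      have h270 := hnum 270
      have h972 := hnum 972
      have h729 := hnum 729
      push_cast at h2 h4 h28 h270 h972 h729
      simp [Fin.sum_univ_four, levelSixPoly, h2, h4, h28, h270, h972, h729]
      linear_combination (Polynomial.aeval (MvPolynomial.X 0) (p 3)) * ((MvPolynomial.X 1 + 1) *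
        (MvPolynomial.X 1 + 9) ^ 3 - 2 ^ 10 * MvPolynomial.X 0 ^ 3 * (1 - 4 * MvPolynomial.X 0 ^ 3)  * MvPolynomial.X 1 ^ 3) * h27

/-- Reduce an element of the kernel to degree at most 3 in `t` and use the independence of the
powers of `t`. Irreducibility of the equation is thereby obtained without a separate proof. -/
theorem ker_param : RingHom.ker param = Ideal.span {levelSixPoly} := by
  apply le_antisymm
  · intro F hF
    obtain ⟨p, hp⟩ := exists_reduced F
    have hle : Ideal.span {levelSixPoly} ≤ RingHom.ker param := by
      rw [Ideal.span_singleton_le_iff_mem]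
      exact param_levelSixPoly
    have h1 : param (∑ i : Fin 4, Polynomial.aeval (MvPolynomial.X 0 : MvPolynomial (Fin 2) ℚ) (p i) *
      MvPolynomial.X 1 ^ (i : ℕ)) = 0 := by
      have := hle hp
      rw [RingHom.mem_ker, map_sub, (RingHom.mem_ker).1 hF, zero_sub, neg_eq_zero] at this
      exact this
    have h2 : p = 0 := by
      apply eq_zero_of_sum_eq_zero ℚ
      rw [← h1, map_sum]
      refine Finset.sum_congr rfl fun i _ => ?_
      rw [map_mul, map_pow, Polynomial.aeval_def, Polynomial.hom_eval₂]
      congr 2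
      · ext a
        simp [param, MvPolynomial.algebraMap_eq]
      · simp [param]
      · simp [param]
    rw [h2] at hp
    simpa using hp
  · rw [Ideal.span_singleton_le_iff_mem]
    exact param_levelSixPoly

/-- The level 6 curve is rational. -/
theorem nonempty_functionField_ringEquiv : Nonempty (LevelSixFunctionField ≃+* RatFunc ℚ) := by
  let A := MvPolynomial (Fin 2) ℚ ⧸ Ideal.span {levelSixPoly}
  let ι : A →+* RatFunc ℚ := Ideal.Quotient.lift _ param fun a ha => by
    rw [← ker_param] at ha
    exact ha
  have hι : Function.Injective ι := by
    rw [injective_iff_map_eq_zero]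
    intro a ha
    obtain ⟨F, rfl⟩ := Ideal.Quotient.mk_surjective a
    rw [Ideal.Quotient.eq_zero_iff_mem, ← ker_param]
    exact ha
  let _ : Algebra A (RatFunc ℚ) := ι.toAlgebra
  have : FaithfulSMul A (RatFunc ℚ) := (faithfulSMul_iff_algebraMap_injective _ _).2 hι
  have : IsFractionRing A (RatFunc ℚ) := by
    refine IsFractionRing.of_field A (RatFunc ℚ) fun z => ?_
    obtain ⟨r, s, h⟩ := exists_eq_div ℚ z
    exact ⟨Ideal.Quotient.mk _ r, Ideal.Quotient.mk _ s, h⟩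
  exact ⟨(FractionRing.algEquiv A (RatFunc ℚ)).toRingEquiv⟩

theorem nonempty_functionField_algEquiv : Nonempty (LevelSixFunctionField ≃ₐ[ℚ] RatFunc ℚ) := by
  obtain ⟨e⟩ := nonempty_functionField_ringEquiv
  exact ⟨AlgEquiv.ofRingEquiv (f := e) fun q => RingHom.map_rat_algebraMap e.toRingHom q⟩

end LevelSix

/-! ### Division polynomials and addition formulas. -/

section

theorem ZMod.injective_three {α : Type*} {X : ZMod 3 → α} (h₁ : X 0 ≠ X 1) (h₂ : X 0 ≠ X 2)
    (h₃ : X 1 ≠ X 2) : Function.Injective X := by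
  intro i j hij
  fin_cases i <;> fin_cases j <;>
    first
    | rfl
    | exact absurd hij h₁
    | exact absurd hij h₂
    | exact absurd hij h₃
    | exact absurd hij.symm h₁
    | exact absurd hij.symm h₂
    | exact absurd hij.symm h₃

namespace WeierstrassCurve

section CommRing

variable {R : Type*} [CommRing R] (W : WeierstrassCurve R)

/-- The value `4x³ + b₂x² + 2b₄x + b₆` of the square of the 2-division polynomial. -/
def psiTwoSq (x : R) : R := 4 * x ^ 3 + W.b₂ * x ^ 2 + 2 * W.b₄ * x + W.b₆

/-- The value `3x⁴ + b₂x³ + 3b₄x² + 3b₆x + b₈` of the 3-division polynomial. -/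
def psiThree (x : R) : R :=
  3 * x ^ 4 + W.b₂ * x ^ 3 + 3 * W.b₄ * x ^ 2 + 3 * W.b₆ * x + W.b₈

variable {W} in
theorem Affine.Equation.sq_eq {x y : R} (h : W.toAffine.Equation x y) :
    (2 * y + W.a₁ * x + W.a₃) ^ 2 = W.psiTwoSq x := by
  rw [Affine.equation_iff] at h
  simp only [psiTwoSq, b₂, b₄, b₆]
  linear_combination 4 * h

end CommRing

section Field

variable {F : Type*} [Field F] {W : WeierstrassCurve F}

theorem Affine.equation_of_sq_eq (h2 : (2 : F) ≠ 0) {x y : F}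
    (h : (2 * y + W.a₁ * x + W.a₃) ^ 2 = W.psiTwoSq x) : W.toAffine.Equation x y := by
  rw [Affine.equation_iff]
  simp only [psiTwoSq, b₂, b₄, b₆] at h
  refine mul_left_cancel₀ (pow_ne_zero 2 h2) ?_
  linear_combination h

/-- At a common root the relation between the `bᵢ` becomes a perfect square equal to zero. This
expresses `b₄`, `b₆`, `b₈` through `b₂` and `x`, and `Δ` then vanishes. -/
theorem psiThree_ne_zero_or_psiTwoSq_ne_zero (hΔ : W.Δ ≠ 0) {x : F} (h3 : W.psiThree x = 0) :
    W.psiTwoSq x ≠ 0 := by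
  intro h2
  simp only [psiThree, psiTwoSq] at h2 h3
  have hb := W.b_relation
  have h6 : W.b₆ = -(4 * x ^ 3 + W.b₂ * x ^ 2 + 2 * W.b₄ * x) := by linear_combination h2
  have h8 : W.b₈ = -(3 * x ^ 4 + W.b₂ * x ^ 3 + 3 * W.b₄ * x ^ 2 + 3 * W.b₆ * x) := by
    linear_combination h3
  rw [h6] at h8
  rw [h6, h8] at hb
  have h4 : W.b₄ = -(W.b₂ * x + 6 * x ^ 2) := by
    have : (W.b₄ + (W.b₂ * x + 6 * x ^ 2)) ^ 2 = 0 := by linear_combination hb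
    have := (pow_eq_zero_iff two_ne_zero).1 this
    linear_combination this
  apply hΔ
  simp only [Δ]
  rw [h8, h6, h4]
  ring

theorem exists_vieta_psiTwoSq [CharZero F] [IsAlgClosed F] (hΔ : W.Δ ≠ 0) : ∃ e : ZMod 3 → F,
    Function.Injective e ∧ ∀ x, W.psiTwoSq x = 4 * (x - e 0) * (x - e 1) * (x - e 2) := by
  have h4 : (algebraMap F F) W.twoTorsionPolynomial.a ≠ 0 := by simp [twoTorsionPolynomial]
  have ha : W.twoTorsionPolynomial.a ≠ 0 := by simp [twoTorsionPolynomial]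
  have hs : (W.twoTorsionPolynomial.toPoly.map (RingHom.id F)).Splits := IsAlgClosed.splits _
  obtain ⟨x, y, z, h3⟩ := (Cubic.splits_iff_roots_eq_three ha).1 hs
  have hd := (Cubic.discr_ne_zero_iff_roots_ne ha h3).1 (by
    rw [twoTorsionPolynomial_discr]
    exact mul_ne_zero (by norm_num) hΔ)
  have hb := Cubic.b_eq_three_roots ha h3
  have hc := Cubic.c_eq_three_roots ha h3
  have hd' := Cubic.d_eq_three_roots ha h3
  simp only [twoTorsionPolynomial, RingHom.id_apply] at hb hc hd'
  refine ⟨![x, y, z], ?_, fun w => ?_⟩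
  · obtain ⟨h1, h2, h3⟩ := hd
    exact ZMod.injective_three h1 h2 h3
  · change W.psiTwoSq w = 4 * (w - x) * (w - y) * (w - z)
    simp only [psiTwoSq]
    rw [hb, hc, hd']
    ring

/-- A root of the `3`-division polynomial splits off. -/
theorem exists_vieta_psiThree [CharZero F] [IsAlgClosed F] (hΔ : W.Δ ≠ 0) {x₁ : F}
    (hx₁ : W.psiThree x₁ = 0) : ∃ X : ZMod 3 → F, Function.Injective X ∧ (∀ k, X k ≠ x₁) ∧
      ∀ x, W.psiThree x = 3 * (x - x₁) * ((x - X 0) * (x - X 1) * (x - X 2)) := by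
  -- The quotient of the 3-division polynomial by `x - x₁`.
  let P : Cubic F := ⟨3, W.b₂ + 3 * x₁, 3 * W.b₄ + x₁ * (W.b₂ + 3 * x₁),
    3 * W.b₆ + x₁ * (3 * W.b₄ + x₁ * (W.b₂ + 3 * x₁))⟩
  have ha : P.a ≠ 0 := by simp [P]
  have hs : (P.toPoly.map (RingHom.id F)).Splits := IsAlgClosed.splits _
  obtain ⟨x, y, z, h3⟩ := (Cubic.splits_iff_roots_eq_three ha).1 hs
  have hb := Cubic.b_eq_three_roots ha h3
  have hc := Cubic.c_eq_three_roots ha h3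
  have hd := Cubic.d_eq_three_roots ha h3
  simp only [P, RingHom.id_apply] at hb hc hd
  have hfac : ∀ w, W.psiThree w = 3 * (w - x₁) * ((w - x) * (w - y) * (w - z)) := by
    intro w
    have : 3 * ((w - x) * (w - y) * (w - z)) = 3 * w ^ 3 + (W.b₂ + 3 * x₁) * w ^ 2 +
        (3 * W.b₄ + x₁ * (W.b₂ + 3 * x₁)) * w +
        (3 * W.b₆ + x₁ * (3 * W.b₄ + x₁ * (W.b₂ + 3 * x₁))) := by
      linear_combination -w ^ 2 * hb - w * hc - hd
    simp only [psiThree] at hx₁ ⊢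
    linear_combination hx₁ - (w - x₁) * this
  -- The left side is the derivative of the 3-division polynomial, so a repeated root would be a
  -- common root of both division polynomials.
  have hder : ∀ w, 3 * W.psiTwoSq w = 3 * ((w - x) * (w - y) * (w - z)) +
      3 * (w - x₁) * ((w - y) * (w - z) + (w - x) * (w - z) + (w - x) * (w - y)) := by
    intro w
    have hb' : W.b₂ = -3 * (x₁ + x + y + z) := by linear_combination hb
    rw [hb'] at hc hd
    have hc' : 3 * W.b₄ = 3 * (x * y + x * z + y * z) + 3 * x₁ * (x + y + z) := by
      linear_combination hc
    have hd' : 3 * W.b₆ = - 3 * (x * y * z) - 3 * x₁ * (x * y + x * z + y * z) := by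
      linear_combination hd - x₁ * hc'
    simp only [psiTwoSq]
    rw [hb']
    linear_combination 2 * w * hc' + hd'
  have hne : ∀ w, W.psiThree w = 0 → 3 * ((w - x) * (w - y) * (w - z)) +
      3 * (w - x₁) * ((w - y) * (w - z) + (w - x) * (w - z) + (w - x) * (w - y)) ≠ 0 := by
    intro w hw
    rw [← hder]
    exact mul_ne_zero (by norm_num) (psiThree_ne_zero_or_psiTwoSq_ne_zero hΔ hw)
  have hx := hne x (by rw [hfac]; ring)
  have hy := hne y (by rw [hfac]; ring)
  have hz := hne z (by rw [hfac]; ring)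
  have hxy : x ≠ y := by rintro rfl; apply hx; ring
  have hxz : x ≠ z := by rintro rfl; apply hx; ring
  have hyz : y ≠ z := by rintro rfl; apply hy; ring
  have hx1 : x ≠ x₁ := by rintro rfl; apply hx; ring
  have hy1 : y ≠ x₁ := by rintro rfl; apply hy; ring
  have hz1 : z ≠ x₁ := by rintro rfl; apply hz; ring
  refine ⟨![x, y, z], ?_, ?_, fun w => hfac w⟩
  · exact ZMod.injective_three hxy hxz hyz
  · intro k
    fin_cases k
    · exact hx1
    · exact hy1
    · exact hz1

variable [DecidableEq F]

open WeierstrassCurve.Affine.Point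

/-- The sum and the product of `x(P + Q)` and `x(P - Q)` depend only on `x(P)` and `x(Q)`. All later
estimates rest on these two identities, which avoid the `y`-coordinates. -/
theorem exists_add_sub_eq {x₁ y₁ x₂ y₂ : F} (h₁ : W.toAffine.Nonsingular x₁ y₁)
    (h₂ : W.toAffine.Nonsingular x₂ y₂) (hx : x₁ ≠ x₂) :
    ∃ (x₃ y₃ x₄ y₄ : F) (h₃ : W.toAffine.Nonsingular x₃ y₃) (h₄ : W.toAffine.Nonsingular x₄ y₄),
      some x₁ y₁ h₁ + some x₂ y₂ h₂ = some x₃ y₃ h₃ ∧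
      some x₁ y₁ h₁ - some x₂ y₂ h₂ = some x₄ y₄ h₄ ∧
      (x₃ + x₄) * (x₁ - x₂) ^ 2 =
        2 * x₁ * x₂ * (x₁ + x₂) + W.b₂ * x₁ * x₂ + W.b₄ * (x₁ + x₂) + W.b₆ ∧
      x₃ * x₄ * (x₁ - x₂) ^ 2 =
        x₁ ^ 2 * x₂ ^ 2 - W.b₄ * x₁ * x₂ - W.b₆ * (x₁ + x₂) - W.b₈ := by
  have hx' : x₁ - x₂ ≠ 0 := sub_ne_zero.2 hx
  have e₁ := (Affine.equation_iff _ _).1 h₁.1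
  have e₂ := (Affine.equation_iff _ _).1 h₂.1
  refine ⟨_, _, _, _, _, _, add_of_X_ne hx, by rw [sub_eq_add_neg, neg_some, add_of_X_ne hx], ?_, ?_⟩
  · simp only [Affine.addX, Affine.slope_of_X_ne hx, Affine.negY]
    field_simp
    simp only [b₂, b₄, b₆]
    linear_combination 2 * e₁ + 2 * e₂
  · simp only [Affine.addX, Affine.slope_of_X_ne hx, Affine.negY]
    set A := y₁ - y₂ with hA
    set B := y₁ - (-y₂ - W.a₁ * x₂ - W.a₃) with hB
    set d := x₁ - x₂ with hd
    set c := W.a₂ + x₁ + x₂ with hc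
    set g := x₁ ^ 2 + x₁ * x₂ + x₂ ^ 2 + W.a₂ * (x₁ + x₂) + W.a₄ with hg
    -- `A / d` and `B / d` are the slopes for `P + Q` and `P - Q`; subtracting the two curve
    -- equations gives their product.
    have hAB : A * B = d * (g - W.a₁ * y₁) := by
      rw [hA, hB, hd, hg]
      linear_combination e₁ - e₂
    have hprod : (A ^ 2 + W.a₁ * A * d - c * d ^ 2) * (B ^ 2 + W.a₁ * B * d - c * d ^ 2) =
        d ^ 2 * (x₁ ^ 2 * x₂ ^ 2 - W.b₄ * x₁ * x₂ - W.b₆ * (x₁ + x₂) - W.b₈) := by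
      have hQ : (g - W.a₁ * y₁) ^ 2 + W.a₁ * (g - W.a₁ * y₁) * (A + B) - c * (A + B) ^ 2 +
          2 * c * d * (g - W.a₁ * y₁) + W.a₁ ^ 2 * d * (g - W.a₁ * y₁) - W.a₁ * c * d * (A + B) +
          c ^ 2 * d ^ 2 = x₁ ^ 2 * x₂ ^ 2 - W.b₄ * x₁ * x₂ - W.b₆ * (x₁ + x₂) - W.b₈ := by
        rw [hA, hB, hd, hc, hg]
        simp only [b₄, b₆, b₈]
        linear_combination -(W.a₁ ^ 2 + 4 * (W.a₂ + x₁ + x₂)) * e₁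
      linear_combination d ^ 2 * hQ + (A * B + d * (g - W.a₁ * y₁) + W.a₁ * d * (A + B) +
        2 * c * d ^ 2 + W.a₁ ^ 2 * d ^ 2) * hAB
    have h3 : (A / d) ^ 2 + W.a₁ * (A / d) - W.a₂ - x₁ - x₂ =
        (A ^ 2 + W.a₁ * A * d - c * d ^ 2) / d ^ 2 := by
      rw [hc]
      field_simp
      ring
    have h4 : (B / d) ^ 2 + W.a₁ * (B / d) - W.a₂ - x₁ - x₂ =
        (B ^ 2 + W.a₁ * B * d - c * d ^ 2) / d ^ 2 := by
      rw [hc]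
      field_simp
      ring
    rw [h3, h4, div_mul_div_comm, hprod]
    field_simp

/-- The duplication formula in the form `x(2P) - x(P) = -ψ₃ / ψ₂²`; it makes `3P = 0` equivalent to
`ψ₃ = 0`. -/
theorem addX_slope_self_sub {x y : F} (h : W.toAffine.Nonsingular x y)
    (hy : y ≠ W.toAffine.negY x y) :
    (W.toAffine.addX x x (W.toAffine.slope x x y y) - x) * W.psiTwoSq x = - W.psiThree x := by
  have hy' : 2 * y + W.a₁ * x + W.a₃ ≠ 0 := by
    intro h0
    apply hy
    simp only [Affine.negY]
    linear_combination h0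
  have hy'' : y - (-y - W.a₁ * x - W.a₃) ≠ 0 := by
    intro h0
    apply hy'
    linear_combination h0
  have e := (Affine.equation_iff _ _).1 h.1
  rw [← h.1.sq_eq, Affine.slope_of_Y_ne rfl hy]
  simp only [Affine.addX, Affine.negY, psiThree]
  rw [show y - (-y - W.a₁ * x - W.a₃) = 2 * y + W.a₁ * x + W.a₃ by ring]
  have gen : ∀ n D a c : F, D ≠ 0 → ((n / D) ^ 2 + a * (n / D) - c - x - x - x) * D ^ 2 =
      n ^ 2 + a * n * D - (c + 3 * x) * D ^ 2 := by
    intro n D a c hD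
    field_simp
    ring
  rw [gen _ _ _ _ hy']
  simp only [b₂, b₄, b₆, b₈]
  linear_combination -(W.a₁ ^ 2 + 4 * (W.a₂ + 3 * x)) * e

theorem Affine.Point.two_nsmul_some_eq_zero_iff {x y : F} (h : W.toAffine.Nonsingular x y) :
    2 • some x y h = 0 ↔ W.psiTwoSq x = 0 := by
  rw [two_nsmul, add_eq_zero_iff_eq_neg, neg_some, ← h.1.sq_eq, pow_eq_zero_iff two_ne_zero]
  simp only [some.injEq, true_and, Affine.negY]
  constructor <;> intro h <;> linear_combination h

theorem Affine.Point.three_nsmul_some_eq_zero_iff (hΔ : W.Δ ≠ 0) {x y : F}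
    (h : W.toAffine.Nonsingular x y) : 3 • some x y h = 0 ↔ W.psiThree x = 0 := by
  by_cases hy : y = W.toAffine.negY x y
  · have h2 : 2 • some x y h = 0 := by
      rw [two_nsmul]
      exact add_self_of_Y_eq hy
    rw [show (3 : ℕ) = 2 + 1 from rfl, add_nsmul, h2, zero_add, one_nsmul]
    refine ⟨fun h0 => absurd h0 (some_ne_zero h), fun h3 => ?_⟩
    exact absurd ((two_nsmul_some_eq_zero_iff h).1 h2) (psiThree_ne_zero_or_psiTwoSq_ne_zero hΔ h3)
  · have h2 : W.psiTwoSq x ≠ 0 := by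
      intro h0
      rw [← two_nsmul_some_eq_zero_iff h, two_nsmul, add_eq_zero_iff_eq_neg, neg_some] at h0
      simp only [some.injEq, true_and] at h0
      exact hy h0
    have key := addX_slope_self_sub h hy
    have hadd := add_self_of_Y_ne (W := W.toAffine) (h₁ := h) hy
    rw [show (3 : ℕ) = 2 + 1 from rfl, add_nsmul, one_nsmul, add_eq_zero_iff_eq_neg, two_nsmul]
    have hX := X_eq_iff (W := W.toAffine) (h₁ := Affine.nonsingular_add h h fun hxy => hy hxy.2) (h₂ := h)
    rw [← hadd] at hX
    constructor
    · intro h0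
      have := hX.2 (Or.inr h0)
      rw [this, sub_self, zero_mul] at key
      linear_combination key
    · intro h0
      rw [h0, _root_.neg_zero] at key
      rcases mul_eq_zero.1 key with h4 | h4
      · rcases hX.1 (sub_eq_zero.1 h4) with h5 | h5
        · exact absurd (add_eq_right.1 h5) (some_ne_zero h)
        · exact h5
      · exact absurd h4 h2

end Field
end WeierstrassCurve

end

/-! ### Automorphisms, and CM for `j = 0` and `j = 1728`. -/

namespace WeierstrassCurve

section Field

variable {F : Type*} [Field F] {W : WeierstrassCurve F}

/-- Choose `s`, `r`, `t` in turn so that `a₁`, `a₂`, `a₃` are preserved. Then `b₂` is preserved, and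
`c₄`, `c₆` determine the remaining coefficients in characteristic 0. -/
theorem exists_variableChange_smul_eq_self [CharZero F] (u : Fˣ) (h₄ : (u⁻¹ : Fˣ) ^ 4 * W.c₄ = W.c₄)
    (h₆ : (u⁻¹ : Fˣ) ^ 6 * W.c₆ = W.c₆) : ∃ C : VariableChange F, C.u = u ∧ C • W = W := by
  let s : F := (u * W.a₁ - W.a₁) / 2
  let r : F := (u ^ 2 * W.a₂ - W.a₂ + s * W.a₁ + s ^ 2) / 3
  let t : F := (u ^ 3 * W.a₃ - W.a₃ - r * W.a₁) / 2
  let C : VariableChange F := ⟨u, r, s, t⟩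
  have hu : (u : F) * (u⁻¹ : Fˣ) = 1 := u.mul_inv
  have h1 : (C • W).a₁ = W.a₁ := by
    rw [variableChange_a₁]
    change (u⁻¹ : Fˣ) * (W.a₁ + 2 * s) = W.a₁
    rw [show W.a₁ + 2 * s = u * W.a₁ by simp only [s]; ring]
    linear_combination W.a₁ * hu
  have h2 : (C • W).a₂ = W.a₂ := by
    rw [variableChange_a₂]
    change (u⁻¹ : Fˣ) ^ 2 * (W.a₂ - s * W.a₁ + 3 * r - s ^ 2) = W.a₂
    rw [show W.a₂ - s * W.a₁ + 3 * r - s ^ 2 = u ^ 2 * W.a₂ by simp only [r]; ring, ← mul_assoc,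
      ← mul_pow, mul_comm _ (u : F), hu]
    ring
  have h3 : (C • W).a₃ = W.a₃ := by
    rw [variableChange_a₃]
    change (u⁻¹ : Fˣ) ^ 3 * (W.a₃ + r * W.a₁ + 2 * t) = W.a₃
    rw [show W.a₃ + r * W.a₁ + 2 * t = u ^ 3 * W.a₃ by simp only [t]; ring, ← mul_assoc,
      ← mul_pow, mul_comm _ (u : F), hu]
    ring
  have hc4 : (C • W).c₄ = W.c₄ := by rw [variableChange_c₄]; exact h₄
  have hc6 : (C • W).c₆ = W.c₆ := by rw [variableChange_c₆]; exact h₆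
  have hb2 : (C • W).b₂ = W.b₂ := by simp only [b₂, h1, h2]
  have hb4 : (C • W).b₄ = W.b₄ := by
    simp only [c₄, hb2] at hc4
    linear_combination -hc4 / 24
  have hb6 : (C • W).b₆ = W.b₆ := by
    simp only [c₆, hb2, hb4] at hc6
    linear_combination -hc6 / 216
  have h4 : (C • W).a₄ = W.a₄ := by
    simp only [b₄, h1, h3] at hb4
    linear_combination hb4 / 2
  have h6 : (C • W).a₆ = W.a₆ := by
    simp only [b₆, h3] at hb6
    linear_combination hb6 / 4
  exact ⟨C, rfl, WeierstrassCurve.ext h1 h2 h3 h4 h6⟩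

theorem VariableChange.relations {C : VariableChange F} (hC : C • W = W) :
    W.a₁ + 2 * C.s = C.u * W.a₁ ∧
    W.a₂ - C.s * W.a₁ + 3 * C.r - C.s ^ 2 = C.u ^ 2 * W.a₂ ∧
    W.a₃ + C.r * W.a₁ + 2 * C.t = C.u ^ 3 * W.a₃ ∧
    W.a₄ - C.s * W.a₃ + 2 * C.r * W.a₂ - (C.t + C.r * C.s) * W.a₁ + 3 * C.r ^ 2
      - 2 * C.s * C.t = C.u ^ 4 * W.a₄ ∧
    W.a₆ + C.r * W.a₄ + C.r ^ 2 * W.a₂ + C.r ^ 3 - C.t * W.a₃ - C.t ^ 2 - C.r * C.t * W.a₁ =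
      C.u ^ 6 * W.a₆ := by
  have h1 := congrArg WeierstrassCurve.a₁ hC
  have h2 := congrArg WeierstrassCurve.a₂ hC
  have h3 := congrArg WeierstrassCurve.a₃ hC
  have h4 := congrArg WeierstrassCurve.a₄ hC
  have h6 := congrArg WeierstrassCurve.a₆ hC
  rw [variableChange_a₁] at h1
  rw [variableChange_a₂] at h2
  rw [variableChange_a₃] at h3
  rw [variableChange_a₄] at h4
  rw [variableChange_a₆] at h6
  have hu : ∀ (n : ℕ) (a b : F), ((C.u⁻¹ : Fˣ) : F) ^ n * a = b → a = (C.u : F) ^ n * b := by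
    rintro n a b rfl
    rw [← mul_assoc, ← mul_pow, Units.mul_inv, one_pow, one_mul]
  exact ⟨by simpa using hu 1 _ _ (by rw [pow_one]; exact h1), hu 2 _ _ h2, hu 3 _ _ h3, hu 4 _ _ h4, hu 6 _ _ h6⟩

open WeierstrassCurve.Affine.Point

namespace VariableChange

theorem equation_map {C : VariableChange F} (hC : C • W = W) {x y : F}
    (h : W.toAffine.Equation x y) :
    W.toAffine.Equation (C.u ^ 2 * x + C.r) (C.u ^ 3 * y + C.u ^ 2 * C.s * x + C.t) := by
  obtain ⟨h1, h2, h3, h4, h6⟩ := relations hC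
  rw [Affine.equation_iff] at h ⊢
  change y ^ 2 + W.a₁ * x * y + W.a₃ * y = x ^ 3 + W.a₂ * x ^ 2 + W.a₄ * x + W.a₆ at h
  change (C.u ^ 3 * y + C.u ^ 2 * C.s * x + C.t) ^ 2 + W.a₁ * (C.u ^ 2 * x + C.r) *
    (C.u ^ 3 * y + C.u ^ 2 * C.s * x + C.t) + W.a₃ * (C.u ^ 3 * y + C.u ^ 2 * C.s * x + C.t) =
    (C.u ^ 2 * x + C.r) ^ 3 + W.a₂ * (C.u ^ 2 * x + C.r) ^ 2 + W.a₄ * (C.u ^ 2 * x + C.r) + W.a₆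
  linear_combination C.u ^ 6 * h + C.u ^ 5 * x * y * h1 - C.u ^ 4 * x ^ 2 * h2 + C.u ^ 3 * y * h3
    - C.u ^ 2 * x * h4 - h6

variable [DecidableEq F]

/-- The automorphism of the points given by a change of variables fixing the curve. -/
def pointMapFun [W.IsElliptic] {C : VariableChange F} (hC : C • W = W) :
    W.toAffine.Point → W.toAffine.Point
  | .zero => .zero
  | .some x y h => .some (C.u ^ 2 * x + C.r) (C.u ^ 3 * y + C.u ^ 2 * C.s * x + C.t)
      ((Affine.equation_iff_nonsingular).1 (equation_map hC h.1))

/-- An affine change of coordinates preserves collinearity: a chord or tangent of slope `ℓ` goes to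
one of slope `u ℓ + s`. -/
theorem pointMapFun_add [W.IsElliptic] {C : VariableChange F} (hC : C • W = W) (P Q : W.toAffine.Point) :
    pointMapFun hC (P + Q) = pointMapFun hC P + pointMapFun hC Q := by
  obtain ⟨e1, e2, e3, e4, e6⟩ := relations hC
  have hu : (C.u : F) ≠ 0 := C.u.ne_zero
  rcases P with _ | ⟨x₁, y₁, h₁⟩
  · change pointMapFun hC (0 + Q) = 0 + pointMapFun hC Q
    rw [zero_add, zero_add]
  rcases Q with _ | ⟨x₂, y₂, h₂⟩
  · change pointMapFun hC (_ + 0) = pointMapFun hC _ + 0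
    rw [add_zero, add_zero]
  have hX : C.u ^ 2 * x₁ + C.r = C.u ^ 2 * x₂ + C.r ↔ x₁ = x₂ := by
    rw [add_left_inj, mul_right_inj' (pow_ne_zero 2 hu)]
  have hD' : ∀ x y y' : F, C.u ^ 3 * y + C.u ^ 2 * C.s * x + C.t - W.toAffine.negY (C.u ^ 2 * x + C.r)
      (C.u ^ 3 * y' + C.u ^ 2 * C.s * x + C.t) = C.u ^ 3 * (y - W.toAffine.negY x y') := by
    intro x y y'
    simp only [Affine.negY]
    linear_combination C.u ^ 2 * x * e1 + e3
  have hY : x₁ = x₂ → (C.u ^ 3 * y₁ + C.u ^ 2 * C.s * x₁ + C.t = W.toAffine.negY (C.u ^ 2 * x₂ + C.r)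
      (C.u ^ 3 * y₂ + C.u ^ 2 * C.s * x₂ + C.t) ↔ y₁ = W.toAffine.negY x₂ y₂) := by
    rintro rfl
    rw [← sub_eq_zero, hD', mul_eq_zero_iff_left (pow_ne_zero 3 hu), sub_eq_zero]
  by_cases hxy : x₁ = x₂ ∧ y₁ = W.toAffine.negY x₂ y₂
  · rw [add_of_Y_eq hxy.1 hxy.2]
    exact (add_of_Y_eq (hX.2 hxy.1) ((hY hxy.1).2 hxy.2)).symm
  · have hxy' : ¬(C.u ^ 2 * x₁ + C.r = C.u ^ 2 * x₂ + C.r ∧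
        C.u ^ 3 * y₁ + C.u ^ 2 * C.s * x₁ + C.t = W.toAffine.negY (C.u ^ 2 * x₂ + C.r)
      (C.u ^ 3 * y₂ + C.u ^ 2 * C.s * x₂ + C.t)) := by
      rintro ⟨h1, h2⟩
      exact hxy ⟨hX.1 h1, (hY (hX.1 h1)).1 h2⟩
    have hslope : W.toAffine.slope (C.u ^ 2 * x₁ + C.r) (C.u ^ 2 * x₂ + C.r)
        (C.u ^ 3 * y₁ + C.u ^ 2 * C.s * x₁ + C.t) (C.u ^ 3 * y₂ + C.u ^ 2 * C.s * x₂ + C.t) =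
        C.u * W.toAffine.slope x₁ x₂ y₁ y₂ + C.s := by
      by_cases hx : x₁ = x₂
      · have hy : y₁ ≠ W.toAffine.negY x₂ y₂ := fun hy => hxy ⟨hx, hy⟩
        rw [Affine.slope_of_Y_ne hx hy, Affine.slope_of_Y_ne (hX.2 hx) (fun h => hy ((hY hx).1 h))]
        obtain rfl := hx
        have hyy := Affine.Y_eq_of_Y_ne h₁.1 h₂.1 rfl hy
        subst hyy
        have hD : y₁ - W.toAffine.negY x₁ y₁ ≠ 0 := sub_ne_zero.2 hy
        rw [hD', div_eq_iff (mul_ne_zero (pow_ne_zero 3 hu) hD)]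
        have hgen : ∀ n D u s : F, D ≠ 0 → (u * (n / D) + s) * (u ^ 3 * D) = u ^ 4 * n + s * u ^ 3 * D := by
          intro n D u s hD
          field_simp
        rw [hgen _ _ _ _ hD]
        simp only [Affine.negY]
        linear_combination 2 * C.u ^ 2 * x₁ * e2 + e4 - C.u ^ 3 * y₁ * e1 + C.s * C.u ^ 2 * x₁ * e1 + C.s * e3
      · rw [Affine.slope_of_X_ne hx, Affine.slope_of_X_ne (fun h => hx (hX.1 h))]
        have hd : x₁ - x₂ ≠ 0 := sub_ne_zero.2 hx
        rw [show C.u ^ 2 * x₁ + C.r - (C.u ^ 2 * x₂ + C.r) = C.u ^ 2 * (x₁ - x₂) by ring]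
        field_simp
        ring
    rw [add_some hxy]
    refine Eq.trans ?_ (add_some hxy').symm
    simp only [pointMapFun]
    set ℓ := W.toAffine.slope x₁ x₂ y₁ y₂ with hℓ
    rw [some.injEq, hslope]
    have hx : C.u ^ 2 * W.toAffine.addX x₁ x₂ ℓ + C.r =
        W.toAffine.addX (C.u ^ 2 * x₁ + C.r) (C.u ^ 2 * x₂ + C.r) (C.u * ℓ + C.s) := by
      simp only [Affine.addX]
      linear_combination -C.u * ℓ * e1 + e2
    refine ⟨hx, ?_⟩
    rw [Affine.addY, Affine.negAddY, Affine.addY, Affine.negAddY, ← hx]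
    simp only [Affine.negY]
    linear_combination C.u ^ 2 * W.toAffine.addX x₁ x₂ ℓ * e1 + e3

/-- The automorphism of the group of points given by a change of variables fixing the curve. -/
def pointMap [W.IsElliptic] {C : VariableChange F} (hC : C • W = W) :
    W.toAffine.Point →+ W.toAffine.Point where
  toFun := pointMapFun hC
  map_zero' := rfl
  map_add' := pointMapFun_add hC

/-- Multiplication by an integer fixes or kills each 2-torsion point. The map `x ↦ u²x + r` with `u²
≠ 1` fixes at most one `x`, hence moves some 2-torsion point to another nonzero point. -/
theorem pointMap_ne_zsmul [CharZero F] [IsAlgClosed F] [W.IsElliptic] {C : VariableChange F} (hC : C • W = W)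
    (hu : (C.u : F) ^ 2 ≠ 1) (n : ℤ) : pointMap hC ≠ n • AddMonoidHom.id W.toAffine.Point := by
  intro hn
  obtain ⟨e, he, hroot⟩ := exists_vieta_psiTwoSq (W := W) W.isUnit_Δ.ne_zero
  obtain ⟨x, hx0, hx⟩ : ∃ x, W.psiTwoSq x = 0 ∧ C.u ^ 2 * x + C.r ≠ x := by
    by_contra! hall
    have h0 := hall (e 0) (by rw [hroot]; ring)
    have h1 := hall (e 1) (by rw [hroot]; ring)
    have h2 : ((C.u : F) ^ 2 - 1) * (e 0 - e 1) = 0 := by linear_combination h0 - h1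
    rcases mul_eq_zero.1 h2 with h3 | h3
    · exact hu (sub_eq_zero.1 h3)
    · exact absurd (he (sub_eq_zero.1 h3)) (by decide)
  have heq : W.toAffine.Equation x (-(W.a₁ * x + W.a₃) / 2) := by
    refine Affine.equation_of_sq_eq two_ne_zero ?_
    rw [hx0]
    field_simp
    ring
  have hns := (Affine.equation_iff_nonsingular).1 heq
  have h2 := (two_nsmul_some_eq_zero_iff hns).2 hx0
  have hP : some _ _ ((Affine.equation_iff_nonsingular).1 (equation_map hC heq)) =
      n • some _ _ hns := DFunLike.congr_fun hn (some _ _ hns)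
  rcases Int.even_or_odd' n with ⟨k, rfl | rfl⟩
  · have h0 : (2 * k) • some _ _ hns = 0 := by
      rw [mul_comm (2 : ℤ) k, mul_zsmul, ofNat_zsmul, h2, zsmul_zero]
    exact some_ne_zero _ (hP.trans h0)
  · have h0 : (2 * k + 1) • some _ _ hns = some _ _ hns := by
      rw [add_zsmul, one_zsmul, mul_comm (2 : ℤ) k, mul_zsmul, ofNat_zsmul, h2, zsmul_zero,
        zero_add]
    exact hx (Affine.Point.some.inj (hP.trans h0)).1

end VariableChange
end Field
end WeierstrassCurve

instance : Algebra.IsAlgebraic ℚ Qbar := by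
  have h := AlgebraicClosure.isAlgebraic ℚ
  convert! h

instance : IsAlgClosure ℚ Qbar := ⟨inferInstance, inferInstance⟩

instance : IsGalois ℚ Qbar := IsAlgClosure.isGalois ℚ Qbar

instance (E : WeierstrassCurve ℚ) [E.IsElliptic] : (E⁄Qbar).IsElliptic :=
  inferInstanceAs (E.map (algebraMap ℚ Qbar)).IsElliptic

theorem WeierstrassCurve.hasCM_of_unit (E : WeierstrassCurve ℚ) [E.IsElliptic] (u : Qbarˣ)
    (hu : (u : Qbar) ^ 2 ≠ 1) (h₄ : (u : Qbar) ^ 4 = 1 ∨ E.c₄ = 0) (h₆ : (u : Qbar) ^ 6 = 1 ∨ E.c₆ = 0) :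
    HasCM E := by
  have hinv : ∀ n : ℕ, (u : Qbar) ^ n = 1 → ((u⁻¹ : Qbarˣ) : Qbar) ^ n = 1 := by
    intro n hn
    rw [Units.val_inv_eq_inv_val, inv_pow, hn, inv_one]
  obtain ⟨C, hCu, hC⟩ := exists_variableChange_smul_eq_self (W := E⁄Qbar) u
    (by
      rcases h₄ with h | h
      · rw [hinv 4 h, one_mul]
      · rw [show (E⁄Qbar).c₄ = algebraMap ℚ Qbar E.c₄ from E.map_c₄ _, h, map_zero, mul_zero])
    (by
      rcases h₆ with h | h
      · rw [hinv 6 h, one_mul]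
      · rw [show (E⁄Qbar).c₆ = algebraMap ℚ Qbar E.c₆ from E.map_c₆ _, h, map_zero, mul_zero])
  refine ⟨VariableChange.pointMap hC, Or.inr ⟨.C (.C ((C.u : Qbar) ^ 2) * .X + .C C.r), 1,
    .C (.C ((C.u : Qbar) ^ 3)) * .X + .C (.C ((C.u : Qbar) ^ 2 * C.s) * .X + .C C.t), 1, ?_⟩,
    VariableChange.pointMap_ne_zsmul hC (by rw [hCu]; exact hu)⟩
  refine (Set.finite_singleton (0 : QbarPoints E)).subset fun P hP => ?_
  rcases P with _ | ⟨x, y, h⟩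
  · rfl
  · refine absurd ⟨x, y, _, _, h, _, rfl, rfl, ?_⟩ hP
    simp [Polynomial.evalEval, add_assoc]

theorem WeierstrassCurve.hasCM_of_j_eq_zero (E : WeierstrassCurve ℚ) [E.IsElliptic] (h : E.j = 0) :
    HasCM E := by
  rw [j_eq_zero_iff] at h
  obtain ⟨z, hz⟩ := HasEnoughRootsOfUnity.exists_primitiveRoot Qbar 3
  refine E.hasCM_of_unit (Units.mk0 z (hz.ne_zero (by norm_num))) ?_ (Or.inr h) (Or.inl ?_)
  · exact hz.pow_ne_one_of_pos_of_lt (by norm_num) (by norm_num)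
  · change z ^ 6 = 1
    rw [show 6 = 3 * 2 from rfl, pow_mul, hz.pow_eq_one, one_pow]

theorem WeierstrassCurve.hasCM_of_c₆_eq_zero (E : WeierstrassCurve ℚ) [E.IsElliptic] (h : E.c₆ = 0) :
    HasCM E := by
  obtain ⟨z, hz⟩ := HasEnoughRootsOfUnity.exists_primitiveRoot Qbar 4
  refine E.hasCM_of_unit (Units.mk0 z (hz.ne_zero (by norm_num))) ?_ (Or.inl hz.pow_eq_one) (Or.inr h)
  exact hz.pow_ne_one_of_pos_of_lt (by norm_num) (by norm_num)

/-! ### Rational functions and rational maps on `y² = x³ + d (x + b)²`. -/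

section

/-- The curve `y² = x³ + d (x + b)²`. -/
def nodalCurve {R : Type*} [CommRing R] (d b : R) : WeierstrassCurve R :=
  ⟨0, d, 0, 2 * d * b, d * b ^ 2⟩

namespace nodalCurve

open Filter Polynomial WeierstrassCurve.Affine

theorem map_eq {R S : Type*} [CommRing R] [CommRing S] (f : R →+* S) (d b : R) :
    (nodalCurve d b).map f = nodalCurve (f d) (f b) := by
  ext <;> simp [nodalCurve, map_ofNat]

section Invariants

variable {R : Type*} [CommRing R] (d b : R)

theorem b₂_eq : (nodalCurve d b).b₂ = 4 * d := by simp [nodalCurve, WeierstrassCurve.b₂]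
theorem b₄_eq : (nodalCurve d b).b₄ = 4 * d * b := by
  simp [nodalCurve, WeierstrassCurve.b₄]; ring
theorem b₆_eq : (nodalCurve d b).b₆ = 4 * d * b ^ 2 := by
  simp [nodalCurve, WeierstrassCurve.b₆]; ring
theorem b₈_eq : (nodalCurve d b).b₈ = 0 := by
  simp [nodalCurve, WeierstrassCurve.b₈]; ring
theorem Δ_eq : (nodalCurve d b).Δ = 16 * d ^ 2 * b ^ 3 * (4 * d - 27 * b) := by
  rw [WeierstrassCurve.Δ, b₂_eq, b₄_eq, b₆_eq, b₈_eq]; ring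
theorem c₄_eq : (nodalCurve d b).c₄ = 16 * d * (d - 6 * b) := by
  rw [WeierstrassCurve.c₄, b₂_eq, b₄_eq]; ring

end Invariants

variable {F : Type*} [Field F] {d b : F}

theorem equation_iff {x y : F} :
    (nodalCurve d b).toAffine.Equation x y ↔ y ^ 2 = x ^ 3 + d * (x + b) ^ 2 := by
  rw [WeierstrassCurve.Affine.equation_iff]
  simp only [nodalCurve]
  constructor <;> intro h <;> linear_combination h

theorem negY_eq (x y : F) : (nodalCurve d b).toAffine.negY x y = -y := by
  simp [nodalCurve, negY]

/-- The `x`-coordinate of a point, with the value `0` at infinity. -/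
def xCoord : (nodalCurve d b).toAffine.Point → F
  | .zero => 0
  | .some x _ _ => x

/-- The `y`-coordinate of a point, with the value `0` at infinity. -/
def yCoord : (nodalCurve d b).toAffine.Point → F
  | .zero => 0
  | .some _ y _ => y

theorem yCoord_sq {P : (nodalCurve d b).toAffine.Point} (hP : P ≠ 0) :
    yCoord P ^ 2 = xCoord P ^ 3 + d * (xCoord P + b) ^ 2 := by
  rcases P with _ | ⟨x, y, h⟩
  · exact absurd rfl hP
  · exact equation_iff.1 h.1

/-- The default coordinates `(0, 0)` at infinity are not on the affine curve because `d b² ≠ 0`. So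
the coordinates detect the point at infinity. -/
theorem ne_zero_iff (hd : d ≠ 0) (hb : b ≠ 0) {P : (nodalCurve d b).toAffine.Point} :
    P ≠ 0 ↔ yCoord P ^ 2 = xCoord P ^ 3 + d * (xCoord P + b) ^ 2 := by
  refine ⟨yCoord_sq, ?_⟩
  rintro h rfl
  have h0 : d * b ^ 2 = 0 := by
    change (0 : F) ^ 2 = 0 ^ 3 + d * (0 + b) ^ 2 at h
    linear_combination -h
  exact mul_ne_zero hd (pow_ne_zero 2 hb) h0

theorem coord_injective (hd : d ≠ 0) (hb : b ≠ 0) :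
    Function.Injective fun P : (nodalCurve d b).toAffine.Point => (xCoord P, yCoord P) := by
  intro P Q h
  have h1 : xCoord P = xCoord Q := congrArg Prod.fst h
  have h2 : yCoord P = yCoord Q := congrArg Prod.snd h
  have hiff : P ≠ 0 ↔ Q ≠ 0 := by rw [ne_zero_iff hd hb, ne_zero_iff hd hb, h1, h2]
  rcases P with _ | ⟨x, y, hP⟩
  · by_contra hQ
    exact hiff.2 (Ne.symm hQ) rfl
  rcases Q with _ | ⟨x', y', hQ⟩
  · exact absurd rfl (hiff.1 (Point.some_ne_zero _))
  · obtain rfl : x = x' := h1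
    obtain rfl : y = y' := h2
    rfl

theorem xCoord_neg (P : (nodalCurve d b).toAffine.Point) : xCoord (-P) = xCoord P := by
  rcases P with _ | ⟨x, y, hP⟩ <;> rfl

theorem yCoord_neg (P : (nodalCurve d b).toAffine.Point) : yCoord (-P) = -yCoord P := by
  rcases P with _ | ⟨x, y, hP⟩
  · exact neg_zero.symm
  · exact negY_eq x y

/-- The polynomial `x³ + d (x + b)²`. -/
def cubic (d b : F) : F[X] := X ^ 3 + C d * (X + C b) ^ 2

theorem eval_cubic (x : F) : (cubic d b).eval x = x ^ 3 + d * (x + b) ^ 2 := by simp [cubic]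

theorem natDegree_cubic : (cubic d b).natDegree = 3 := by
  unfold cubic
  compute_degree!

/-- This is the norm of `A + B y` down to `F(x)`; the two terms have degrees of different parity. -/
theorem norm_ne_zero {A B : F[X]} (h : B ≠ 0 ∨ A ≠ 0) : A ^ 2 - B ^ 2 * cubic d b ≠ 0 := by
  intro h0
  have h1 : A ^ 2 = B ^ 2 * cubic d b := sub_eq_zero.1 h0
  have hc : cubic d b ≠ 0 := by
    intro h; have := natDegree_cubic (d := d) (b := b); simp [h] at this
  by_cases hB : B = 0
  · subst hB
    have : A = 0 := by simpa using h1
    simp [this] at h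
  · have h2 := congrArg natDegree h1
    rw [natDegree_pow, natDegree_mul (pow_ne_zero 2 hB) hc, natDegree_pow, natDegree_cubic] at h2
    omega

section Finite

variable [IsAlgClosed F]

theorem exists_point (hΔ : (nodalCurve d b).Δ ≠ 0) (x : F) :
    ∃ P : (nodalCurve d b).toAffine.Point, P ≠ 0 ∧ xCoord P = x := by
  obtain ⟨y, hy⟩ := IsAlgClosed.exists_pow_nat_eq (x ^ 3 + d * (x + b) ^ 2) (n := 2) two_pos
  exact ⟨.some x y (equation_iff_nonsingular_of_Δ_ne_zero hΔ |>.1 (equation_iff.2 hy)),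
    Point.some_ne_zero _, rfl⟩

theorem infinite_point (hΔ : (nodalCurve d b).Δ ≠ 0) :
    Infinite (nodalCurve d b).toAffine.Point :=
  Infinite.of_surjective xCoord fun x => let ⟨P, hP⟩ := exists_point hΔ x; ⟨P, hP.2⟩

end Finite

theorem finite_xCoord_eq (hd : d ≠ 0) (hb : b ≠ 0) (x : F) :
    {P : (nodalCurve d b).toAffine.Point | xCoord P = x}.Finite := by
  have hfin : ({x} ×ˢ {y | y = 0 ∨ IsRoot (X ^ 2 - C (x ^ 3 + d * (x + b) ^ 2)) y} : Set (F × F)).Finite := by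
    refine (Set.finite_singleton x).prod ((Set.finite_singleton 0).union ?_)
    exact finite_setOfPred_isRoot (X_pow_sub_C_ne_zero two_pos _)
  refine (hfin.preimage (coord_injective hd hb).injOn).subset ?_
  intro P hP
  obtain rfl : xCoord P = x := hP
  refine ⟨rfl, ?_⟩
  by_cases h : P = 0
  · exact Or.inl (by rw [h]; rfl)
  · exact Or.inr (by simp [yCoord_sq h])

theorem eventually_eval_ne_zero (hd : d ≠ 0) (hb : b ≠ 0) {p : F[X]} (hp : p ≠ 0) :
    ∀ᶠ P : (nodalCurve d b).toAffine.Point in cofinite, p.eval (xCoord P) ≠ 0 := by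
  rw [eventually_cofinite]
  refine ((finite_setOfPred_isRoot hp).biUnion fun x _ => finite_xCoord_eq hd hb x).subset ?_
  intro P hP
  rw [Set.mem_iUnion₂]
  exact ⟨xCoord P, not_not.1 hP, rfl⟩

theorem eventually_ne_zero :
    ∀ᶠ P : (nodalCurve d b).toAffine.Point in cofinite, P ≠ 0 := by
  rw [eventually_cofinite]
  exact (Set.finite_singleton 0).subset fun P hP => not_not.1 hP

/-- A function on the points which, away from a finite set, is a rational function of the
coordinates. -/
def IsRational (g : (nodalCurve d b).toAffine.Point → F) : Prop :=
  ∃ p q r : F[X], r ≠ 0 ∧ ∀ᶠ P in cofinite,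
    g P * r.eval (xCoord P) = p.eval (xCoord P) + q.eval (xCoord P) * yCoord P

namespace IsRational

variable {g h : (nodalCurve d b).toAffine.Point → F}

theorem congr (hg : IsRational g) (hgh : ∀ᶠ P in cofinite, g P = h P) : IsRational h := by
  obtain ⟨p, q, r, hr, hp⟩ := hg
  refine ⟨p, q, r, hr, ?_⟩
  filter_upwards [hp, hgh] with P h1 h2
  rw [← h2, h1]

theorem const (c : F) : IsRational (fun _ : (nodalCurve d b).toAffine.Point => c) :=
  ⟨C c, 0, 1, one_ne_zero, .of_forall fun P => by simp⟩

theorem x : IsRational (xCoord : (nodalCurve d b).toAffine.Point → F) :=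
  ⟨X, 0, 1, one_ne_zero, .of_forall fun P => by simp⟩

theorem y : IsRational (yCoord : (nodalCurve d b).toAffine.Point → F) :=
  ⟨0, 1, 1, one_ne_zero, .of_forall fun P => by simp⟩

theorem add (hg : IsRational g) (hh : IsRational h) : IsRational fun P => g P + h P := by
  obtain ⟨p, q, r, hr, hp⟩ := hg
  obtain ⟨p', q', r', hr', hp'⟩ := hh
  refine ⟨p * r' + p' * r, q * r' + q' * r, r * r', mul_ne_zero hr hr', ?_⟩
  filter_upwards [hp, hp'] with P h1 h2
  simp only [eval_add, eval_mul]
  linear_combination r'.eval (xCoord P) * h1 + r.eval (xCoord P) * h2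

theorem mul (hg : IsRational g) (hh : IsRational h) : IsRational fun P => g P * h P := by
  obtain ⟨p, q, r, hr, hp⟩ := hg
  obtain ⟨p', q', r', hr', hp'⟩ := hh
  refine ⟨p * p' + q * q' * cubic d b, p * q' + p' * q, r * r', mul_ne_zero hr hr', ?_⟩
  filter_upwards [hp, hp', eventually_ne_zero] with P h1 h2 h3
  have := yCoord_sq h3
  simp only [eval_add, eval_mul, eval_cubic]
  calc g P * h P * (r.eval (xCoord P) * r'.eval (xCoord P))
      = (g P * r.eval (xCoord P)) * (h P * r'.eval (xCoord P)) := by ring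
    _ = _ := by
      rw [h1, h2]
      linear_combination q.eval (xCoord P) * q'.eval (xCoord P) * this

theorem neg (hg : IsRational g) : IsRational fun P => -g P := by
  simpa using (const (-1)).mul hg

theorem sub (hg : IsRational g) (hh : IsRational h) : IsRational fun P => g P - h P := by
  simpa [sub_eq_add_neg] using hg.add hh.neg

theorem pow (hg : IsRational g) (n : ℕ) : IsRational fun P => g P ^ n := by
  induction n with
  | zero => simpa using const 1
  | succ n ih => simpa [pow_succ] using ih.mul hg

/-- If `g = (p + q y) / r`, then away from finitely many points a zero of `g` is a zero of the norm
`p² - q² f`, which is a nonzero polynomial in `x` unless `p = q = 0`. -/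
theorem dichotomy (hd : d ≠ 0) (hb : b ≠ 0) (hg : IsRational g) :
    (∀ᶠ P in cofinite, g P = 0) ∨ ∀ᶠ P in cofinite, g P ≠ 0 := by
  obtain ⟨p, q, r, hr, hp⟩ := hg
  by_cases h : q ≠ 0 ∨ p ≠ 0
  · right
    filter_upwards [hp, eventually_eval_ne_zero hd hb (norm_ne_zero (d := d) (b := b) h),
      eventually_ne_zero] with P h1 h2 h3 h4
    rw [h4, zero_mul] at h1
    apply h2
    simp only [eval_sub, eval_mul, eval_pow, eval_cubic]
    rw [← yCoord_sq h3]
    linear_combination -(p.eval (xCoord P) - q.eval (xCoord P) * yCoord P) * h1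
  · left
    push Not at h
    filter_upwards [hp, eventually_eval_ne_zero hd hb hr] with P h1 h2
    simpa [h.1, h.2, h2] using h1

theorem inv (hd : d ≠ 0) (hb : b ≠ 0) (hg : IsRational g) : IsRational fun P => (g P)⁻¹ := by
  rcases hg.dichotomy hd hb with h0 | h0
  · refine (const 0).congr ?_
    filter_upwards [h0] with P hP
    rw [hP, inv_zero]
  obtain ⟨p, q, r, hr, hp⟩ := hg
  by_cases h : q ≠ 0 ∨ p ≠ 0
  · refine ⟨r * p, -(r * q), p ^ 2 - q ^ 2 * cubic d b, norm_ne_zero h, ?_⟩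
    filter_upwards [hp, h0, eventually_ne_zero] with P h1 h2 h3
    simp only [eval_sub, eval_mul, eval_pow, eval_cubic, eval_neg]
    rw [← yCoord_sq h3, inv_mul_eq_iff_eq_mul₀ h2]
    linear_combination -(p.eval (xCoord P) - q.eval (xCoord P) * yCoord P) * h1
  · push Not at h
    refine (const 0).congr ?_
    filter_upwards [hp, eventually_eval_ne_zero hd hb hr, h0] with P h1 h2 h3
    simp [h.1, h.2, h2, h3] at h1

theorem div (hd : d ≠ 0) (hb : b ≠ 0) (hg : IsRational g) (hh : IsRational h) :
    IsRational fun P => g P / h P := by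
  simpa [div_eq_mul_inv] using hg.mul (hh.inv hd hb)

theorem evalEval (p : F[X][X]) :
    IsRational fun P : (nodalCurve d b).toAffine.Point => p.evalEval (xCoord P) (yCoord P) := by
  induction p using Polynomial.induction_on' with
  | add p q hp hq => simpa using hp.add hq
  | monomial n a =>
    have h : IsRational fun P : (nodalCurve d b).toAffine.Point => a.eval (xCoord P) := by
      induction a using Polynomial.induction_on' with
      | add p q hp hq => simpa using hp.add hq
      | monomial n a => simpa using (const a).mul (x.pow n)
    simpa [Polynomial.evalEval] using h.mul (y.pow n)

end IsRational

section Group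

/-- A map on the points whose coordinates are rational. -/
def IsRationalMap (φ : (nodalCurve d b).toAffine.Point → (nodalCurve d b).toAffine.Point) : Prop :=
  IsRational (fun P => xCoord (φ P)) ∧ IsRational (fun P => yCoord (φ P))

namespace IsRationalMap

variable {φ ψ : (nodalCurve d b).toAffine.Point → (nodalCurve d b).toAffine.Point}

theorem congr (hφ : IsRationalMap φ) (h : ∀ᶠ P in cofinite, φ P = ψ P) : IsRationalMap ψ :=
  ⟨hφ.1.congr (by filter_upwards [h] with P hP; rw [hP]),
    hφ.2.congr (by filter_upwards [h] with P hP; rw [hP])⟩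

theorem zero : IsRationalMap fun _ : (nodalCurve d b).toAffine.Point => 0 :=
  ⟨.const 0, .const 0⟩

theorem id : IsRationalMap fun P : (nodalCurve d b).toAffine.Point => P := ⟨.x, .y⟩

theorem neg (hφ : IsRationalMap φ) : IsRationalMap fun P => -φ P := by
  refine ⟨?_, ?_⟩
  · simpa [xCoord_neg] using hφ.1
  · simpa [yCoord_neg] using hφ.2.neg

/-- Membership of the coordinates in the affine curve is the vanishing of a rational function, and
infinity is the one point where it fails. -/
theorem dichotomy (hd : d ≠ 0) (hb : b ≠ 0) (hφ : IsRationalMap φ) :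
    (∀ᶠ P in cofinite, φ P = 0) ∨ ∀ᶠ P in cofinite, φ P ≠ 0 := by
  have h : IsRational fun P => yCoord (φ P) ^ 2 - (xCoord (φ P) ^ 3 + d * (xCoord (φ P) + b) ^ 2) :=
    (hφ.2.pow 2).sub ((hφ.1.pow 3).add ((IsRational.const d).mul ((hφ.1.add (.const b)).pow 2)))
  rcases h.dichotomy hd hb with h | h
  · right
    filter_upwards [h] with P hP
    rw [ne_zero_iff hd hb]
    exact sub_eq_zero.1 hP
  · left
    filter_upwards [h] with P hP
    by_contra h0
    exact hP (sub_eq_zero.2 ((ne_zero_iff hd hb).1 h0))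

variable [DecidableEq F]

/-- By the dichotomies a single case of the addition law applies outside a finite set; in each case
the slope is a rational function. -/
theorem add (hd : d ≠ 0) (hb : b ≠ 0) (hφ : IsRationalMap φ) (hψ : IsRationalMap ψ) :
    IsRationalMap fun P => φ P + ψ P := by
  rcases hφ.dichotomy hd hb with hφ0 | hφ0
  · refine hψ.congr ?_
    filter_upwards [hφ0] with P hP
    rw [hP, zero_add]
  rcases hψ.dichotomy hd hb with hψ0 | hψ0
  · refine hφ.congr ?_
    filter_upwards [hψ0] with P hP
    rw [hP, add_zero]
  have key : ∀ ℓ : (nodalCurve d b).toAffine.Point → F, IsRational ℓ →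
      (∀ᶠ P in cofinite, ¬(xCoord (φ P) = xCoord (ψ P) ∧ yCoord (φ P) = - yCoord (ψ P)) ∧
        (nodalCurve d b).toAffine.slope (xCoord (φ P)) (xCoord (ψ P)) (yCoord (φ P))
          (yCoord (ψ P)) = ℓ P) → IsRationalMap fun P => φ P + ψ P := by
    intro ℓ hℓ h
    have hx : IsRational fun P => ℓ P ^ 2 - d - xCoord (φ P) - xCoord (ψ P) :=
      (((hℓ.pow 2).sub (.const d)).sub hφ.1).sub hψ.1
    have hy : IsRational fun P => -(ℓ P * ((ℓ P ^ 2 - d - xCoord (φ P) - xCoord (ψ P)) -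
        xCoord (φ P)) + yCoord (φ P)) := ((hℓ.mul (hx.sub hφ.1)).add hφ.2).neg
    have hadd : ∀ᶠ P in cofinite,
        xCoord (φ P + ψ P) = ℓ P ^ 2 - d - xCoord (φ P) - xCoord (ψ P) ∧
        yCoord (φ P + ψ P) = -(ℓ P * ((ℓ P ^ 2 - d - xCoord (φ P) - xCoord (ψ P)) -
          xCoord (φ P)) + yCoord (φ P)) := by
      filter_upwards [hφ0, hψ0, h] with P h1 h2 h3
      obtain ⟨h3, h4⟩ := h3
      rw [← h4]
      generalize φ P = A at *
      generalize ψ P = B at *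
      rcases A with _ | ⟨x₁, y₁, hA⟩
      · exact absurd rfl h1
      rcases B with _ | ⟨x₂, y₂, hB⟩
      · exact absurd rfl h2
      have h5 : ¬(x₁ = x₂ ∧ y₁ = (nodalCurve d b).toAffine.negY x₂ y₂) := by
        rw [negY_eq]; exact h3
      rw [Point.add_some h5]
      simp only [xCoord, yCoord, addX, addY, negAddY, negY_eq]
      simp [nodalCurve]
    exact ⟨hx.congr (hadd.mono fun P hP => hP.1.symm), hy.congr (hadd.mono fun P hP => hP.2.symm)⟩
  rcases (hφ.1.sub hψ.1).dichotomy hd hb with hx | hx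
  · rcases (hφ.2.add hψ.2).dichotomy hd hb with hy | hy
    · refine zero.congr ?_
      filter_upwards [hφ0, hψ0, hx, hy] with P h1 h2 h3 h4
      rw [eq_comm, add_eq_zero_iff_eq_neg]
      apply coord_injective hd hb
      simp only [xCoord_neg, yCoord_neg]
      rw [sub_eq_zero.1 h3, add_eq_zero_iff_eq_neg.1 h4]
    · refine key (fun P => (3 * xCoord (φ P) ^ 2 + 2 * d * xCoord (φ P) + 2 * d * b) /
        (yCoord (φ P) + yCoord (φ P))) ?_ ?_
      · exact ((((IsRational.const 3).mul (hφ.1.pow 2)).add ((IsRational.const (2 * d)).mul hφ.1)).add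
          (.const (2 * d * b))).div hd hb (hφ.2.add hφ.2)
      · filter_upwards [hφ0, hψ0, hx, hy] with P h1 h2 h3 h4
        have h5 : yCoord (φ P) ≠ -yCoord (ψ P) := fun h => h4 (by rw [h]; ring)
        refine ⟨fun h => h5 h.2, ?_⟩
        rw [slope_of_Y_ne (sub_eq_zero.1 h3) (by rwa [negY_eq])]
        rw [negY_eq]
        simp [nodalCurve]
  · refine key (fun P => (yCoord (φ P) - yCoord (ψ P)) / (xCoord (φ P) - xCoord (ψ P)))
      ((hφ.2.sub hψ.2).div hd hb (hφ.1.sub hψ.1)) ?_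
    filter_upwards [hx] with P h3
    exact ⟨fun h => h3 (sub_eq_zero.2 h.1), slope_of_X_ne fun h => h3 (sub_eq_zero.2 h)⟩

theorem zsmul (hd : d ≠ 0) (hb : b ≠ 0) (hφ : IsRationalMap φ) (n : ℤ) :
    IsRationalMap fun P => n • φ P := by
  have h : ∀ n : ℕ, IsRationalMap fun P => n • φ P := by
    intro n
    induction n with
    | zero => simpa using zero
    | succ n ih => simpa [succ_nsmul] using ih.add hd hb hφ
  rcases n with n | n
  · simpa using h n
  · simpa using (h (n + 1)).neg

omit [DecidableEq F] in
theorem exists_isCoprime_of_ne_zero (p : F[X]) {r : F[X]} (hr : r ≠ 0) :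
    ∃ p' r', IsCoprime p' r' ∧ ∃ g, p = g * p' ∧ r = g * r' := by
  classical
  have hg : EuclideanDomain.gcd p r ≠ 0 := fun h => hr (EuclideanDomain.gcd_eq_zero_iff.1 h).2
  obtain ⟨p', hp'⟩ := EuclideanDomain.gcd_dvd_left p r
  obtain ⟨r', hr'⟩ := EuclideanDomain.gcd_dvd_right p r
  refine ⟨p', r', ⟨EuclideanDomain.gcdA p r, EuclideanDomain.gcdB p r, ?_⟩, _, hp', hr'⟩
  apply mul_left_cancel₀ hg
  have := EuclideanDomain.gcd_eq_gcd_ab p r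
  generalize EuclideanDomain.gcd p r = g at *
  linear_combination -this + EuclideanDomain.gcdA p r * (-hp') + EuclideanDomain.gcdB p r * (-hr')

/-- A homomorphism commutes with negation, so `x ∘ φ` is even; averaging over `P` and `-P` removes
the term in `y`. -/
theorem exists_xCoord_eq [CharZero F] (hd : d ≠ 0) (hb : b ≠ 0) {φ : (nodalCurve d b).toAffine.Point →+ (nodalCurve d b).toAffine.Point}
    (hφ : IsRationalMap φ) :
    ∃ p r : F[X], r ≠ 0 ∧ IsCoprime p r ∧ ∀ᶠ P in cofinite,
      xCoord (φ P) * r.eval (xCoord P) = p.eval (xCoord P) := by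
  obtain ⟨p, q, r, hr, h⟩ := hφ.1
  have hneg : ∀ᶠ P : (nodalCurve d b).toAffine.Point in cofinite, xCoord (φ P) * r.eval (xCoord P) =
      p.eval (xCoord P) - q.eval (xCoord P) * yCoord P := by
    have h' := (neg_injective (G := (nodalCurve d b).toAffine.Point)).tendsto_cofinite.eventually h
    filter_upwards [h'] with P hP
    rw [map_neg, xCoord_neg, xCoord_neg, yCoord_neg] at hP
    rw [hP]; ring
  have h2 : ∀ᶠ P : (nodalCurve d b).toAffine.Point in cofinite,
      xCoord (φ P) * r.eval (xCoord P) = p.eval (xCoord P) := by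
    filter_upwards [h, hneg] with P h1 h2
    linear_combination (h1 + h2) / 2
  obtain ⟨p', r', hc, g, hp', hr'⟩ := exists_isCoprime_of_ne_zero p hr
  subst hp' hr'
  refine ⟨p', r', right_ne_zero_of_mul hr, hc, ?_⟩
  filter_upwards [h2, eventually_eval_ne_zero hd hb (left_ne_zero_of_mul hr)] with P h1 h2
  rw [eval_mul, eval_mul] at h1
  apply mul_left_cancel₀ h2
  linear_combination h1

end IsRationalMap
end Group
end nodalCurve

end

/-! ### Ultrametric estimates for the group law at a node. -/

section

section Ultrametric

variable {F : Type*} [NormedField F] [IsUltrametricDist F]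

theorem norm_add_eq_left_of_lt {x y : F} (h : ‖y‖ < ‖x‖) : ‖x + y‖ = ‖x‖ := by
  rw [IsUltrametricDist.norm_add_eq_max_of_norm_ne_norm h.ne', max_eq_left h.le]

theorem norm_sub_eq_left_of_lt {x y : F} (h : ‖y‖ < ‖x‖) : ‖x - y‖ = ‖x‖ := by
  rw [sub_eq_add_neg, norm_add_eq_left_of_lt (by rwa [norm_neg])]

theorem norm_add_lt_of_lt {x y : F} {r : ℝ} (hx : ‖x‖ < r) (hy : ‖y‖ < r) : ‖x + y‖ < r :=
  (IsUltrametricDist.norm_add_le_max x y).trans_lt (max_lt hx hy)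

theorem norm_sub_lt_of_lt {x y : F} {r : ℝ} (hx : ‖x‖ < r) (hy : ‖y‖ < r) : ‖x - y‖ < r := by
  rw [sub_eq_add_neg]
  exact norm_add_lt_of_lt hx (by rwa [norm_neg])

theorem norm_add_le_of_le_of_le {x y : F} {r : ℝ} (hx : ‖x‖ ≤ r) (hy : ‖y‖ ≤ r) : ‖x + y‖ ≤ r :=
  (IsUltrametricDist.norm_add_le_max x y).trans (max_le hx hy)

theorem norm_sub_le_of_le_of_le {x y : F} {r : ℝ} (hx : ‖x‖ ≤ r) (hy : ‖y‖ ≤ r) : ‖x - y‖ ≤ r := by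
  rw [sub_eq_add_neg]
  exact norm_add_le_of_le_of_le hx (by rwa [norm_neg])

theorem norm_eq_or_norm_add_eq (x y : F) :
    ‖x‖ = ‖y‖ ∨ (‖y‖ < ‖x‖ ∧ ‖x + y‖ = ‖x‖) ∨ (‖x‖ < ‖y‖ ∧ ‖x + y‖ = ‖y‖) := by
  rcases lt_trichotomy ‖x‖ ‖y‖ with h | h | h
  · exact Or.inr (Or.inr ⟨h, by rw [add_comm, norm_add_eq_left_of_lt h]⟩)
  · exact Or.inl h
  · exact Or.inr (Or.inl ⟨h, norm_add_eq_left_of_lt h⟩)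

/-- This and the next two lemmas are the Newton polygon of a quadratic polynomial; they are applied
to `x(P + Q)` and `x(P - Q)`. -/
theorem norm_lt_one_of_norm_add_of_norm_mul {x y : F} (ha : ‖x + y‖ < 1) (hm : ‖x * y‖ < 1) :
    ‖x‖ < 1 ∧ ‖y‖ < 1 := by
  rw [norm_mul] at hm
  rcases norm_eq_or_norm_add_eq x y with h | ⟨h, h'⟩ | ⟨h, h'⟩
  · rw [h] at hm ⊢
    have : ‖y‖ < 1 := by nlinarith [norm_nonneg y]
    exact ⟨this, this⟩
  · rw [h'] at ha
    exact ⟨ha, h.trans ha⟩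
  · rw [h'] at ha
    exact ⟨h.trans ha, ha⟩

theorem norm_eq_of_norm_add_of_norm_mul {x y : F} {s : ℝ} (hs : 0 < s) (ha : ‖x + y‖ ≤ s)
    (hm : ‖x * y‖ = s ^ 2) : ‖x‖ = s ∧ ‖y‖ = s := by
  rw [norm_mul] at hm
  rcases norm_eq_or_norm_add_eq x y with h | ⟨h, h'⟩ | ⟨h, h'⟩
  · rw [h] at hm ⊢
    have : ‖y‖ = s := by nlinarith [norm_nonneg y]
    exact ⟨this, this⟩
  · rw [h'] at ha
    nlinarith [norm_nonneg x, norm_nonneg y]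
  · rw [h'] at ha
    nlinarith [norm_nonneg x, norm_nonneg y]

theorem norm_eq_div_of_norm_add_of_norm_mul {x y : F} {r s : ℝ} (hr : 0 < r) (hs : 0 < s)
    (hs1 : s < 1) (ha : ‖x + y‖ = r / s) (hm : ‖x * y‖ = r ^ 2) : ‖x‖ = r / s ∨ ‖y‖ = r / s := by
  rw [norm_mul] at hm
  rcases norm_eq_or_norm_add_eq x y with h | ⟨h, h'⟩ | ⟨h, h'⟩
  · exfalso
    have h1 : ‖x + y‖ ≤ ‖y‖ := norm_add_le_of_le_of_le h.le le_rfl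
    rw [ha] at h1
    have h2 : ‖y‖ = r := by rw [h] at hm; nlinarith [norm_nonneg y]
    rw [h2, div_le_iff₀ hs] at h1
    nlinarith
  · exact Or.inl (h'.symm.trans ha)
  · exact Or.inr (h'.symm.trans ha)

end Ultrametric

/-- The reduction of `y² = x³ + d (x + b)²` is a node at the origin. -/
structure IsNodal {F : Type*} [NormedField F] (d b : F) : Prop where
  norm_two : ‖(2 : F)‖ = 1
  norm_d : ‖d‖ = 1
  b_ne_zero : b ≠ 0
  norm_b : ‖b‖ < 1

namespace IsNodal

open WeierstrassCurve WeierstrassCurve.Affine nodalCurve Filter Topology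

variable {F : Type*} [NormedField F] {d b : F} (h : IsNodal d b)
include h

theorem norm_four : ‖(4 : F)‖ = 1 := by
  rw [show (4 : F) = 2 * 2 by norm_num, norm_mul, h.norm_two, one_mul]

theorem d_ne_zero : d ≠ 0 := by
  intro h0
  have := h.norm_d
  simp [h0] at this

theorem norm_four_mul (x : F) : ‖4 * d * x‖ = ‖x‖ := by
  rw [norm_mul, norm_mul, h.norm_four, h.norm_d, one_mul, one_mul]

theorem norm_b_pos : 0 < ‖b‖ := norm_pos_iff.2 h.b_ne_zero

theorem disc_ne_zero [IsUltrametricDist F] : (nodalCurve d b).Δ ≠ 0 := by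
  have h2 : (2 : F) ≠ 0 := norm_ne_zero_iff.1 (by rw [h.norm_two]; exact one_ne_zero)
  have h3 : 4 * d - 27 * b ≠ 0 := by
    refine norm_ne_zero_iff.1 ?_
    have h27 : ‖(27 : F)‖ ≤ 1 := by exact_mod_cast IsUltrametricDist.norm_natCast_le_one F 27
    have : ‖27 * b‖ < ‖4 * d‖ := by
      rw [norm_mul, norm_mul, h.norm_four, h.norm_d]
      nlinarith [h.norm_b, norm_nonneg b]
    rw [norm_sub_eq_left_of_lt this, norm_mul, h.norm_four, h.norm_d]
    norm_num
  rw [Δ_eq, show (16 : F) = 2 ^ 4 by norm_num]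
  exact mul_ne_zero (mul_ne_zero (mul_ne_zero (pow_ne_zero 4 h2) (pow_ne_zero 2 h.d_ne_zero))
    (pow_ne_zero 3 h.b_ne_zero)) h3

variable [DecidableEq F]
omit h in
theorem add_sub_relations {P Q : (nodalCurve d b).toAffine.Point} (hP : P ≠ 0) (hQ : Q ≠ 0)
    (hx : xCoord P ≠ xCoord Q) : P + Q ≠ 0 ∧ P - Q ≠ 0 ∧
    (xCoord (P + Q) + xCoord (P - Q)) * (xCoord P - xCoord Q) ^ 2 =
      2 * xCoord P * xCoord Q * (xCoord P + xCoord Q)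
        + 4 * d * ((xCoord P + b) * (xCoord Q + b)) ∧
    xCoord (P + Q) * xCoord (P - Q) * (xCoord P - xCoord Q) ^ 2 =
      xCoord P ^ 2 * xCoord Q ^ 2 - 4 * d * (b * (xCoord P * xCoord Q))
        - 4 * d * (b ^ 2 * (xCoord P + xCoord Q)) := by
  rcases P with _ | ⟨x₁, y₁, h₁⟩
  · exact absurd rfl hP
  rcases Q with _ | ⟨x₂, y₂, h₂⟩
  · exact absurd rfl hQ
  obtain ⟨x₃, y₃, x₄, y₄, h₃, h₄, e₃, e₄, hS, hN⟩ := exists_add_sub_eq h₁ h₂ hx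
  rw [e₃, e₄]
  refine ⟨Point.some_ne_zero _, Point.some_ne_zero _, ?_, ?_⟩
  · change (x₃ + x₄) * (x₁ - x₂) ^ 2 = 2 * x₁ * x₂ * (x₁ + x₂) + 4 * d * ((x₁ + b) * (x₂ + b))
    rw [hS, b₂_eq, b₄_eq, b₆_eq]; ring
  · change x₃ * x₄ * (x₁ - x₂) ^ 2 = x₁ ^ 2 * x₂ ^ 2 - 4 * d * (b * (x₁ * x₂)) -
      4 * d * (b ^ 2 * (x₁ + x₂))
    rw [hN, b₄_eq, b₆_eq, b₈_eq]; ring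

omit h in
theorem two_nsmul_relation {P : (nodalCurve d b).toAffine.Point} (hP : P ≠ 0)
    (hy : 4 * xCoord P ^ 3 + 4 * d * (xCoord P + b) ^ 2 ≠ 0) : P + P ≠ 0 ∧
    xCoord (P + P) * (4 * xCoord P ^ 3 + 4 * d * (xCoord P + b) ^ 2) =
      xCoord P ^ 4 - 4 * d * (b * xCoord P ^ 2 + 2 * b ^ 2 * xCoord P) := by
  rcases P with _ | ⟨x, y, h₁⟩
  · exact absurd rfl hP
  have he := equation_iff.1 h₁.1
  change 4 * x ^ 3 + 4 * d * (x + b) ^ 2 ≠ 0 at hy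
  change _ ∧ _ * (4 * x ^ 3 + 4 * d * (x + b) ^ 2) = x ^ 4 - 4 * d * (b * x ^ 2 + 2 * b ^ 2 * x)
  have h4 : 4 * x ^ 3 + 4 * d * (x + b) ^ 2 = (2 * y) ^ 2 := by linear_combination -4 * he
  rw [h4] at hy ⊢
  have hy0 : 2 * y ≠ 0 := fun h0 => hy (by rw [h0]; ring)
  have hne : y ≠ (nodalCurve d b).toAffine.negY x y := by
    rw [negY_eq]
    intro h0
    exact hy0 (by linear_combination h0)
  rw [Point.add_self_of_Y_ne hne]
  refine ⟨Point.some_ne_zero _, ?_⟩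
  change (nodalCurve d b).toAffine.addX x x ((nodalCurve d b).toAffine.slope x x y y) * _ = _
  rw [slope_of_Y_ne rfl hne, negY_eq, addX]
  have h2 : y - -y = 2 * y := by ring
  rw [h2]
  simp only [nodalCurve]
  generalize hℓ : (3 * x ^ 2 + 2 * d * x + 2 * d * b - 0 * y) / (2 * y) = ℓ
  rw [div_eq_iff hy0] at hℓ
  linear_combination -(ℓ * (2 * y) + (3 * x ^ 2 + 2 * d * x + 2 * d * b - 0 * y)) * hℓ
    - (8 * x + 4 * d) * he

variable [IsUltrametricDist F]

/-- The points reducing to the smooth locus form a subgroup; the sum of a point of this subgroup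
and a point outside it is outside it. -/
theorem norm_xCoord_add_lt_one {P Q : (nodalCurve d b).toAffine.Point} (hP : P ≠ 0) (hQ : Q ≠ 0)
    (h₁ : 1 ≤ ‖xCoord P‖) (h₂ : ‖xCoord Q‖ < 1) :
    P + Q ≠ 0 ∧ P - Q ≠ 0 ∧ ‖xCoord (P + Q)‖ < 1 ∧ ‖xCoord (P - Q)‖ < 1 := by
  have hx : xCoord P ≠ xCoord Q := fun h0 => (h₂.trans_le h₁).ne (by rw [h0])
  obtain ⟨n₁, n₂, hS, hN⟩ := add_sub_relations hP hQ hx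
  refine ⟨n₁, n₂, ?_⟩
  generalize xCoord P = x₁ at *
  generalize xCoord Q = x₂ at *
  have h21 : ‖x₂‖ < ‖x₁‖ := h₂.trans_le h₁
  have hr : 0 < ‖x₁‖ ^ 2 := by positivity
  have hb1 : ‖b‖ < ‖x₁‖ := h.norm_b.trans_le h₁
  have hadd : ‖x₁ + x₂‖ = ‖x₁‖ := norm_add_eq_left_of_lt h21
  have hx2b : ‖x₂ + b‖ < 1 := norm_add_lt_of_lt h₂ h.norm_b
  apply norm_lt_one_of_norm_add_of_norm_mul
  · rw [← mul_lt_mul_iff_left₀ hr, one_mul, ← norm_sub_eq_left_of_lt h21, ← norm_pow, ← norm_mul, hS,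
      norm_pow, norm_sub_eq_left_of_lt h21]
    apply norm_add_lt_of_lt
    · rw [norm_mul, norm_mul, norm_mul, h.norm_two, hadd]
      nlinarith
    · rw [h.norm_four_mul, norm_mul, norm_add_eq_left_of_lt hb1]
      nlinarith
  · rw [← mul_lt_mul_iff_left₀ hr, one_mul, ← norm_sub_eq_left_of_lt h21, ← norm_pow, ← norm_mul, hN,
      norm_pow, norm_sub_eq_left_of_lt h21]
    have hx2 : ‖x₂‖ ^ 2 < 1 := by nlinarith [norm_nonneg x₂]
    have hb2 : ‖b‖ ^ 2 < 1 := by nlinarith [norm_nonneg b, h.norm_b]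
    have hbx : ‖b‖ * ‖x₂‖ < 1 := by nlinarith [norm_nonneg b, h.norm_b, norm_nonneg x₂]
    refine norm_sub_lt_of_lt (norm_sub_lt_of_lt ?_ ?_) ?_
    · rw [norm_mul, norm_pow, norm_pow]
      nlinarith
    · rw [h.norm_four_mul, norm_mul, norm_mul]
      nlinarith
    · rw [h.norm_four_mul, norm_mul, norm_pow, hadd]
      nlinarith

/-- The product of `x(P ± Q)` has norm `|x(Q)|²` and their sum has norm at most `|x(Q)|`. So
translation by `P` does not change the size of `x(Q)`. -/
theorem norm_xCoord_add_eq {P Q : (nodalCurve d b).toAffine.Point} (hP : P ≠ 0) (hQ : Q ≠ 0)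
    (h₁ : 1 ≤ ‖xCoord P‖) (h₂ : ‖xCoord Q‖ < ‖xCoord P‖) (h₃ : ‖b‖ < ‖xCoord Q‖ ^ 2) :
    P + Q ≠ 0 ∧ P - Q ≠ 0 ∧ ‖xCoord (P + Q)‖ = ‖xCoord Q‖ ∧ ‖xCoord (P - Q)‖ = ‖xCoord Q‖ := by
  have hx : xCoord P ≠ xCoord Q := fun h0 => h₂.ne (by rw [h0])
  obtain ⟨n₁, n₂, hS, hN⟩ := add_sub_relations hP hQ hx
  refine ⟨n₁, n₂, ?_⟩
  generalize xCoord P = x₁ at *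
  generalize xCoord Q = x₂ at *
  have hb := h.norm_b
  have hb0 := norm_nonneg b
  have hr : 0 < ‖x₁‖ ^ 2 := by positivity
  have hx0 : 0 ≤ ‖x₂‖ := norm_nonneg _
  have hs : 0 < ‖x₂‖ := by
    rcases hx0.eq_or_lt with h0 | h0
    · rw [← h0] at h₃; nlinarith
    · exact h0
  have hbs : ‖b‖ < ‖x₂‖ := by
    by_contra! h0
    nlinarith
  have hadd : ‖x₁ + x₂‖ = ‖x₁‖ := norm_add_eq_left_of_lt h₂
  have hsub : ‖x₁ - x₂‖ = ‖x₁‖ := norm_sub_eq_left_of_lt h₂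
  have e1 : ‖x₁ + b‖ = ‖x₁‖ := norm_add_eq_left_of_lt (hbs.trans h₂)
  have e2 : ‖x₂ + b‖ = ‖x₂‖ := norm_add_eq_left_of_lt hbs
  apply norm_eq_of_norm_add_of_norm_mul hs
  · rw [← mul_le_mul_iff_left₀ hr, ← hsub, ← norm_pow, ← norm_mul, hS, norm_pow, hsub]
    apply norm_add_le_of_le_of_le
    · rw [norm_mul, norm_mul, norm_mul, h.norm_two, hadd]
      nlinarith
    · rw [h.norm_four_mul, norm_mul, e1, e2]
      nlinarith [mul_pos hs (zero_lt_one.trans_le h₁)]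
  · have hlead : ‖x₁ ^ 2 * x₂ ^ 2‖ = ‖x₁‖ ^ 2 * ‖x₂‖ ^ 2 := by rw [norm_mul, norm_pow, norm_pow]
    rw [← mul_left_inj' hr.ne', ← hsub, ← norm_pow, ← norm_mul, hN, norm_pow, hsub]
    have hrs : 0 < ‖x₁‖ * ‖x₂‖ := mul_pos (zero_lt_one.trans_le h₁) hs
    have k1 : ‖4 * d * (b * (x₁ * x₂))‖ < ‖x₁ ^ 2 * x₂ ^ 2‖ := by
      rw [hlead, h.norm_four_mul, norm_mul, norm_mul]
      have : ‖b‖ < ‖x₁‖ * ‖x₂‖ := by nlinarith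
      nlinarith
    have k2 : ‖4 * d * (b ^ 2 * (x₁ + x₂))‖ < ‖x₁ ^ 2 * x₂ ^ 2‖ := by
      rw [hlead, h.norm_four_mul, norm_mul, norm_pow, hadd]
      have hb2 : ‖b‖ ^ 2 < ‖x₂‖ ^ 2 := by nlinarith
      calc ‖b‖ ^ 2 * ‖x₁‖ < ‖x₂‖ ^ 2 * ‖x₁‖ := by nlinarith
        _ ≤ ‖x₂‖ ^ 2 * ‖x₁‖ ^ 2 := by gcongr; nlinarith
        _ = ‖x₁‖ ^ 2 * ‖x₂‖ ^ 2 := mul_comm _ _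
    rw [sub_sub, norm_sub_eq_left_of_lt (norm_add_lt_of_lt k1 k2), hlead]
    ring

/-- In the range `|b| < |x(P)| |x(Q)|` the norms of `x(P ± Q)` are `|x(P)| |x(Q)|` and `|x(P)| /
|x(Q)|` in some order: `-log |x|` behaves like the absolute value of an additive function. -/
theorem norm_xCoord_add_mul {P Q : (nodalCurve d b).toAffine.Point} (hP : P ≠ 0) (hQ : Q ≠ 0)
    (h₁ : ‖xCoord P‖ < ‖xCoord Q‖) (h₂ : ‖xCoord Q‖ < 1) (h₃ : ‖b‖ < ‖xCoord P‖ * ‖xCoord Q‖) :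
    P + Q ≠ 0 ∧ P - Q ≠ 0 ∧ ‖xCoord (P + Q) * xCoord (P - Q)‖ = ‖xCoord P‖ ^ 2 ∧
      (‖xCoord (P + Q)‖ = ‖xCoord P‖ / ‖xCoord Q‖ ∨
        ‖xCoord (P - Q)‖ = ‖xCoord P‖ / ‖xCoord Q‖) := by
  have hx : xCoord P ≠ xCoord Q := fun h0 => h₁.ne (by rw [h0])
  obtain ⟨n₁, n₂, hS, hN⟩ := add_sub_relations hP hQ hx
  refine ⟨n₁, n₂, ?_⟩
  generalize xCoord P = x₁ at *
  generalize xCoord Q = x₂ at *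
  have hb := h.norm_b
  have hb0 := norm_nonneg b
  have hs : 0 < ‖x₂‖ := (norm_nonneg _).trans_lt h₁
  have hr : 0 < ‖x₁‖ := by
    by_contra! h0
    nlinarith
  have hs2 : 0 < ‖x₂‖ ^ 2 := by positivity
  have hb1 : ‖b‖ < ‖x₁‖ := by nlinarith
  have hadd : ‖x₁ + x₂‖ = ‖x₂‖ := by rw [add_comm, norm_add_eq_left_of_lt h₁]
  have hsub : ‖x₁ - x₂‖ = ‖x₂‖ := by rw [← norm_neg, neg_sub, norm_sub_eq_left_of_lt h₁]
  have e1 : ‖x₁ + b‖ = ‖x₁‖ := norm_add_eq_left_of_lt hb1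
  have e2 : ‖x₂ + b‖ = ‖x₂‖ := norm_add_eq_left_of_lt (hb1.trans h₁)
  have hmul : ‖xCoord (P + Q) * xCoord (P - Q)‖ = ‖x₁‖ ^ 2 := by
    have hlead : ‖x₁ ^ 2 * x₂ ^ 2‖ = ‖x₁‖ ^ 2 * ‖x₂‖ ^ 2 := by rw [norm_mul, norm_pow, norm_pow]
    rw [← mul_left_inj' hs2.ne', ← hsub, ← norm_pow, ← norm_mul, hN, norm_pow, hsub]
    have hrs : 0 < ‖x₁‖ * ‖x₂‖ := mul_pos hr hs
    have k1 : ‖4 * d * (b * (x₁ * x₂))‖ < ‖x₁ ^ 2 * x₂ ^ 2‖ := by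
      rw [hlead, h.norm_four_mul, norm_mul, norm_mul]
      nlinarith
    have k2 : ‖4 * d * (b ^ 2 * (x₁ + x₂))‖ < ‖x₁ ^ 2 * x₂ ^ 2‖ := by
      rw [hlead, h.norm_four_mul, norm_mul, norm_pow, hadd]
      have : ‖b‖ ^ 2 < ‖x₁‖ ^ 2 * ‖x₂‖ := by nlinarith
      nlinarith
    rw [sub_sub, norm_sub_eq_left_of_lt (norm_add_lt_of_lt k1 k2), hlead]
  refine ⟨hmul, norm_eq_div_of_norm_add_of_norm_mul hr hs h₂ ?_ hmul⟩
  rw [← mul_left_inj' hs2.ne', ← hsub, ← norm_pow, ← norm_mul, hS, norm_pow, hsub]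
  have k1 : ‖4 * d * ((x₁ + b) * (x₂ + b))‖ = ‖x₁‖ * ‖x₂‖ := by
    rw [h.norm_four_mul, norm_mul, e1, e2]
  rw [add_comm, norm_add_eq_left_of_lt, k1]
  · field_simp
  · rw [k1, norm_mul, norm_mul, norm_mul, h.norm_two, hadd, one_mul]
    nlinarith [mul_pos hr hs]

/-- If both `x(P ± Q)` had norm below 1, the term `4d(x₁ + b)(x₂ + b)` of norm `|x₂|²` could not be
balanced in the relation for their sum, since `|x₁ - x₂| ≤ |x₂|`. -/
theorem one_le_norm_xCoord_add_or {P Q : (nodalCurve d b).toAffine.Point} (hP : P ≠ 0) (hQ : Q ≠ 0)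
    (hx : xCoord P ≠ xCoord Q)
    (h₁ : ‖xCoord P‖ = ‖xCoord Q‖) (h₂ : ‖xCoord Q‖ < 1) (h₃ : ‖b‖ < ‖xCoord Q‖ ^ 2) :
    1 ≤ ‖xCoord (P + Q)‖ ∨ 1 ≤ ‖xCoord (P - Q)‖ := by
  obtain ⟨n₁, n₂, hS, hN⟩ := add_sub_relations hP hQ hx
  by_contra! hlt
  have hlt := norm_add_lt_of_lt hlt.1 hlt.2
  generalize xCoord P = x₁ at *
  generalize xCoord Q = x₂ at *
  have hb := h.norm_b
  have hb0 := norm_nonneg b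
  have hs : 0 < ‖x₂‖ := by
    rcases (norm_nonneg x₂).eq_or_lt with h0 | h0
    · rw [← h0] at h₃; nlinarith
    · exact h0
  have hb1 : ‖b‖ < ‖x₂‖ := by nlinarith
  have hadd : ‖x₁ + x₂‖ ≤ ‖x₂‖ := norm_add_le_of_le_of_le h₁.le le_rfl
  have hsub : ‖x₁ - x₂‖ ≤ ‖x₂‖ := norm_sub_le_of_le_of_le h₁.le le_rfl
  have e1 : ‖x₁ + b‖ = ‖x₂‖ := by rw [norm_add_eq_left_of_lt (by rwa [h₁]), h₁]
  have e2 : ‖x₂ + b‖ = ‖x₂‖ := norm_add_eq_left_of_lt hb1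
  have k1 : ‖4 * d * ((x₁ + b) * (x₂ + b))‖ = ‖x₂‖ * ‖x₂‖ := by
    rw [h.norm_four_mul, norm_mul, e1, e2]
  have k := congrArg norm hS
  rw [add_comm (2 * x₁ * x₂ * (x₁ + x₂)), norm_add_eq_left_of_lt, k1, norm_mul, norm_pow] at k
  · have : ‖x₁ - x₂‖ ^ 2 ≤ ‖x₂‖ ^ 2 := pow_le_pow_left₀ (norm_nonneg _) hsub 2
    nlinarith [sq_nonneg ‖x₁ - x₂‖, norm_nonneg (xCoord (P + Q) + xCoord (P - Q))]
  · rw [k1, norm_mul, norm_mul, norm_mul, h.norm_two, one_mul, h₁]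
    nlinarith [mul_pos hs hs]

theorem norm_xCoord_two_of_lt {P : (nodalCurve d b).toAffine.Point} (hP : P ≠ 0)
    (h₂ : ‖xCoord P‖ < 1) (h₃ : ‖b‖ < ‖xCoord P‖ ^ 2) :
    P + P ≠ 0 ∧ ‖xCoord (P + P)‖ = ‖xCoord P‖ ^ 2 := by
  have hb0 := h.norm_b_pos
  have hs : 0 < ‖xCoord P‖ := by
    rcases (norm_nonneg (xCoord P)).eq_or_lt with h0 | h0
    · rw [← h0] at h₃; nlinarith
    · exact h0
  have hb1 : ‖b‖ < ‖xCoord P‖ := by nlinarith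
  have k1 : ‖4 * d * (xCoord P + b) ^ 2‖ = ‖xCoord P‖ ^ 2 := by
    rw [h.norm_four_mul, norm_pow, norm_add_eq_left_of_lt hb1]
  have hden : ‖4 * xCoord P ^ 3 + 4 * d * (xCoord P + b) ^ 2‖ = ‖xCoord P‖ ^ 2 := by
    rw [add_comm, norm_add_eq_left_of_lt, k1]
    rw [k1, norm_mul, h.norm_four, norm_pow]
    nlinarith [mul_pos hs hs]
  obtain ⟨h0, hrel⟩ := two_nsmul_relation hP (norm_ne_zero_iff.1 (by rw [hden]; positivity))
  refine ⟨h0, ?_⟩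
  have hs2 : 0 < ‖xCoord P‖ ^ 2 := by positivity
  have k := congrArg norm hrel
  rw [norm_mul, hden, norm_sub_eq_left_of_lt, norm_pow] at k
  · nlinarith
  · rw [h.norm_four_mul, norm_pow]
    apply norm_add_lt_of_lt
    · rw [norm_mul, norm_pow]
      nlinarith
    · rw [norm_mul, norm_mul, h.norm_two, norm_pow, one_mul]
      have : ‖b‖ ^ 2 * ‖xCoord P‖ ≤ ‖b‖ * ‖xCoord P‖ ^ 2 := by
        nlinarith [mul_pos hb0 hs]
      nlinarith

theorem norm_xCoord_two_of_one_lt {P : (nodalCurve d b).toAffine.Point} (hP : P ≠ 0)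
    (h₁ : 1 < ‖xCoord P‖) : P + P ≠ 0 ∧ ‖xCoord (P + P)‖ = ‖xCoord P‖ := by
  have hb := h.norm_b
  have hb0 := norm_nonneg b
  have hb1 : ‖b‖ < ‖xCoord P‖ := hb.trans h₁
  have hs : 0 < ‖xCoord P‖ := by linarith
  have k1 : ‖4 * xCoord P ^ 3‖ = ‖xCoord P‖ ^ 3 := by
    rw [norm_mul, h.norm_four, norm_pow, one_mul]
  have hden : ‖4 * xCoord P ^ 3 + 4 * d * (xCoord P + b) ^ 2‖ = ‖xCoord P‖ ^ 3 := by
    rw [norm_add_eq_left_of_lt, k1]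
    rw [k1, h.norm_four_mul, norm_pow, norm_add_eq_left_of_lt hb1]
    nlinarith [mul_pos hs hs]
  obtain ⟨h0, hrel⟩ := two_nsmul_relation hP (norm_ne_zero_iff.1 (by rw [hden]; positivity))
  refine ⟨h0, ?_⟩
  have hs3 : 0 < ‖xCoord P‖ ^ 3 := by positivity
  have hs2 : 1 < ‖xCoord P‖ ^ 2 := by nlinarith
  have k := congrArg norm hrel
  rw [norm_mul, hden, norm_sub_eq_left_of_lt, norm_pow] at k
  · nlinarith
  · rw [h.norm_four_mul, norm_pow]
    apply norm_add_lt_of_lt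
    · rw [norm_mul, norm_pow]
      nlinarith
    · rw [norm_mul, norm_mul, h.norm_two, norm_pow, one_mul]
      have : ‖b‖ ^ 2 < 1 := by nlinarith
      have : ‖b‖ ^ 2 * ‖xCoord P‖ < ‖xCoord P‖ ^ 2 := by nlinarith
      nlinarith

end IsNodal

end

/-! ### Absolute values of polynomials near the unit circle and near infinity. -/

section

open Filter Topology Polynomial

/-- The values of the norm, approaching `1` from below. -/
def normFilter (F : Type*) [NormedField F] : Filter ℝ := 𝓝[<] 1 ⊓ 𝓟 (Set.range (norm : F → ℝ))

/-- The norms of the `n`-th roots of `t` tend to 1 from below. -/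
theorem normFilter_neBot {F : Type*} [NormedField F] [IsAlgClosed F] {t : F} (ht : t ≠ 0)
    (ht1 : ‖t‖ < 1) : (normFilter F).NeBot := by
  rw [normFilter, inf_principal_neBot_iff]
  intro s hs
  obtain ⟨l, hl, hls⟩ := (mem_nhdsLT_iff_exists_Ioo_subset).1 hs
  have hl1 : max l 0 < 1 := max_lt hl one_pos
  obtain ⟨n, hn⟩ := exists_pow_lt_of_lt_one (norm_pos_iff.2 ht) hl1
  have hn0 : n ≠ 0 := by
    rintro rfl
    rw [pow_zero] at hn
    exact lt_asymm hn ht1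
  obtain ⟨x, hx⟩ := IsAlgClosed.exists_pow_nat_eq t (Nat.pos_of_ne_zero hn0)
  refine ⟨‖x‖, hls ⟨?_, ?_⟩, x, rfl⟩
  · rw [← hx, norm_pow] at hn
    exact (le_max_left _ _).trans_lt (lt_of_pow_lt_pow_left₀ n (norm_nonneg _) hn)
  · rw [← hx, norm_pow] at ht1
    exact lt_of_pow_lt_pow_left₀ n zero_le_one (by rwa [one_pow])

theorem normFilter_le {F : Type*} [NormedField F] : normFilter F ≤ 𝓝[<] 1 := inf_le_left

theorem eventually_normFilter {F : Type*} [NormedField F] {p : ℝ → Prop}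
    (h : ∀ᶠ ρ in 𝓝[<] (1 : ℝ), p ρ) : ∀ᶠ ρ in normFilter F, p ρ := normFilter_le h

theorem eventually_normFilter_of_nhds {F : Type*} [NormedField F] {p : ℝ → Prop}
    (h : ∀ᶠ ρ in 𝓝 (1 : ℝ), p ρ) : ∀ᶠ ρ in normFilter F, p ρ :=
  eventually_normFilter (nhdsWithin_le_nhds h)

theorem eventually_mem_range_norm (F : Type*) [NormedField F] :
    ∀ᶠ ρ in normFilter F, ∃ x : F, ‖x‖ = ρ :=
  mem_inf_of_right (mem_principal_self _)

theorem eventually_pos_lt_one : ∀ᶠ ρ in 𝓝[<] (1 : ℝ), 0 < ρ ∧ ρ < 1 :=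
  inter_mem (nhdsWithin_le_nhds (lt_mem_nhds one_pos)) self_mem_nhdsWithin

theorem eventually_ne_nhdsLT (r : ℝ) : ∀ᶠ ρ in 𝓝[<] (1 : ℝ), ρ ≠ r := by
  by_cases h : r = 1
  · filter_upwards [eventually_pos_lt_one] with ρ hρ
    rw [h]; exact hρ.2.ne
  · exact nhdsWithin_le_nhds (isOpen_ne.mem_nhds (Ne.symm h))

theorem tendsto_const_mul_zpow (C : ℝ) (a : ℤ) :
    Tendsto (fun ρ : ℝ => C * ρ ^ a) (𝓝 1) (𝓝 C) := by
  have h := (continuousAt_zpow₀ (1 : ℝ) a (Or.inl one_ne_zero)).tendsto.const_mul C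
  rwa [one_zpow, mul_one] at h

theorem tendsto_pow_nhdsLT {n : ℕ} (hn : n ≠ 0) :
    Tendsto (fun ρ : ℝ => ρ ^ n) (𝓝[<] 1) (𝓝[<] 1) := by
  refine tendsto_nhdsWithin_iff.2 ⟨?_, ?_⟩
  · have h := (continuous_pow (M := ℝ) n).tendsto 1
    rw [one_pow] at h
    exact h.mono_left nhdsWithin_le_nhds
  · filter_upwards [eventually_pos_lt_one] with ρ hρ
    exact pow_lt_one₀ hρ.1.le hρ.2 hn

/-- Letting `ρ` tend to 1 gives `c₁ = c₂`; then `ρ ^ m = ρ ^ k` for some `0 < ρ < 1`. -/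
theorem eq_of_frequently_mul_pow_eq {l : Filter ℝ} (hl : l ≤ 𝓝[<] 1) {c₁ c₂ : ℝ} (h₁ : 0 < c₁) {m k : ℕ}
    (h : ∃ᶠ ρ in l, c₁ * ρ ^ m = c₂ * ρ ^ k) : m = k := by
  have hc : c₁ = c₂ := by
    by_contra hne
    have h1 := tendsto_const_mul_zpow c₁ m
    have h2 := tendsto_const_mul_zpow c₂ k
    have h3 : ∀ᶠ ρ : ℝ in 𝓝 1, c₁ * ρ ^ (m : ℤ) - c₂ * ρ ^ (k : ℤ) ≠ 0 :=
      (h1.sub h2).eventually_ne (sub_ne_zero.2 hne)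
    have h4 : ∀ᶠ ρ : ℝ in l, c₁ * ρ ^ (m : ℤ) - c₂ * ρ ^ (k : ℤ) ≠ 0 :=
      (hl.trans nhdsWithin_le_nhds) h3
    refine h (h4.mono fun ρ hρ h5 => hρ ?_)
    rw [zpow_natCast, zpow_natCast, h5, sub_self]
  obtain ⟨ρ, h1, h2⟩ := (h.and_eventually (hl eventually_pos_lt_one)).exists
  rw [← hc] at h1
  exact pow_right_injective₀ h2.1 h2.2.ne (mul_left_cancel₀ h₁.ne' h1)

section Poly

variable {F : Type*} [NormedField F] [IsUltrametricDist F] [IsAlgClosed F]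

omit [IsUltrametricDist F] in
theorem Polynomial.eval_eq_leadingCoeff_mul_prod (p : F[X]) (x : F) :
    p.eval x = p.leadingCoeff * (p.roots.map fun r => x - r).prod := by
  conv_lhs => rw [(IsAlgClosed.splits p).eq_prod_roots]
  rw [eval_mul, eval_C, eval_multiset_prod, Multiset.map_map]
  simp

/-- Each factor `x - r` has norm `ρ` if `|r| < 1`, provided `|r| < ρ`, and `|r|` otherwise. The
exponent therefore counts the zeros in the open unit disc. -/
theorem exists_norm_eval_eq {p : F[X]} (hp : p ≠ 0) : ∃ c > 0, ∀ᶠ ρ in 𝓝[<] (1 : ℝ), ∀ x : F, ‖x‖ = ρ →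
    ‖p.eval x‖ = c * ρ ^ p.roots.countP fun r => ‖r‖ < 1 := by
  suffices h : ∀ s : Multiset F, ∃ c > 0, ∀ᶠ ρ in 𝓝[<] (1 : ℝ), ∀ x : F, ‖x‖ = ρ →
      ‖(s.map fun r => x - r).prod‖ = c * ρ ^ s.countP fun r => ‖r‖ < 1 by
    obtain ⟨c, hc, h⟩ := h p.roots
    refine ⟨‖p.leadingCoeff‖ * c, mul_pos (norm_pos_iff.2 (leadingCoeff_ne_zero.2 hp)) hc, ?_⟩
    filter_upwards [h] with ρ hρ x hx
    rw [eval_eq_leadingCoeff_mul_prod, norm_mul, hρ x hx, mul_assoc]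
  intro s
  induction s using Multiset.induction_on with
  | empty => exact ⟨1, one_pos, by simp⟩
  | cons r s ih =>
    obtain ⟨c, hc, h⟩ := ih
    by_cases hr : ‖r‖ < 1
    · refine ⟨c, hc, ?_⟩
      filter_upwards [h, nhdsWithin_le_nhds (lt_mem_nhds hr)] with ρ hρ hρr x hx
      rw [Multiset.map_cons, Multiset.prod_cons, norm_mul, hρ x hx,
        norm_sub_eq_left_of_lt (by rwa [hx]), hx, Multiset.countP_cons_of_pos (p := fun r : F => ‖r‖ < 1) _ hr]
      ring
    · refine ⟨‖r‖ * c, mul_pos (by linarith) hc, ?_⟩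
      filter_upwards [h, eventually_pos_lt_one] with ρ hρ hρr x hx
      rw [Multiset.map_cons, Multiset.prod_cons, norm_mul, hρ x hx, ← norm_neg, neg_sub,
        norm_sub_eq_left_of_lt (by linarith), Multiset.countP_cons_of_neg (p := fun r : F => ‖r‖ < 1) _ hr]
      ring

theorem exists_norm_eval_eq_of_le {p : F[X]} (hp : p ≠ 0) :
    ∃ R c : ℝ, 0 < c ∧ ∀ x : F, R ≤ ‖x‖ → ‖p.eval x‖ = c * ‖x‖ ^ p.natDegree := by
  suffices h : ∀ s : Multiset F, ∃ R : ℝ, ∀ x : F, R ≤ ‖x‖ →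
      ‖(s.map fun r => x - r).prod‖ = ‖x‖ ^ Multiset.card s by
    obtain ⟨R, h⟩ := h p.roots
    refine ⟨R, ‖p.leadingCoeff‖, norm_pos_iff.2 (leadingCoeff_ne_zero.2 hp), fun x hx => ?_⟩
    rw [eval_eq_leadingCoeff_mul_prod, norm_mul, h x hx,
      ← (IsAlgClosed.splits p).natDegree_eq_card_roots]
  intro s
  induction s using Multiset.induction_on with
  | empty => exact ⟨0, by simp⟩
  | cons r s ih =>
    obtain ⟨R, h⟩ := ih
    refine ⟨max R (‖r‖ + 1), fun x hx => ?_⟩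
    have h1 := (le_max_right _ _).trans hx
    rw [Multiset.map_cons, Multiset.prod_cons, norm_mul, h x ((le_max_left _ _).trans hx),
      norm_sub_eq_left_of_lt (by linarith), Multiset.card_cons, pow_succ, mul_comm]

/-- When `deg p ≤ deg q`, the function `p / q` has a finite limit `c` at infinity and is eventually
at distance less than 1 from it. -/
theorem exists_norm_eval_sub_lt {p q : F[X]} (hq : q ≠ 0) (hpq : p.natDegree ≤ q.natDegree) :
    ∃ (c : F) (R : ℝ), ∀ x : F, R ≤ ‖x‖ → ‖p.eval x - c * q.eval x‖ < ‖q.eval x‖ := by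
  obtain ⟨R, κ, hκ, hR⟩ := exists_norm_eval_eq_of_le hq
  set c := p.coeff q.natDegree / q.leadingCoeff
  set D := p - C c * q with hD
  have hlc : q.leadingCoeff ≠ 0 := leadingCoeff_ne_zero.2 hq
  have hcoeff : D.coeff q.natDegree = 0 := by
    rw [hD, coeff_sub, coeff_C_mul, coeff_natDegree, div_mul_cancel₀ _ hlc, sub_self]
  have heval : ∀ x, p.eval x - c * q.eval x = D.eval x := fun x => by simp [hD]
  by_cases hD0 : D = 0
  · refine ⟨c, max R 1, fun x hx => ?_⟩
    rw [heval, hD0, eval_zero, norm_zero, hR x ((le_max_left _ _).trans hx)]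
    have := (le_max_right _ _).trans hx
    positivity
  obtain ⟨R', κ', hκ', hR'⟩ := exists_norm_eval_eq_of_le hD0
  have hdeg : D.natDegree < q.natDegree := by
    refine lt_of_le_of_ne ?_ ?_
    · exact (natDegree_sub_le _ _).trans (max_le hpq (natDegree_C_mul_le _ _))
    · intro h
      rw [← h, coeff_natDegree] at hcoeff
      exact hD0 (leadingCoeff_eq_zero.1 hcoeff)
  refine ⟨c, max R (max R' (max 1 (κ' / κ + 1))), fun x hx => ?_⟩
  simp only [max_le_iff] at hx
  obtain ⟨h1, h2, h3, h4⟩ := hx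
  rw [heval, hR x h1, hR' x h2]
  obtain ⟨k, hk⟩ := Nat.exists_eq_add_of_lt hdeg
  rw [hk, add_assoc, pow_add, mul_left_comm κ]
  have h5 : κ' < κ * ‖x‖ := by
    rw [mul_comm, ← div_lt_iff₀ hκ]; linarith
  have h6 : κ * ‖x‖ ≤ κ * ‖x‖ ^ (k + 1) := by
    rw [pow_succ]
    nlinarith [one_le_pow₀ h3 (n := k), mul_pos hκ (zero_lt_one.trans_le h3)]
  rw [mul_comm]
  have h7 : 0 < ‖x‖ ^ D.natDegree := by positivity
  nlinarith

end Poly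

namespace nodalCurve

variable {F : Type*} [NormedField F] {d b : F} {P Q : (nodalCurve d b).toAffine.Point}

theorem eq_or_eq_neg (hd : d ≠ 0) (hb : b ≠ 0) (hP : P ≠ 0) (hQ : Q ≠ 0)
    (h : xCoord P = xCoord Q) : P = Q ∨ P = -Q := by
  have h1 := yCoord_sq hP
  have h2 := yCoord_sq hQ
  rw [h, ← h2, sq_eq_sq_iff_eq_or_eq_neg] at h1
  refine h1.imp (fun h1 => coord_injective hd hb ?_) (fun h1 => coord_injective hd hb ?_)
  · simp only [h, h1]
  · simp only [h, h1, xCoord_neg, yCoord_neg]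

theorem eventually_nhdsLT_of_cofinite {p : (nodalCurve d b).toAffine.Point → Prop}
    (h : ∀ᶠ P in cofinite, p P) : ∀ᶠ ρ in 𝓝[<] (1 : ℝ), ∀ P, ‖xCoord P‖ = ρ → p P := by
  rw [eventually_cofinite] at h
  have h1 : ∀ᶠ ρ in 𝓝[<] (1 : ℝ), ∀ P ∈ {P | ¬ p P}, ρ ≠ ‖xCoord P‖ :=
    (h.eventually_all).2 fun P _ => eventually_ne_nhdsLT _
  filter_upwards [h1] with ρ hρ P hP
  by_contra hp
  exact hρ P hp hP.symm

theorem exists_bound_of_cofinite {p : (nodalCurve d b).toAffine.Point → Prop}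
    (h : ∀ᶠ P in cofinite, p P) : ∃ R : ℝ, ∀ P, R ≤ ‖xCoord P‖ → p P := by
  rw [eventually_cofinite] at h
  obtain ⟨R, hR⟩ := (h.image fun P => ‖xCoord P‖).bddAbove
  refine ⟨R + 1, fun P hP => ?_⟩
  by_contra hp
  have := hR ⟨P, hp, rfl⟩
  linarith

end nodalCurve

end

/-! ### Endomorphisms of a curve with nodal reduction are integers. -/

section

open Filter Topology Polynomial nodalCurve

namespace IsNodal

section Basic

variable {F : Type*} [NormedField F] [IsUltrametricDist F] [IsAlgClosed F] {d b : F}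
  (h : IsNodal d b)
include h

theorem eventually_exists_point : ∀ᶠ ρ in normFilter F,
    ∃ P : (nodalCurve d b).toAffine.Point, P ≠ 0 ∧ ‖xCoord P‖ = ρ := by
  filter_upwards [eventually_mem_range_norm F] with ρ ⟨x, hx⟩
  obtain ⟨P, hP, hPx⟩ := exists_point h.disc_ne_zero x
  exact ⟨P, hP, by rw [hPx, hx]⟩

variable [DecidableEq F] {φ : (nodalCurve d b).toAffine.Point →+ (nodalCurve d b).toAffine.Point}

omit [IsAlgClosed F] in
theorem smooth_add {P Q : (nodalCurve d b).toAffine.Point} (hP : P ≠ 0 → 1 ≤ ‖xCoord P‖)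
    (hQ : Q ≠ 0 → 1 ≤ ‖xCoord Q‖) : P + Q ≠ 0 → 1 ≤ ‖xCoord (P + Q)‖ := by
  intro hPQ
  by_cases hP0 : P = 0
  · rw [hP0, zero_add] at hPQ ⊢
    exact hQ hPQ
  by_contra! hlt
  -- If `P + Q` reduced to the node, so would `P - (P + Q) = -Q`.
  obtain ⟨-, h2, -, h4⟩ := h.norm_xCoord_add_lt_one hP0 hPQ (hP hP0) hlt
  have hQ' : P - (P + Q) = -Q := by abel
  rw [hQ'] at h2 h4
  rw [xCoord_neg] at h4
  exact h4.not_ge (hQ (neg_ne_zero.1 h2))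

/-- A homomorphism vanishing outside a finite set is zero: write any `Q` as `(Q + P) - P` with `P`
generic. -/
theorem eventually_ne_zero_of_isRationalMap (hφ : IsRationalMap φ) (h0 : φ ≠ 0) :
    ∀ᶠ P in cofinite, φ P ≠ 0 := by
  refine (hφ.dichotomy h.d_ne_zero h.b_ne_zero).resolve_left fun hz => h0 ?_
  ext Q
  have := infinite_point h.disc_ne_zero
  have hz' := (add_right_injective Q).tendsto_cofinite.eventually hz
  obtain ⟨P, h1, h2⟩ := (hz.and hz').exists
  rw [map_add, h1, add_zero] at h2
  exact h2

/-- Write `x ∘ φ = p / r` as a function of `x`; then `a` is the number of zeros of `p` minus that of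
`r` in the open unit disc. The value `C = 0` covers the case `p = 0`. -/
theorem exists_norm_xCoord_eq [CharZero F] (hφ : IsRationalMap φ) (h0 : φ ≠ 0) :
    ∃ (C : ℝ) (a : ℤ), 0 ≤ C ∧ ∀ᶠ ρ in 𝓝[<] (1 : ℝ), ∀ P, ‖xCoord P‖ = ρ →
      φ P ≠ 0 ∧ ‖xCoord (φ P)‖ = C * ρ ^ a := by
  have hne := h.eventually_ne_zero_of_isRationalMap hφ h0
  obtain ⟨p, r, hr, -, hpr⟩ := hφ.exists_xCoord_eq h.d_ne_zero h.b_ne_zero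
  have hr0 := eventually_eval_ne_zero h.d_ne_zero h.b_ne_zero hr
  obtain ⟨c, hc, hc'⟩ := exists_norm_eval_eq hr
  by_cases hp : p = 0
  · refine ⟨0, 0, le_rfl, ?_⟩
    filter_upwards [eventually_nhdsLT_of_cofinite (hne.and (hpr.and hr0))] with ρ hρ P hP
    obtain ⟨h1, h2, h3⟩ := hρ P hP
    refine ⟨h1, ?_⟩
    rw [hp, eval_zero, mul_eq_zero] at h2
    rw [h2.resolve_right h3, norm_zero, zero_mul]
  obtain ⟨c₁, hc₁, hc₁'⟩ := exists_norm_eval_eq hp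
  set k := p.roots.countP fun r => ‖r‖ < 1
  set m := r.roots.countP fun r => ‖r‖ < 1
  refine ⟨c₁ / c, (k : ℤ) - m, by positivity, ?_⟩
  filter_upwards [eventually_nhdsLT_of_cofinite (hne.and hpr), hc', hc₁', eventually_pos_lt_one]
    with ρ h1 h2 h3 h4 P hP
  obtain ⟨h5, h6⟩ := h1 P hP
  refine ⟨h5, ?_⟩
  have h7 := congrArg norm h6
  rw [norm_mul, h2 _ hP, h3 _ hP] at h7
  rw [zpow_sub₀ h4.1.ne', zpow_natCast, zpow_natCast]
  have := pow_pos h4.1 m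
  field_simp
  linear_combination h7

end Basic

section Main

variable {F : Type*} [NormedField F] [IsUltrametricDist F] [IsAlgClosed F]
  [DecidableEq F] {d b : F} (h : IsNodal d b)
  {φ : (nodalCurve d b).toAffine.Point →+ (nodalCurve d b).toAffine.Point}
include h

/-- The images of `P`, `2P`, `3P` have `x`-coordinates of norm close to `C`. If `C < 1`, the
relations for `φ(2P) ± φ(P)` cannot hold for `ρ` near 1. -/
theorem one_le_of_norm_xCoord_eq [(normFilter F).NeBot] {C : ℝ} {a : ℤ} (hC0 : 0 ≤ C)
    (hC : ∀ᶠ ρ in 𝓝[<] (1 : ℝ), ∀ P, ‖xCoord P‖ = ρ → φ P ≠ 0 ∧ ‖xCoord (φ P)‖ = C * ρ ^ a) :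
    1 ≤ C := by
  by_contra! hC1
  set B := ‖b‖ with hB
  have hB0 : 0 < B := h.norm_b_pos
  have hB1 : B < 1 := h.norm_b
  set m : ℝ → ℝ := fun ρ => max (C * ρ ^ a) (max (C * (ρ ^ 2) ^ a) (C * (ρ ^ 3) ^ a)) with hm
  have ht : ∀ n : ℕ, n ≠ 0 → Tendsto (fun ρ : ℝ => C * (ρ ^ n) ^ a) (𝓝[<] 1) (𝓝 C) := fun n hn =>
    ((tendsto_const_mul_zpow C a).mono_left nhdsWithin_le_nhds).comp (tendsto_pow_nhdsLT hn)
  have ht1 : Tendsto (fun ρ : ℝ => C * ρ ^ a) (𝓝[<] 1) (𝓝 C) := by simpa using ht 1 one_ne_zero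
  have hmt : Tendsto m (𝓝[<] 1) (𝓝 C) := by
    simpa using ht1.max ((ht 2 two_ne_zero).max (ht 3 three_ne_zero))
  have hB3 : ∀ᶠ ρ in 𝓝[<] (1 : ℝ), B < ρ ^ 3 :=
    (tendsto_pow_nhdsLT three_ne_zero).eventually (nhdsWithin_le_nhds (lt_mem_nhds hB1))
  have hcase : (C ≤ B ∧ ∀ᶠ ρ in 𝓝[<] (1 : ℝ), m ρ ^ 3 < B ^ 2 ∧ m ρ ^ 4 < B ^ 3) ∨
      (∀ᶠ ρ in 𝓝[<] (1 : ℝ), B < C * ρ ^ a ∧ B < C * (ρ ^ 2) ^ a ∧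
        m ρ ^ 3 < (C * ρ ^ a) * (C * (ρ ^ 2) ^ a)) := by
    rcases le_or_gt C B with hCB | hCB
    · left
      have h3 : C ^ 3 < B ^ 2 := by
        have := pow_le_pow_left₀ hC0 hCB 3
        nlinarith [mul_pos hB0 hB0]
      have h4 : C ^ 4 < B ^ 3 := by
        have := pow_le_pow_left₀ hC0 hCB 4
        nlinarith [mul_pos hB0 (mul_pos hB0 hB0)]
      exact ⟨hCB, ((hmt.pow 3).eventually (gt_mem_nhds h3)).and
        ((hmt.pow 4).eventually (gt_mem_nhds h4))⟩
    · right
      have hC0' := hB0.trans hCB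
      have h3 : C ^ 3 < C * C := by nlinarith [mul_pos hC0' hC0']
      exact (ht1.eventually (lt_mem_nhds hCB)).and (((ht 2 two_ne_zero).eventually (lt_mem_nhds hCB)).and
        ((hmt.pow 3).eventually_lt (ht1.mul (ht 2 two_ne_zero)) h3))
  have hcase' : ∀ᶠ ρ in 𝓝[<] (1 : ℝ), (m ρ ^ 3 < B ^ 2 ∧ m ρ ^ 4 < B ^ 3) ∨
      (B < C * ρ ^ a ∧ B < C * (ρ ^ 2) ^ a ∧ m ρ ^ 3 < (C * ρ ^ a) * (C * (ρ ^ 2) ^ a)) := by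
    rcases hcase with ⟨-, hc⟩ | hc
    · exact hc.mono fun ρ => Or.inl
    · exact hc.mono fun ρ => Or.inr
  obtain ⟨ρ, hρ, hCρ, hCρ2, hCρ3, hB3, hρ1, P, hP, hPρ⟩ := ((eventually_normFilter (F := F) hcase').and
    ((eventually_normFilter hC).and ((eventually_normFilter ((tendsto_pow_nhdsLT two_ne_zero).eventually hC)).and
    ((eventually_normFilter ((tendsto_pow_nhdsLT three_ne_zero).eventually hC)).and
    ((eventually_normFilter hB3).and ((eventually_normFilter eventually_pos_lt_one).and
      h.eventually_exists_point)))))).exists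
  obtain ⟨hρ0, hρ1⟩ := hρ1
  have hB2 : B < ρ ^ 2 := hB3.trans (pow_lt_pow_right_of_lt_one₀ hρ0 hρ1 (by norm_num))
  obtain ⟨h2P, h2x⟩ := h.norm_xCoord_two_of_lt hP (by rwa [hPρ]) (by rwa [hPρ])
  rw [hPρ] at h2x
  obtain ⟨h3P, -, h3m, -⟩ := h.norm_xCoord_add_mul h2P hP
    (by rw [h2x, hPρ]; nlinarith) (by rwa [hPρ]) (by rw [h2x, hPρ, ← pow_succ]; exact hB3)
  rw [show P + P - P = P by abel, norm_mul, hPρ, h2x] at h3m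
  have h3x : ‖xCoord (P + P + P)‖ = ρ ^ 3 := by
    apply mul_right_cancel₀ hρ0.ne'
    rw [h3m]; ring
  obtain ⟨n1, e1⟩ := hCρ P hPρ
  obtain ⟨n2, e2⟩ := hCρ2 _ h2x
  obtain ⟨n3, e3⟩ := hCρ3 _ h3x
  have hne : xCoord (φ (P + P)) ≠ xCoord (φ P) := by
    intro heq
    rcases eq_or_eq_neg h.d_ne_zero h.b_ne_zero n2 n1 heq with h0 | h0
    · rw [map_add, add_eq_left] at h0
      exact n1 h0
    · apply n3
      rw [map_add, h0, neg_add_cancel]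
  obtain ⟨-, -, hS, hN⟩ := add_sub_relations n2 n1 hne
  have hs1 : φ (P + P) + φ P = φ (P + P + P) := (map_add φ _ _).symm
  have hs2 : φ (P + P) - φ P = φ P := by rw [map_add]; abel
  rw [hs1, hs2] at hS hN
  generalize xCoord (φ (P + P + P)) = u at *
  generalize xCoord (φ (P + P)) = z₂ at *
  generalize xCoord (φ P) = z₁ at *
  have m1 : ‖z₁‖ ≤ m ρ := by rw [e1]; exact le_max_left _ _
  have m2 : ‖z₂‖ ≤ m ρ := by rw [e2]; exact (le_max_left _ _).trans (le_max_right _ _)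
  have m3 : ‖u‖ ≤ m ρ := by rw [e3]; exact (le_max_right _ _).trans (le_max_right _ _)
  have hm0 : 0 ≤ m ρ := (norm_nonneg _).trans m1
  have ma : ‖z₂ + z₁‖ ≤ m ρ := norm_add_le_of_le_of_le m2 m1
  have md : ‖z₂ - z₁‖ ≤ m ρ := norm_sub_le_of_le_of_le m2 m1
  have mua : ‖u + z₁‖ ≤ m ρ := norm_add_le_of_le_of_le m3 m1
  generalize m ρ = M at *
  have kS : ‖(z₂ + b) * (z₁ + b)‖ ≤ M ^ 3 := by
    rw [← h.norm_four_mul, ← sub_eq_iff_eq_add'.2 hS]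
    apply norm_sub_le_of_le_of_le
    · rw [norm_mul, norm_pow]
      calc _ ≤ M * M ^ 2 := by gcongr
        _ = M ^ 3 := by ring
    · rw [norm_mul, norm_mul, norm_mul, h.norm_two, one_mul]
      calc _ ≤ M * M * M := by gcongr
        _ = M ^ 3 := by ring
  rcases hρ with ⟨hM3, hM4⟩ | ⟨hb1, hb2, hM3⟩
  · have kN : ‖b * ((z₂ + b) * (z₁ + b) - b ^ 2)‖ ≤ M ^ 4 := by
      rw [← h.norm_four_mul]
      have : 4 * d * (b * ((z₂ + b) * (z₁ + b) - b ^ 2)) =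
          z₂ ^ 2 * z₁ ^ 2 - u * z₁ * (z₂ - z₁) ^ 2 := by linear_combination hN
      rw [this]
      apply norm_sub_le_of_le_of_le
      · rw [norm_mul, norm_pow, norm_pow]
        calc _ ≤ M ^ 2 * M ^ 2 := by gcongr
          _ = M ^ 4 := by ring
      · rw [norm_mul, norm_mul, norm_pow]
        calc _ ≤ M * M * M ^ 2 := by gcongr
          _ = M ^ 4 := by ring
    rw [norm_mul, ← norm_neg (_ - _), neg_sub, norm_sub_eq_left_of_lt
      (by rw [norm_pow]; exact kS.trans_lt hM3), norm_pow] at kN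
    nlinarith
  · rw [← e1] at hb1 hM3
    rw [← e2] at hb2 hM3
    rw [norm_mul, norm_add_eq_left_of_lt hb1, norm_add_eq_left_of_lt hb2, mul_comm] at kS
    linarith

/-- Doubling `P` replaces `ρ` by `ρ²`, while doubling a point with `|x| > 1` preserves `|x|`. Hence
`C ρ^(2a) = C ρ^a`. -/
theorem eq_zero_of_one_lt {C : ℝ} {a : ℤ}
    (hC : ∀ᶠ ρ in 𝓝[<] (1 : ℝ), ∀ P, ‖xCoord P‖ = ρ → φ P ≠ 0 ∧ ‖xCoord (φ P)‖ = C * ρ ^ a)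
    (hlt : ∃ᶠ ρ in normFilter F, 1 < C * ρ ^ a) : a = 0 := by
  have hB2 : ∀ᶠ ρ in 𝓝[<] (1 : ℝ), ‖b‖ < ρ ^ 2 :=
    (tendsto_pow_nhdsLT two_ne_zero).eventually (nhdsWithin_le_nhds (lt_mem_nhds h.norm_b))
  obtain ⟨ρ, hlt, hCρ, hCρ2, hB2, hρ, P, hP, hPρ⟩ := (hlt.and_eventually
    ((eventually_normFilter (F := F) hC).and
    ((eventually_normFilter ((tendsto_pow_nhdsLT two_ne_zero).eventually hC)).and
    ((eventually_normFilter hB2).and ((eventually_normFilter eventually_pos_lt_one).and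
      h.eventually_exists_point))))).exists
  obtain ⟨h2P, h2x⟩ := h.norm_xCoord_two_of_lt hP (by rw [hPρ]; exact hρ.2) (by rwa [hPρ])
  obtain ⟨n1, e1⟩ := hCρ P hPρ
  obtain ⟨n2, e2⟩ := hCρ2 _ (by rw [h2x, hPρ])
  obtain ⟨-, e3⟩ := h.norm_xCoord_two_of_one_lt n1 (by rwa [e1])
  rw [← map_add, e2, e1] at e3
  have hC0 : C ≠ 0 := by
    rintro rfl
    rw [zero_mul] at hlt
    exact lt_asymm hlt one_pos
  have h4 := mul_left_cancel₀ hC0 e3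
  rw [← zpow_natCast, ← zpow_mul] at h4
  have h5 := zpow_right_injective₀ hρ.1 hρ.2.ne h4
  push_cast at h5
  omega

omit [IsAlgClosed F] in
-- Adding `P` or `-P` lowers the exponent of `ρ` by one. At exponent 1 a last addition reaches the
-- smooth locus or the point at infinity.
theorem exists_zsmul_add_smooth {P : (nodalCurve d b).toAffine.Point} (hP : P ≠ 0) {ρ : ℝ}
    (hPρ : ‖xCoord P‖ = ρ) (hρ0 : 0 < ρ) (hρ1 : ρ < 1) (k : ℕ) :
    ∀ Q : (nodalCurve d b).toAffine.Point, Q ≠ 0 → ‖xCoord Q‖ = ρ ^ (k + 1) → ‖b‖ < ρ ^ (k + 2) →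
      ∃ n : ℤ, |n| ≤ k + 1 ∧ (Q + n • P ≠ 0 → 1 ≤ ‖xCoord (Q + n • P)‖) := by
  induction k with
  | zero =>
    intro Q hQ hQρ hb
    rw [zero_add, pow_one] at hQρ
    rw [zero_add] at hb
    by_cases hx : xCoord Q = xCoord P
    · rcases eq_or_eq_neg h.d_ne_zero h.b_ne_zero hQ hP hx with rfl | rfl
      · exact ⟨-1, by simp, fun h0 => absurd (by simp) h0⟩
      · exact ⟨1, by simp, fun h0 => absurd (by simp) h0⟩
    rcases h.one_le_norm_xCoord_add_or hQ hP hx (by rw [hQρ, hPρ]) (by rwa [hPρ])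
      (by rwa [hPρ]) with h1 | h1
    · exact ⟨1, by simp, fun _ => by rwa [one_zsmul]⟩
    · exact ⟨-1, by simp, fun _ => by rwa [neg_one_zsmul, ← sub_eq_add_neg]⟩
  | succ k ih =>
    intro Q hQ hQρ hb
    have hb' : ‖b‖ < ρ ^ (k + 2) :=
      hb.trans (pow_lt_pow_right_of_lt_one₀ hρ0 hρ1 (by omega))
    have hdiv : ρ ^ (k + 1 + 1) / ρ = ρ ^ (k + 1) := by rw [pow_succ, mul_div_cancel_right₀ _ hρ0.ne']
    obtain ⟨n1, n2, -, h1⟩ := h.norm_xCoord_add_mul hQ hP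
      (by rw [hQρ, hPρ]; exact pow_lt_self_of_lt_one₀ hρ0 hρ1 (by omega)) (by rwa [hPρ])
      (by rw [hQρ, hPρ, ← pow_succ]; exact hb)
    rw [hQρ, hPρ, hdiv] at h1
    rcases h1 with h1 | h1
    · obtain ⟨n, hn, h2⟩ := ih _ n1 h1 hb'
      refine ⟨n + 1, ?_, ?_⟩
      · push_cast
        rw [abs_le] at hn ⊢
        omega
      · rwa [add_zsmul, one_zsmul, add_comm (n • P), ← add_assoc]
    · obtain ⟨n, hn, h2⟩ := ih _ n2 h1 hb'
      refine ⟨n - 1, ?_, ?_⟩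
      · push_cast
        rw [abs_le] at hn ⊢
        omega
      · rwa [show Q + (n - 1) • P = Q - P + n • P by rw [sub_zsmul, one_zsmul]; abel]

/-- Either `a = 0` already, or `C = 1` and `a > 0`. In the second case some `φ + N` sends points
with `|x| = ρ` to the smooth locus for frequently many `ρ`, and this forces its exponent to vanish.
It is not zero because `φ` is not an integer. -/
theorem exists_norm_xCoord_eq_const [CharZero F] [(normFilter F).NeBot] (hφ : IsRationalMap φ)
    (hZ : ∀ n : ℤ, φ ≠ n • AddMonoidHom.id _) :
    ∃ ψ : (nodalCurve d b).toAffine.Point →+ (nodalCurve d b).toAffine.Point, IsRationalMap ψ ∧ ψ ≠ 0 ∧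
      ∃ C : ℝ, 1 ≤ C ∧ ∀ᶠ ρ in 𝓝[<] (1 : ℝ), ∀ P, ‖xCoord P‖ = ρ →
        ψ P ≠ 0 ∧ ‖xCoord (ψ P)‖ = C := by
  have hφ0 : φ ≠ 0 := by simpa using hZ 0
  obtain ⟨C, a, hC0, hC⟩ := h.exists_norm_xCoord_eq hφ hφ0
  have hC1 := h.one_le_of_norm_xCoord_eq hC0 hC
  by_cases ha : a = 0
  · subst ha
    exact ⟨φ, hφ, hφ0, C, hC1, by simpa using hC⟩
  have hC' : C = 1 := by
    refine le_antisymm ?_ hC1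
    by_contra! hlt
    exact ha (h.eq_zero_of_one_lt hC
      ((eventually_normFilter_of_nhds ((tendsto_const_mul_zpow C a).eventually (lt_mem_nhds hlt))).frequently))
  subst hC'
  have hapos : 0 < a := by
    by_contra! hneg
    refine ha (h.eq_zero_of_one_lt hC (Eventually.frequently ?_))
    filter_upwards [eventually_normFilter eventually_pos_lt_one] with ρ hρ
    rw [one_mul]
    exact one_lt_zpow_of_neg₀ hρ.1 hρ.2 (lt_of_le_of_ne hneg ha)
  obtain ⟨k, rfl⟩ : ∃ k : ℕ, a = (k + 1 : ℕ) := ⟨(a - 1).toNat, by omega⟩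
  have hBk : ∀ᶠ ρ in 𝓝[<] (1 : ℝ), ‖b‖ < ρ ^ (k + 2) :=
    (tendsto_pow_nhdsLT (by omega)).eventually (nhdsWithin_le_nhds (lt_mem_nhds h.norm_b))
  have hex : ∀ᶠ ρ in normFilter F, ∃ n ∈ Finset.Icc (-(k + 1) : ℤ) (k + 1),
      ∃ P, ‖xCoord P‖ = ρ ∧ (φ P + n • P ≠ 0 → 1 ≤ ‖xCoord (φ P + n • P)‖) := by
    filter_upwards [eventually_normFilter hC, eventually_normFilter hBk, eventually_normFilter eventually_pos_lt_one,
      h.eventually_exists_point] with ρ hC hBk hρ ⟨P, hP, hPρ⟩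
    obtain ⟨n1, e1⟩ := hC P hPρ
    rw [one_mul, zpow_natCast] at e1
    obtain ⟨n, hn, h1⟩ := h.exists_zsmul_add_smooth hP hPρ hρ.1 hρ.2 k _ n1 e1 hBk
    exact ⟨n, Finset.mem_Icc.2 (abs_le.1 hn), P, hPρ, h1⟩
  -- The pigeonhole principle: the bound on `n` does not depend on `ρ`, so one value occurs
  -- frequently.
  obtain ⟨N, hN⟩ : ∃ N : ℤ, ∃ᶠ ρ in normFilter F,
      ∃ P, ‖xCoord P‖ = ρ ∧ (φ P + N • P ≠ 0 → 1 ≤ ‖xCoord (φ P + N • P)‖) := by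
    by_contra! hno
    have h1 : ∀ᶠ ρ in normFilter F, ∀ n ∈ Finset.Icc (-(k + 1) : ℤ) (k + 1),
        ¬ ∃ P, ‖xCoord P‖ = ρ ∧ (φ P + n • P ≠ 0 → 1 ≤ ‖xCoord (φ P + n • P)‖) :=
      (Finset.eventually_all _).2 fun n _ => not_frequently.1 (by simpa using hno n)
    obtain ⟨ρ, h1, n, hn, h2⟩ := (h1.and hex).exists
    exact h1 n hn h2
  set ψ := φ + N • AddMonoidHom.id (nodalCurve d b).toAffine.Point with hψ
  have hψr : IsRationalMap ψ :=
    hφ.add h.d_ne_zero h.b_ne_zero (IsRationalMap.id.zsmul h.d_ne_zero h.b_ne_zero N)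
  have hψ0 : ψ ≠ 0 := by
    intro h0
    apply hZ (-N)
    rw [neg_zsmul, eq_neg_iff_add_eq_zero]
    exact h0
  obtain ⟨C', a', hC0', hC'⟩ := h.exists_norm_xCoord_eq hψr hψ0
  have hC1' := h.one_le_of_norm_xCoord_eq hC0' hC'
  have ha' : a' = 0 := by
    by_contra ha'
    have hC1'' : C' = 1 := by
      refine le_antisymm ?_ hC1'
      by_contra! hlt
      exact ha' (h.eq_zero_of_one_lt hC'
        ((eventually_normFilter_of_nhds ((tendsto_const_mul_zpow C' a').eventually (lt_mem_nhds hlt))).frequently))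
    subst hC1''
    refine ha' (h.eq_zero_of_one_lt hC' ?_)
    refine (hN.and_eventually ((eventually_normFilter hC').and
      (eventually_normFilter eventually_pos_lt_one))).mono ?_
    rintro ρ ⟨⟨P, hPρ, hP⟩, hCρ, hρ⟩
    obtain ⟨n1, e1⟩ := hCρ P hPρ
    have h1 : 1 ≤ ‖xCoord (ψ P)‖ := hP n1
    rw [e1] at h1
    refine lt_of_le_of_ne h1 fun h2 => ha' ?_
    rw [one_mul, ← zpow_zero ρ] at h2
    exact (zpow_right_injective₀ hρ.1 hρ.2.ne h2).symm
  subst ha'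
  exact ⟨ψ, hψr, hψ0, C', hC1', by simpa using hC'⟩

end Main

end IsNodal

end

section

open Filter Topology Polynomial nodalCurve

namespace IsNodal

variable {F : Type*} [NormedField F] [IsUltrametricDist F] [IsAlgClosed F] [CharZero F]
  [DecidableEq F] {d b : F} (h : IsNodal d b)
  {φ : (nodalCurve d b).toAffine.Point →+ (nodalCurve d b).toAffine.Point}
include h

omit [IsAlgClosed F] [CharZero F] in
-- Write `Q = (Q + P) - P` with `|x(P)| = ρ` just below 1. Both `Q + P` and `P` have `|x| = ρ`, so
-- `φ` sends them to the smooth locus, which is a subgroup.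
theorem smooth_map [(normFilter F).NeBot] [IsAlgClosed F] {C : ℝ} (hC1 : 1 ≤ C)
    (hC : ∀ᶠ ρ in 𝓝[<] (1 : ℝ), ∀ P, ‖xCoord P‖ = ρ → φ P ≠ 0 ∧ ‖xCoord (φ P)‖ = C)
    {Q : (nodalCurve d b).toAffine.Point} (hQ : 1 ≤ ‖xCoord Q‖) :
    φ Q ≠ 0 → 1 ≤ ‖xCoord (φ Q)‖ := by
  have hB2 : ∀ᶠ ρ in 𝓝[<] (1 : ℝ), ‖b‖ < ρ ^ 2 :=
    (tendsto_pow_nhdsLT two_ne_zero).eventually (nhdsWithin_le_nhds (lt_mem_nhds h.norm_b))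
  have hQ0 : Q ≠ 0 := by
    rintro rfl
    have h0 : ‖(0 : F)‖ ≥ 1 := hQ
    rw [norm_zero] at h0
    linarith
  obtain ⟨ρ, hCρ, hB2, hρ, P, hP, hPρ⟩ := ((eventually_normFilter (F := F) hC).and
    ((eventually_normFilter hB2).and ((eventually_normFilter eventually_pos_lt_one).and
      h.eventually_exists_point))).exists
  obtain ⟨-, -, h1, -⟩ := h.norm_xCoord_add_eq hQ0 hP hQ (by rw [hPρ]; linarith) (by rwa [hPρ])
  have hP' : φ (-P) ≠ 0 → 1 ≤ ‖xCoord (φ (-P))‖ := fun _ => by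
    rw [map_neg, xCoord_neg, (hCρ P hPρ).2]; exact hC1
  have hQP : φ (Q + P) ≠ 0 → 1 ≤ ‖xCoord (φ (Q + P))‖ := fun _ => by
    rw [(hCρ _ (h1.trans hPρ)).2]; exact hC1
  have := h.smooth_add hQP hP'
  rwa [← map_add, add_neg_cancel_right] at this

/-- For a generic `w` in the open unit disc all roots of `p - w r` lie in that disc, because smooth
points go to smooth points. Comparing growth on `|x| = ρ` with that of `r` shows that `r` has `max
(deg p) (deg r)` roots there. -/
theorem isRational_bounded [(normFilter F).NeBot] {t : F} (ht0 : t ≠ 0) (ht1 : ‖t‖ < 1)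
    (hφ : IsRationalMap φ) (hφ0 : φ ≠ 0) {C : ℝ} (hC1 : 1 ≤ C)
    (hC : ∀ᶠ ρ in 𝓝[<] (1 : ℝ), ∀ P, ‖xCoord P‖ = ρ → φ P ≠ 0 ∧ ‖xCoord (φ P)‖ = C) :
    ∃ p r : F[X], r ≠ 0 ∧ p.natDegree ≤ r.natDegree ∧ ∀ᶠ P in cofinite,
      xCoord (φ P) * r.eval (xCoord P) = p.eval (xCoord P) := by
  obtain ⟨p, r, hr, hcop, hpr⟩ := hφ.exists_xCoord_eq h.d_ne_zero h.b_ne_zero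
  refine ⟨p, r, hr, ?_, hpr⟩
  have hne := h.eventually_ne_zero_of_isRationalMap hφ hφ0
  set M := max p.natDegree r.natDegree with hM
  have hgood := hne.and hpr
  have hfin := eventually_cofinite.1 hgood
  set S := {P | ¬(φ P ≠ 0 ∧ xCoord (φ P) * r.eval (xCoord P) = p.eval (xCoord P))} with hS
  have hinf : {w : F | ‖w‖ < 1}.Infinite := by
    refine Set.infinite_of_injective_forall_mem (f := fun n : ℕ => t ^ (n + 1)) ?_ ?_
    · intro m n hmn
      have := congrArg norm hmn
      simp only [norm_pow] at this
      have := pow_right_injective₀ (norm_pos_iff.2 ht0) ht1.ne this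
      omega
    · intro n
      change ‖t ^ (n + 1)‖ < 1
      rw [norm_pow]
      exact pow_lt_one₀ (norm_nonneg _) ht1 (by omega)
  -- The excluded values are those of `p / r` at the exceptional points and the one that would lower
  -- the degree of `p - w r`.
  obtain ⟨w, hw1, hw⟩ := hinf.exists_notMem_finite
    ((hfin.image fun P => p.eval (xCoord P) / r.eval (xCoord P)).union
      (Set.finite_singleton (p.coeff M / r.coeff M)))
  rw [Set.mem_union, not_or] at hw
  obtain ⟨hwS, hwM⟩ := hw
  set H := p - Polynomial.C w * r with hH
  have heval : ∀ x, H.eval x = p.eval x - w * r.eval x := fun x => by simp [hH]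
  have hcoeff : H.coeff M ≠ 0 := by
    rw [hH, coeff_sub, coeff_C_mul]
    intro h0
    by_cases hrM : r.coeff M = 0
    · rw [hrM, mul_zero, sub_zero] at h0
      rcases max_choice p.natDegree r.natDegree with h1 | h1
      · rw [hM, h1, coeff_natDegree, leadingCoeff_eq_zero] at h0
        have h2 : r.natDegree = 0 := by
          have := le_max_right p.natDegree r.natDegree
          rw [h1, h0, natDegree_zero] at this
          omega
        rw [hM, h1, h0, natDegree_zero, ← h2, coeff_natDegree, leadingCoeff_eq_zero] at hrM
        exact hr hrM
      · rw [hM, h1, coeff_natDegree, leadingCoeff_eq_zero] at hrM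
        exact hr hrM
    · exact hwM (eq_div_of_mul_eq hrM (sub_eq_zero.1 h0).symm)
  have hH0 : H ≠ 0 := by
    intro h0
    rw [h0] at hcoeff
    exact hcoeff (coeff_zero M)
  have hHdeg : H.natDegree = M := by
    refine le_antisymm ?_ (le_natDegree_of_ne_zero hcoeff)
    exact (natDegree_sub_le _ _).trans (max_le_max le_rfl (natDegree_C_mul_le _ _))
  have hroots : ∀ x ∈ H.roots, ‖x‖ < 1 := by
    intro x hx
    rw [mem_roots hH0, IsRoot.def, heval, sub_eq_zero] at hx
    by_contra! hx1
    obtain ⟨P, hP, rfl⟩ := exists_point h.disc_ne_zero x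
    have hr0 : r.eval (xCoord P) ≠ 0 := by
      intro h0
      rw [h0, mul_zero] at hx
      obtain ⟨u, v, huv⟩ := hcop
      have := congrArg (eval (xCoord P)) huv
      simp [h0, hx] at this
    by_cases hPS : P ∈ S
    · exact hwS ⟨P, hPS, (eq_div_of_mul_eq hr0 hx.symm).symm⟩
    · obtain ⟨h1, h2⟩ := not_not.1 hPS
      rw [hx] at h2
      have h3 := h.smooth_map hC1 hC hx1 h1
      rw [mul_right_cancel₀ hr0 h2] at h3
      exact h3.not_gt hw1
  obtain ⟨cH, hcH, hcH'⟩ := exists_norm_eval_eq hH0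
  obtain ⟨cr, hcr, hcr'⟩ := exists_norm_eval_eq hr
  have hcount : (H.roots.countP fun x => ‖x‖ < 1) = M := by
    rw [Multiset.countP_eq_card.2 hroots, ← (IsAlgClosed.splits H).natDegree_eq_card_roots, hHdeg]
  have hMr : M = r.roots.countP fun x => ‖x‖ < 1 := by
    refine eq_of_frequently_mul_pow_eq (normFilter_le (F := F)) hcH (c₂ := C * cr) (Eventually.frequently ?_)
    filter_upwards [eventually_normFilter hcH', eventually_normFilter hcr',
      eventually_normFilter (eventually_nhdsLT_of_cofinite hpr), eventually_normFilter hC,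
      eventually_normFilter eventually_pos_lt_one, h.eventually_exists_point]
      with ρ h1 h2 h3 h4 h5 ⟨P, hP, hPρ⟩
    have e1 := h1 _ hPρ
    have e2 := h2 _ hPρ
    rw [hcount] at e1
    have e3 : ‖p.eval (xCoord P)‖ = C * ‖r.eval (xCoord P)‖ := by
      rw [← h3 P hPρ, norm_mul, (h4 P hPρ).2]
    have e4 : 0 < ‖r.eval (xCoord P)‖ := by
      rw [e2]; exact mul_pos hcr (pow_pos h5.1 _)
    have hw1' : ‖w‖ < 1 := hw1
    rw [← e1, heval, norm_sub_eq_left_of_lt, e3, e2, mul_assoc]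
    rw [norm_mul, e3]
    nlinarith
  calc p.natDegree ≤ M := le_max_left _ _
    _ = r.roots.countP fun x => ‖x‖ < 1 := hMr
    _ ≤ Multiset.card r.roots := Multiset.countP_le_card _ _
    _ ≤ r.natDegree := card_roots' r

/-- Near infinity `x ∘ ψ` is at distance less than 1 from some `c`. Choose `P₁`, `P₂` such that `P₁
± P₂` are near infinity as well; the product relation for the images then has sides of different
norm. -/
theorem eq_zsmul_of_isRationalMap {t : F} (ht0 : t ≠ 0) (ht1 : ‖t‖ < 1) (hφ : IsRationalMap φ) :
    ∃ n : ℤ, φ = n • AddMonoidHom.id _ := by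
  have := normFilter_neBot ht0 ht1
  by_contra! hZ
  obtain ⟨ψ, hψ, hψ0, C, hC1, hC⟩ := h.exists_norm_xCoord_eq_const hφ hZ
  obtain ⟨p, r, hr, hdeg, hpr⟩ := h.isRational_bounded ht0 ht1 hψ hψ0 hC1 hC
  have hne := h.eventually_ne_zero_of_isRationalMap hψ hψ0
  obtain ⟨c, R₁, hR₁⟩ := exists_norm_eval_sub_lt hr hdeg
  obtain ⟨R₂, hR₂⟩ := exists_bound_of_cofinite (hne.and hpr)
  set R := max 1 (max R₁ R₂) with hR
  have key : ∀ P, R ≤ ‖xCoord P‖ → ψ P ≠ 0 ∧ ‖xCoord (ψ P) - c‖ < 1 ∧ 1 ≤ ‖xCoord (ψ P)‖ := by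
    intro P hP
    simp only [hR, max_le_iff] at hP
    obtain ⟨h1, h2, h3⟩ := hP
    obtain ⟨h4, h5⟩ := hR₂ P h3
    refine ⟨h4, ?_, h.smooth_map hC1 hC h1 h4⟩
    have h6 := hR₁ _ h2
    rw [← h5, ← sub_mul, norm_mul] at h6
    have h7 : 0 < ‖r.eval (xCoord P)‖ := by
      by_contra! h0
      nlinarith [norm_nonneg (xCoord (ψ P) - c), norm_nonneg (r.eval (xCoord P))]
    by_contra! h0
    nlinarith
  have hex : ∀ K : ℝ, ∃ P : (nodalCurve d b).toAffine.Point, P ≠ 0 ∧ K < ‖xCoord P‖ := by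
    intro K
    have ht : 1 < ‖t⁻¹‖ := by
      rw [norm_inv]
      exact (one_lt_inv₀ (norm_pos_iff.2 ht0)).2 ht1
    obtain ⟨n, hn⟩ := pow_unbounded_of_one_lt K ht
    obtain ⟨P, hP, hPx⟩ := exists_point h.disc_ne_zero (t⁻¹ ^ n)
    exact ⟨P, hP, by rwa [hPx, norm_pow]⟩
  obtain ⟨P₂, hP₂, hx₂⟩ := hex R
  obtain ⟨P₁, hP₁, hx₁⟩ := hex ‖xCoord P₂‖
  have hR1 : 1 ≤ R := le_max_left _ _
  obtain ⟨n₃, n₄, hx₃, hx₄⟩ := h.norm_xCoord_add_eq hP₁ hP₂ (by linarith) hx₁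
    (by nlinarith [h.norm_b])
  obtain ⟨m₁, e₁, l₁⟩ := key P₁ (by linarith)
  obtain ⟨m₂, e₂, l₂⟩ := key P₂ (by linarith)
  obtain ⟨m₃, e₃, l₃⟩ := key (P₁ + P₂) (by linarith)
  obtain ⟨m₄, e₄, l₄⟩ := key (P₁ - P₂) (by linarith)
  have hne : xCoord (ψ P₁) ≠ xCoord (ψ P₂) := by
    intro heq
    rcases eq_or_eq_neg h.d_ne_zero h.b_ne_zero m₁ m₂ heq with h0 | h0
    · exact m₄ (by rw [map_sub, h0, sub_self])
    · exact m₃ (by rw [map_add, h0, neg_add_cancel])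
  obtain ⟨-, -, -, hN⟩ := add_sub_relations m₁ m₂ hne
  rw [← map_add, ← map_sub] at hN
  generalize xCoord (ψ (P₁ + P₂)) = z₃ at *
  generalize xCoord (ψ (P₁ - P₂)) = z₄ at *
  generalize xCoord (ψ P₁) = z₁ at *
  generalize xCoord (ψ P₂) = z₂ at *
  have hnorm : ∀ z : F, ‖z - c‖ < 1 → 1 ≤ ‖z‖ → ‖z‖ = ‖c‖ := by
    intro z h1 h2
    rw [← norm_sub_eq_left_of_lt (h1.trans_le h2), sub_sub_cancel]
  have lc : 1 ≤ ‖c‖ := by rwa [hnorm z₁ e₁ l₁] at l₁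
  have hsub : ‖z₁ - z₂‖ < 1 := by
    rw [← sub_sub_sub_cancel_right z₁ z₂ c]
    exact norm_sub_lt_of_lt e₁ e₂
  have hadd : ‖z₁ + z₂‖ ≤ ‖c‖ := norm_add_le_of_le_of_le (hnorm z₁ e₁ l₁).le (hnorm z₂ e₂ l₂).le
  have hc2 : 1 ≤ ‖c‖ ^ 2 := one_le_pow₀ lc
  have hlead : ‖z₁ ^ 2 * z₂ ^ 2‖ = ‖c‖ ^ 2 * ‖c‖ ^ 2 := by
    rw [norm_mul, norm_pow, norm_pow, hnorm z₁ e₁ l₁, hnorm z₂ e₂ l₂]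
  have k1 : ‖4 * d * (b * (z₁ * z₂))‖ < ‖z₁ ^ 2 * z₂ ^ 2‖ := by
    rw [hlead, h.norm_four_mul, norm_mul, norm_mul, hnorm z₁ e₁ l₁, hnorm z₂ e₂ l₂]
    nlinarith [h.norm_b]
  have k2 : ‖4 * d * (b ^ 2 * (z₁ + z₂))‖ < ‖z₁ ^ 2 * z₂ ^ 2‖ := by
    rw [hlead, h.norm_four_mul, norm_mul, norm_pow]
    have hb2 : ‖b‖ ^ 2 < 1 := by nlinarith [h.norm_b, norm_nonneg b]
    calc ‖b‖ ^ 2 * ‖z₁ + z₂‖ ≤ ‖b‖ ^ 2 * ‖c‖ := by gcongr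
      _ < ‖c‖ ^ 2 * ‖c‖ ^ 2 := by nlinarith
  -- This reads `|c|² |z₁ - z₂|² = |c|⁴`, impossible since `|z₁ - z₂| < 1 ≤ |c|`.
  have hfin := congrArg norm hN
  rw [sub_sub, norm_sub_eq_left_of_lt (norm_add_lt_of_lt k1 k2), hlead, norm_mul, norm_mul, norm_pow,
    hnorm z₃ e₃ l₃, hnorm z₄ e₄ l₄] at hfin
  have : ‖z₁ - z₂‖ ^ 2 < 1 := pow_lt_one₀ (norm_nonneg _) hsub two_ne_zero
  nlinarith

theorem eq_zsmul_of_finite {t : F} (ht0 : t ≠ 0) (ht1 : ‖t‖ < 1) {W : WeierstrassCurve F}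
    (hW : W = nodalCurve d b) (φ : W.toAffine.Point →+ W.toAffine.Point) (p q r s : F[X][X])
    (hfin : {P : W.toAffine.Point | ¬ ∃ (x y x' y' : F) (h : W.toAffine.Nonsingular x y)
        (h' : W.toAffine.Nonsingular x' y'),
      P = .some x y h ∧ φ P = .some x' y' h' ∧
      q.evalEval x y ≠ 0 ∧ x' = p.evalEval x y / q.evalEval x y ∧
      s.evalEval x y ≠ 0 ∧ y' = r.evalEval x y / s.evalEval x y}.Finite) :
    ∃ n : ℤ, φ = n • AddMonoidHom.id _ := by
  subst hW
  refine h.eq_zsmul_of_isRationalMap ht0 ht1 ⟨?_, ?_⟩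
  · refine ((IsRational.evalEval p).div h.d_ne_zero h.b_ne_zero (IsRational.evalEval q)).congr ?_
    rw [eventually_cofinite]
    refine hfin.subset fun P hP hex => hP ?_
    obtain ⟨x, y, x', y', hxy, hxy', rfl, h1, -, h2, -, -⟩ := hex
    rw [h1]
    exact h2.symm
  · refine ((IsRational.evalEval r).div h.d_ne_zero h.b_ne_zero (IsRational.evalEval s)).congr ?_
    rw [eventually_cofinite]
    refine hfin.subset fun P hP hex => hP ?_
    obtain ⟨x, y, x', y', hxy, hxy', rfl, h1, -, -, -, h2⟩ := hex
    rw [h1]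
    exact h2.symm

end IsNodal

/-- The norm on `ℚ̄` restricted from an algebraic closure of `ℚ_[p]`. -/
abbrev padicNormedField (p : ℕ) [Fact p.Prime] : NormedField Qbar :=
  NormedField.induced Qbar (PadicAlgCl p)
    (IsAlgClosed.lift : Qbar →ₐ[ℚ] PadicAlgCl p) (RingHom.injective _)

/-- An embedding of `ℚ̄` into an algebraic closure of `ℚ_[p]` gives an ultrametric norm for which
the curve reduces to a node, as `p ≠ 2` and `d` is a unit. -/
theorem not_hasCM_of_eq_nodalCurve {E : WeierstrassCurve ℚ} {d b : ℚ} (hE : E = nodalCurve d b)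
    (p : ℕ) [Fact p.Prime] (hp : p ≠ 2) (hb0 : b ≠ 0) (hd : padicNorm p d = 1) (hb : padicNorm p b < 1) :
    ¬ HasCM E := by
  let _ : NormedField Qbar := padicNormedField p
  have hnorm : ∀ x : Qbar, ‖x‖ = ‖(IsAlgClosed.lift : Qbar →ₐ[ℚ] PadicAlgCl p) x‖ := fun x => rfl
  have : IsUltrametricDist Qbar :=
    IsUltrametricDist.isUltrametricDist_of_isNonarchimedean_norm fun x y => by
      rw [hnorm, map_add]
      exact PadicAlgCl.isNonarchimedean p _ _
  have hq : ∀ q : ℚ, ‖algebraMap ℚ Qbar q‖ = padicNorm p q := by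
    intro q
    rw [hnorm, AlgHom.commutes, IsScalarTower.algebraMap_apply ℚ ℚ_[p] (PadicAlgCl p)]
    exact (PadicAlgCl.norm_extends p _).trans (by rw [eq_ratCast, Padic.eq_padicNorm])
  have hN : IsNodal (algebraMap ℚ Qbar d) (algebraMap ℚ Qbar b) := by
    refine ⟨?_, ?_, ?_, ?_⟩
    · have := hq 2
      rw [map_ofNat] at this
      rw [this]
      have h2 : padicNorm p ((2 : ℕ) : ℚ) = 1 :=
        (padicNorm.nat_eq_one_iff 2).2 fun h => hp ((Nat.prime_dvd_prime_iff_eq Fact.out Nat.prime_two).1 h)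
      exact_mod_cast h2
    · rw [hq, hd, Rat.cast_one]
    · exact (_root_.map_ne_zero _).2 hb0
    · rw [hq]; exact_mod_cast hb
  have ht : ‖algebraMap ℚ Qbar p‖ < 1 := by
    rw [hq]; exact_mod_cast padicNorm.padicNorm_p_lt_one_of_prime
  have ht0 : algebraMap ℚ Qbar p ≠ 0 :=
    (_root_.map_ne_zero _).2 (Nat.cast_ne_zero.2 (Fact.out : p.Prime).ne_zero)
  rintro ⟨φ, hφ, hZ⟩
  rcases hφ with rfl | ⟨p, q, r, s, hfin⟩
  · exact hZ 0 (by ext P; exact (zero_zsmul P).symm)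
  have hE' : E⁄Qbar = nodalCurve (algebraMap ℚ Qbar d) (algebraMap ℚ Qbar b) := by
    rw [hE]; exact nodalCurve.map_eq (algebraMap ℚ Qbar) d b
  obtain ⟨n, hn⟩ := hN.eq_zsmul_of_finite ht0 ht hE' φ p q r s hfin
  exact hZ n hn

end

/-! ### Roots of the division polynomials and cube roots of the discriminant. -/

namespace WeierstrassCurve

section Field

variable {F : Type*} [Field F] [CharZero F] {W : WeierstrassCurve F}

/-- `x₁` and `X` are the roots of the 3-division polynomial. -/
def IsThreeRoots (W : WeierstrassCurve F) (x₁ : F) (X : ZMod 3 → F) : Prop :=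
  Function.Injective X ∧ ∀ x, W.psiThree x = 3 * (x - x₁) * ((x - X 0) * (x - X 1) * (x - X 2))

/-- `e` are the roots of the 2-division polynomial. -/
def IsTwoRoots (W : WeierstrassCurve F) (e : ZMod 3 → F) : Prop :=
  Function.Injective e ∧ ∀ x, W.psiTwoSq x = 4 * (x - e 0) * (x - e 1) * (x - e 2)

/-- For the roots `x₁` and `x` of the 3-division polynomial, a cube root of the discriminant. -/
def cubeRootΔ (W : WeierstrassCurve F) (x₁ x : F) : F :=
  -2 * W.b₄ - (x + x₁) * (3 * x + W.b₂ + 3 * x₁)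

section ThreeRoots

variable {x₁ : F} {X : ZMod 3 → F} (h : W.IsThreeRoots x₁ X)
include h

theorem IsThreeRoots.coeff_eq :
    W.b₂ = -3 * (x₁ + (X 0 + X 1 + X 2)) ∧
    W.b₄ = x₁ * (X 0 + X 1 + X 2) + (X 0 * X 1 + X 0 * X 2 + X 1 * X 2) ∧
    W.b₆ = -(x₁ * (X 0 * X 1 + X 0 * X 2 + X 1 * X 2) + X 0 * X 1 * X 2) ∧
    W.b₈ = 3 * x₁ * (X 0 * X 1 * X 2) := by
  have h0 := h.2 0
  have h1 := h.2 1
  have h2 := h.2 (-1)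
  have h3 := h.2 2
  simp only [psiThree] at h0 h1 h2 h3
  refine ⟨?_, ?_, ?_, ?_⟩
  · linear_combination (h3 - 3 * h1 + 3 * h0 - h2) / 6
  · linear_combination (h1 + h2 - 2 * h0) / 6
  · linear_combination (-h3 + 6 * h1 - 3 * h0 - 2 * h2) / 18
  · linear_combination h0

theorem IsThreeRoots.psiThree_eq_zero_iff {x : F} :
    W.psiThree x = 0 ↔ x = x₁ ∨ ∃ k, x = X k := by
  rw [h.2, mul_eq_zero, mul_eq_zero, mul_eq_zero, mul_eq_zero, sub_eq_zero, sub_eq_zero,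
    sub_eq_zero, sub_eq_zero]
  constructor
  · rintro ((h3 | h) | (h | h) | h)
    · exact absurd h3 three_ne_zero
    · exact Or.inl h
    · exact Or.inr ⟨0, h⟩
    · exact Or.inr ⟨1, h⟩
    · exact Or.inr ⟨2, h⟩
  · rintro (h | ⟨k, h⟩)
    · exact Or.inl (Or.inr h)
    · right
      fin_cases k
      · exact Or.inl (Or.inl h)
      · exact Or.inl (Or.inr h)
      · exact Or.inr h

/-- The relation between the `bᵢ`, rewritten for the elementary symmetric functions of the
differences `X k - x₁`: `3σ₁σ₃ = σ₂²`. -/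
theorem IsThreeRoots.sigma_relation :
    3 * ((X 0 - x₁) + (X 1 - x₁) + (X 2 - x₁)) * ((X 0 - x₁) * (X 1 - x₁) * (X 2 - x₁)) =
      ((X 0 - x₁) * (X 1 - x₁) + (X 0 - x₁) * (X 2 - x₁) + (X 1 - x₁) * (X 2 - x₁)) ^ 2 := by
  obtain ⟨h2, h4, h6, h8⟩ := h.coeff_eq
  have hb := W.b_relation
  rw [h2, h4, h6, h8] at hb
  linear_combination -hb

theorem IsThreeRoots.cubeRootΔ_eq :
    (∀ k, W.cubeRootΔ x₁ (X k) = (X 0 - x₁) * (X 1 - x₁) + (X 0 - x₁) * (X 2 - x₁) +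
      (X 1 - x₁) * (X 2 - x₁) - 3 * ((X (k + 1) - x₁) * (X (k + 2) - x₁))) := by
  obtain ⟨h2, h4, h6, h8⟩ := h.coeff_eq
  have e1 : (1 : ZMod 3) + 1 = 2 := rfl
  have e2 : (1 : ZMod 3) + 2 = 0 := rfl
  have e3 : (2 : ZMod 3) + 1 = 0 := rfl
  have e4 : (2 : ZMod 3) + 2 = 1 := rfl
  intro k
  fin_cases k
  · change W.cubeRootΔ x₁ (X 0) = _ - 3 * ((X (0 + 1) - x₁) * (X (0 + 2) - x₁))
    rw [cubeRootΔ, zero_add, zero_add, h2, h4]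
    ring
  · change W.cubeRootΔ x₁ (X 1) = _ - 3 * ((X (1 + 1) - x₁) * (X (1 + 2) - x₁))
    rw [cubeRootΔ, e1, e2, h2, h4]
    ring
  · change W.cubeRootΔ x₁ (X 2) = _ - 3 * ((X (2 + 1) - x₁) * (X (2 + 2) - x₁))
    rw [cubeRootΔ, e3, e4, h2, h4]
    ring

/-- The three numbers are the roots of `T³ - Δ`; the second symmetric function vanishes by
`sigma_relation`. -/
theorem IsThreeRoots.cubeRootΔ_relations :
    W.cubeRootΔ x₁ (X 0) + W.cubeRootΔ x₁ (X 1) + W.cubeRootΔ x₁ (X 2) = 0 ∧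
    W.cubeRootΔ x₁ (X 0) * W.cubeRootΔ x₁ (X 1) + W.cubeRootΔ x₁ (X 0) * W.cubeRootΔ x₁ (X 2) +
      W.cubeRootΔ x₁ (X 1) * W.cubeRootΔ x₁ (X 2) = 0 ∧
    W.cubeRootΔ x₁ (X 0) * W.cubeRootΔ x₁ (X 1) * W.cubeRootΔ x₁ (X 2) = W.Δ := by
  obtain ⟨h2, h4, h6, h8⟩ := h.coeff_eq
  have hb := h.sigma_relation
  have hD := h.cubeRootΔ_eq
  rw [hD 0, hD 1, hD 2, WeierstrassCurve.Δ, h2, h4, h6, h8]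
  rw [show (0 : ZMod 3) + 1 = 1 from rfl, show (0 : ZMod 3) + 2 = 2 from rfl,
    show (1 : ZMod 3) + 1 = 2 from rfl, show (1 : ZMod 3) + 2 = 0 from rfl,
    show (2 : ZMod 3) + 1 = 0 from rfl, show (2 : ZMod 3) + 2 = 1 from rfl]
  refine ⟨by ring, by linear_combination 3 * hb, ?_⟩
  linear_combination (-6 * ((X 0 - x₁) * (X 1 - x₁) + (X 0 - x₁) * (X 2 - x₁) +
    (X 1 - x₁) * (X 2 - x₁)) - 18 * (x₁ + (X 0 + X 1 + X 2)) * x₁ + 36 * x₁ ^ 2) * hb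

theorem IsThreeRoots.cubeRootΔ_pow_three (k : ZMod 3) : W.cubeRootΔ x₁ (X k) ^ 3 = W.Δ := by
  obtain ⟨h1, h2, h3⟩ := h.cubeRootΔ_relations
  fin_cases k
  · change W.cubeRootΔ x₁ (X 0) ^ 3 = W.Δ
    linear_combination W.cubeRootΔ x₁ (X 0) ^ 2 * h1 - W.cubeRootΔ x₁ (X 0) * h2 + h3
  · change W.cubeRootΔ x₁ (X 1) ^ 3 = W.Δ
    linear_combination W.cubeRootΔ x₁ (X 1) ^ 2 * h1 - W.cubeRootΔ x₁ (X 1) * h2 + h3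
  · change W.cubeRootΔ x₁ (X 2) ^ 3 = W.Δ
    linear_combination W.cubeRootΔ x₁ (X 2) ^ 2 * h1 - W.cubeRootΔ x₁ (X 2) * h2 + h3

theorem IsThreeRoots.cubeRootΔ_injective (hΔ : W.Δ ≠ 0) :
    Function.Injective fun k => W.cubeRootΔ x₁ (X k) := by
  obtain ⟨h1, h2, h3⟩ := h.cubeRootΔ_relations
  have key : ∀ a b c : F, a + b + c = 0 → a * b + a * c + b * c = 0 → a * b * c = W.Δ → a ≠ b := by
    rintro a b c h1 h2 h3 rfl
    have hc : c = -2 * a := by linear_combination h1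
    rw [hc] at h2 h3
    have ha : a ^ 2 = 0 := by linear_combination -h2 / 3
    exact hΔ (by rw [← h3]; linear_combination (-2 * a) * ha)
  refine ZMod.injective_three (key _ _ _ h1 h2 h3) ?_ ?_
  · exact key (W.cubeRootΔ x₁ (X 0)) (W.cubeRootΔ x₁ (X 2)) (W.cubeRootΔ x₁ (X 1))
      (by linear_combination h1) (by linear_combination h2) (by linear_combination h3)
  · exact key (W.cubeRootΔ x₁ (X 1)) (W.cubeRootΔ x₁ (X 2)) (W.cubeRootΔ x₁ (X 0))
      (by linear_combination h1) (by linear_combination h2) (by linear_combination h3)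

end ThreeRoots

section TwoRoots

variable {e : ZMod 3 → F} (h : W.IsTwoRoots e)
include h

theorem IsTwoRoots.coeff_eq : W.b₂ = -4 * (e 0 + e 1 + e 2) ∧
    W.b₄ = 2 * (e 0 * e 1 + e 0 * e 2 + e 1 * e 2) ∧ W.b₆ = -4 * (e 0 * e 1 * e 2) := by
  have h0 := h.2 0
  have h1 := h.2 1
  have h2 := h.2 (-1)
  simp only [psiTwoSq] at h0 h1 h2
  refine ⟨?_, ?_, ?_⟩
  · linear_combination (h1 + h2 - 2 * h0) / 2
  · linear_combination (h1 - h2) / 4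
  · linear_combination h0

theorem IsTwoRoots.psiTwoSq_eq_zero_iff {x : F} : W.psiTwoSq x = 0 ↔ ∃ k, x = e k := by
  rw [h.2, mul_eq_zero, mul_eq_zero, mul_eq_zero, sub_eq_zero, sub_eq_zero, sub_eq_zero]
  constructor
  · rintro (((h4 | h) | h) | h)
    · exact absurd h4 (by norm_num)
    · exact ⟨0, h⟩
    · exact ⟨1, h⟩
    · exact ⟨2, h⟩
  · rintro ⟨k, h⟩
    fin_cases k
    · exact Or.inl (Or.inl (Or.inr h))
    · exact Or.inl (Or.inr h)
    · exact Or.inr h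

end TwoRoots

theorem exists_isThreeRoots [IsAlgClosed F] (hΔ : W.Δ ≠ 0) {x₁ : F} (hx₁ : W.psiThree x₁ = 0) :
    ∃ X, W.IsThreeRoots x₁ X ∧ ∀ k, X k ≠ x₁ := by
  obtain ⟨X, h1, h2, h3⟩ := exists_vieta_psiThree hΔ hx₁
  exact ⟨X, ⟨h1, h3⟩, h2⟩

theorem isThreeRoots_of_injective [IsAlgClosed F] (hΔ : W.Δ ≠ 0) {x₁ : F} {X : ZMod 3 → F}
    (hX : Function.Injective X) (hx₁ : W.psiThree x₁ = 0) (hX₁ : ∀ k, X k ≠ x₁)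
    (h : ∀ k, W.psiThree (X k) = 0) : W.IsThreeRoots x₁ X := by
  obtain ⟨Y, hY, -⟩ := exists_isThreeRoots hΔ hx₁
  have hex : ∀ k, ∃ l, X k = Y l := fun k => (hY.psiThree_eq_zero_iff.1 (h k)).resolve_left (hX₁ k)
  choose f hf using hex
  have hfi : Function.Injective f := fun i j hij => hX (by rw [hf, hf, hij])
  let σ : ZMod 3 ≃ ZMod 3 := Equiv.ofBijective f (Finite.injective_iff_bijective.1 hfi)
  refine ⟨hX, fun x => ?_⟩
  have hprod := Equiv.prod_comp σ fun k => x - Y k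
  have h3 : ∀ g : ZMod 3 → F, ∏ k, g k = g 0 * g 1 * g 2 := Fin.prod_univ_three
  rw [h3, h3] at hprod
  rw [hY.2, ← hprod, hf 0, hf 1, hf 2]
  rfl

theorem isTwoRoots_of_injective [IsAlgClosed F] (hΔ : W.Δ ≠ 0) {e : ZMod 3 → F}
    (he : Function.Injective e) (h : ∀ k, W.psiTwoSq (e k) = 0) : W.IsTwoRoots e := by
  obtain ⟨Y, hYi, hY⟩ := exists_vieta_psiTwoSq hΔ
  have hY : W.IsTwoRoots Y := ⟨hYi, hY⟩
  have hex : ∀ k, ∃ l, e k = Y l := fun k => hY.psiTwoSq_eq_zero_iff.1 (h k)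
  choose f hf using hex
  have hfi : Function.Injective f := fun i j hij => he (by rw [hf, hf, hij])
  let σ : ZMod 3 ≃ ZMod 3 := Equiv.ofBijective f (Finite.injective_iff_bijective.1 hfi)
  refine ⟨he, fun x => ?_⟩
  have hprod := Equiv.prod_comp σ fun k => x - Y k
  have h3 : ∀ g : ZMod 3 → F, ∏ k, g k = g 0 * g 1 * g 2 := Fin.prod_univ_three
  rw [h3, h3] at hprod
  rw [hY.2, mul_assoc 4, mul_assoc 4, ← hprod, hf 0, hf 1, hf 2, ← mul_assoc, ← mul_assoc]
  rfl

end Field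

end WeierstrassCurve

/-! ### From the roots to `c₄`, `c₆` and the parameters `s`, `t`, `v`. -/

namespace WeierstrassCurve

section Field

variable {F : Type*} [Field F] [CharZero F] {W : WeierstrassCurve F}

/-- Trace, second symmetric function and norm of `A + P δ + Q δ²` for a root `δ` of `T³ - Δ`. -/
theorem c_relations_of_cubeRoot {A P Q Δ : F} {D e : ZMod 3 → F} (hsum : D 0 + D 1 + D 2 = 0)
    (hpair : D 0 * D 1 + D 0 * D 2 + D 1 * D 2 = 0) (hD : ∀ k, D k ^ 3 = Δ)
    (he : ∀ k, e k = A + P * D k + Q * D k ^ 2) :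
    e 0 + e 1 + e 2 = 3 * A ∧
    e 0 * e 1 + e 0 * e 2 + e 1 * e 2 = 3 * A ^ 2 - 3 * P * Q * Δ ∧
    e 0 * e 1 * e 2 = A ^ 3 - 3 * A * P * Q * Δ + P ^ 3 * Δ + Q ^ 3 * Δ ^ 2 := by
  have hsq : D 0 ^ 2 + D 1 ^ 2 + D 2 ^ 2 = 0 := by
    linear_combination (D 0 + D 1 + D 2) * hsum - 2 * hpair
  have h1 : e 0 + e 1 + e 2 = 3 * A := by
    rw [he, he, he]
    linear_combination P * hsum + Q * hsq
  have hy2 : ∀ k, (e k - A) ^ 2 = P ^ 2 * D k ^ 2 + 2 * P * Q * Δ + Q ^ 2 * Δ * D k := by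
    intro k
    rw [he]
    linear_combination (2 * P * Q + Q ^ 2 * D k) * hD k
  have hy3 : ∀ k, (e k - A) ^ 3 = P ^ 3 * Δ + Q ^ 3 * Δ ^ 2 + 3 * P ^ 2 * Q * Δ * D k +
      3 * P * Q ^ 2 * Δ * D k ^ 2 := by
    intro k
    rw [he]
    linear_combination (P ^ 3 + 3 * P ^ 2 * Q * D k + 3 * P * Q ^ 2 * D k ^ 2 +
      Q ^ 3 * (D k ^ 3 + Δ)) * hD k
  have hs2 := congrArg₂ (· + ·) (congrArg₂ (· + ·) (hy2 0) (hy2 1)) (hy2 2)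
  have hs3 := congrArg₂ (· + ·) (congrArg₂ (· + ·) (hy3 0) (hy3 1)) (hy3 2)
  have e2 : e 2 = 3 * A - e 0 - e 1 := by linear_combination h1
  rw [e2] at hs2 hs3 ⊢
  have hp : e 0 * e 1 + e 0 * (3 * A - e 0 - e 1) + e 1 * (3 * A - e 0 - e 1) =
      3 * A ^ 2 - 3 * P * Q * Δ := by
    linear_combination -hs2 / 2 - P ^ 2 / 2 * hsq - Q ^ 2 * Δ / 2 * hsum
  refine ⟨by ring, hp, ?_⟩
  linear_combination hs3 / 3 + P ^ 2 * Q * Δ * hsum + P * Q ^ 2 * Δ * hsq + A * hp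

theorem c₄_c₆_of_isTwoRoots {A P Q : F} {D e : ZMod 3 → F} (hsum : D 0 + D 1 + D 2 = 0)
    (hpair : D 0 * D 1 + D 0 * D 2 + D 1 * D 2 = 0) (hD : ∀ k, D k ^ 3 = W.Δ)
    (he : ∀ k, e k = A + P * D k + Q * D k ^ 2) (h : W.IsTwoRoots e) :
    W.c₄ = 144 * P * Q * W.Δ ∧ W.c₆ = 864 * (P ^ 3 * W.Δ + Q ^ 3 * W.Δ ^ 2) := by
  obtain ⟨h1, h2, h3⟩ := c_relations_of_cubeRoot hsum hpair hD he
  obtain ⟨k2, k4, k6⟩ := h.coeff_eq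
  rw [h1] at k2
  rw [h2] at k4
  rw [h3] at k6
  generalize W.Δ = Δ at *
  rw [c₄, c₆, k2, k4, k6]
  constructor <;> ring

/-- The symmetric functions match the coefficients. The roots are distinct because `e i = e j` would
force `P = Q D k` for the third index, that is `P³ = Q³ Δ`. -/
theorem isTwoRoots_of_c₄_c₆ {P Q : F} {D : ZMod 3 → F} (hinj : Function.Injective D)
    (hsum : D 0 + D 1 + D 2 = 0)
    (hpair : D 0 * D 1 + D 0 * D 2 + D 1 * D 2 = 0) (hD : ∀ k, D k ^ 3 = W.Δ)
    (hPQ : P ^ 3 ≠ Q ^ 3 * W.Δ)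
    (h4 : W.c₄ = 144 * P * Q * W.Δ) (h6 : W.c₆ = 864 * (P ^ 3 * W.Δ + Q ^ 3 * W.Δ ^ 2)) :
    W.IsTwoRoots fun k => -W.b₂ / 12 + P * D k + Q * D k ^ 2 := by
  obtain ⟨h1, h2, h3⟩ := c_relations_of_cubeRoot hsum hpair hD
    (fun k => (rfl : (fun k => -W.b₂ / 12 + P * D k + Q * D k ^ 2) k = _))
  set e := fun k => -W.b₂ / 12 + P * D k + Q * D k ^ 2 with he
  have key : ∀ i j k, D i ≠ D j → D i + D j + D k = 0 → e i ≠ e j := by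
    intro i j k hij hs heq
    simp only [he] at heq
    have h0 : (D i - D j) * (P + Q * (D i + D j)) = 0 := by linear_combination heq
    have h5 := (mul_eq_zero.1 h0).resolve_left (sub_ne_zero.2 hij)
    have h7 : P = Q * D k := by linear_combination h5 - Q * hs
    apply hPQ
    rw [h7, mul_pow, hD]
  refine ⟨ZMod.injective_three ?_ ?_ ?_, fun x => ?_⟩
  · exact key 0 1 2 (hinj.ne (by decide)) hsum
  · exact key 0 2 1 (hinj.ne (by decide)) (by linear_combination hsum)
  · exact key 1 2 0 (hinj.ne (by decide)) (by linear_combination hsum)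
  · have hb4 : W.b₄ = (W.b₂ ^ 2 - W.c₄) / 24 := by rw [c₄]; ring
    have hb6 : W.b₆ = (-W.b₂ ^ 3 + 36 * W.b₂ * W.b₄ - W.c₆) / 216 := by rw [c₆]; ring
    rw [psiTwoSq, hb6, hb4, h4, h6]
    linear_combination (4 * x ^ 2) * h1 - 4 * x * h2 + 4 * h3

end Field

section Rat

variable (E : WeierstrassCurve ℚ) [E.IsElliptic]

theorem j_eq_div : E.j = E.c₄ ^ 3 / E.Δ := by
  rw [j, Units.val_inv_eq_inv_val, coe_Δ', div_eq_inv_mul]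

variable {E}

theorem exists_s_of_c₄_c₆ {P Q : ℚ} (h4 : E.c₄ = 144 * P * Q * E.Δ)
    (h6 : E.c₆ = 864 * (P ^ 3 * E.Δ + Q ^ 3 * E.Δ ^ 2)) :
    ∃ s : ℚ, E.j = 2 ^ 10 * 3 ^ 3 * s ^ 3 * (1 - 4 * s ^ 3) := by
  have hΔ : E.Δ ≠ 0 := E.isUnit_Δ.ne_zero
  have hrel := E.c_relation
  have hj := E.j_eq_div
  rw [h4, h6] at hrel
  rw [h4] at hj
  generalize E.Δ = Δ at *
  -- Substitution in `1728 Δ = c₄³ - c₆²`, using `144³ = 4 · 864²`.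
  have h1 : -432 * Δ * (P ^ 3 - Q ^ 3 * Δ) ^ 2 = 1 := by
    apply mul_left_cancel₀ (mul_ne_zero (by norm_num : (1728 : ℚ) ≠ 0) hΔ)
    linear_combination -hrel
  have h0 : P ^ 3 - Q ^ 3 * Δ ≠ 0 := by
    intro h0
    rw [h0] at h1
    norm_num at h1
  refine ⟨Q / (12 * (P ^ 3 - Q ^ 3 * Δ)), ?_⟩
  rw [hj]
  set R := P ^ 3 - Q ^ 3 * Δ with hR
  have hP : P ^ 3 = R + Q ^ 3 * Δ := by rw [hR]; ring
  have hR2 : Δ = -1 / (432 * R ^ 2) := by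
    rw [eq_div_iff (mul_ne_zero (by norm_num) (pow_ne_zero 2 h0))]
    linear_combination -h1
  have e1 : (144 * P * Q * Δ) ^ 3 = 144 ^ 3 * (R + Q ^ 3 * Δ) * Q ^ 3 * Δ ^ 3 := by
    rw [← hP]; ring
  rw [e1]
  clear_value R
  rw [hR2]
  field_simp
  ring

theorem exists_t_of_psiThree (hc₄ : E.c₄ ≠ 0) {x : ℚ} (hx : E.psiThree x = 0) :
    ∃ t : ℚ, t ≠ 0 ∧ E.j = 27 * (t + 1) * (t + 9) ^ 3 / t ^ 3 := by
  have hΔ : E.Δ ≠ 0 := E.isUnit_Δ.ne_zero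
  have hj := E.j_eq_div
  have hb := E.b_relation
  -- These are `b₂`, `b₄`, `b₆` after moving the root `x` to the origin. There `b₈ = 0`, so `u z =
  -- w²`.
  set u := E.b₂ + 12 * x with hu
  set w := E.b₄ + x * E.b₂ + 6 * x ^ 2 with hw
  set z := E.b₆ + 2 * x * E.b₄ + x ^ 2 * E.b₂ + 4 * x ^ 3 with hz
  have h4 : E.c₄ = u ^ 2 - 24 * w := by rw [c₄, hu, hw]; ring
  have hrel : u * z = w ^ 2 := by
    rw [psiThree] at hx
    linear_combination 4 * hx - hb
  have hΔ' : E.Δ = w ^ 3 - 27 * z ^ 2 := by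
    rw [psiThree] at hx
    have h8 : E.b₈ = -(3 * x ^ 4 + E.b₂ * x ^ 3 + 3 * E.b₄ * x ^ 2 + 3 * E.b₆ * x) := by
      linear_combination hx
    rw [WeierstrassCurve.Δ, h8]
    linear_combination (9 * w - 6 * E.b₂ * x - 36 * x ^ 2) * hrel
  clear_value u w z
  rw [h4] at hc₄ hj
  rw [hΔ'] at hΔ hj
  have hu0 : u ≠ 0 := by
    rintro rfl
    have hw0 : w = 0 := by
      rw [zero_mul] at hrel
      exact pow_eq_zero_iff two_ne_zero |>.1 hrel.symm
    rw [hw0] at hc₄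
    norm_num at hc₄
  have hz' : z = w ^ 2 / u := by rw [eq_div_iff hu0]; linear_combination hrel
  have hD : w ^ 3 - 27 * z ^ 2 = w ^ 3 * (u ^ 2 - 27 * w) / u ^ 2 := by
    rw [hz']
    field_simp
  rw [hD] at hΔ hj
  have hw0 : w ≠ 0 := by
    rintro rfl
    norm_num at hΔ
  have hv : u ^ 2 - 27 * w ≠ 0 := by
    intro h0
    rw [h0] at hΔ
    norm_num at hΔ
  refine ⟨27 * w / (u ^ 2 - 27 * w), div_ne_zero (mul_ne_zero (by norm_num) hw0) hv, ?_⟩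
  rw [hj]
  have e1 : 27 * w / (u ^ 2 - 27 * w) + 1 = u ^ 2 / (u ^ 2 - 27 * w) := by
    field_simp
    ring
  have e2 : 27 * w / (u ^ 2 - 27 * w) + 9 = 9 * (u ^ 2 - 24 * w) / (u ^ 2 - 27 * w) := by
    field_simp
    ring
  rw [e1, e2]
  field_simp
  ring

/-- In the notation `ξ = b₂ + 12x`, the parameter `t` gives `ξ²(t + 9) = 9(t + 1) c₄`. This fixes
`ξ` up to sign, and `c₆` selects the sign. -/
theorem exists_psiThree_of_t (hc₄ : E.c₄ ≠ 0) (hc₆ : E.c₆ ≠ 0) {t : ℚ} (ht : t ≠ 0)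
    (hj : E.j = 27 * (t + 1) * (t + 9) ^ 3 / t ^ 3) : ∃ x : ℚ, E.psiThree x = 0 := by
  have hΔ : E.Δ ≠ 0 := E.isUnit_Δ.ne_zero
  have hrel := E.c_relation
  rw [j_eq_div, div_eq_div_iff hΔ (pow_ne_zero 3 ht)] at hj
  have h1 : t + 1 ≠ 0 := by
    intro h0
    rw [h0, mul_zero, zero_mul, zero_mul, mul_eq_zero] at hj
    exact hj.elim (pow_ne_zero 3 hc₄) (pow_ne_zero 3 ht)
  have h9 : t + 9 ≠ 0 := by
    intro h0
    rw [h0, zero_pow three_ne_zero, mul_zero, zero_mul, mul_eq_zero] at hj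
    exact hj.elim (pow_ne_zero 3 hc₄) (pow_ne_zero 3 ht)
  set q := t ^ 2 - 18 * t - 27 with hq
  have h6 : E.c₆ ^ 2 * t ^ 3 = 27 * q ^ 2 * E.Δ := by
    rw [hq]
    linear_combination hj + t ^ 3 * hrel
  have hq0 : q ≠ 0 := by
    intro h0
    rw [h0] at h6
    have : E.c₆ ^ 2 * t ^ 3 ≠ 0 := mul_ne_zero (pow_ne_zero 2 hc₆) (pow_ne_zero 3 ht)
    exact this (by rw [h6]; ring)
  -- the value of `b₂ + 12 x`
  set ξ := 3 * E.c₆ * (t + 9) * (t + 1) / (E.c₄ * q) with hξ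
  have k4 : ξ ^ 2 * (t + 9) = 9 * (t + 1) * E.c₄ := by
    rw [hξ]
    field_simp
    have hj' : E.c₄ ^ 3 * q ^ 2 = E.c₆ ^ 2 * (t + 1) * (t + 9) ^ 3 := by
      apply mul_right_cancel₀ (mul_ne_zero (pow_ne_zero 3 ht) hΔ)
      linear_combination E.Δ * q ^ 2 * hj - E.Δ * (t + 1) * (t + 9) ^ 3 * h6
    linear_combination -9 * hj'
  have k6 : 3 * E.c₆ * (t + 9) * (t + 1) = ξ * (E.c₄ * q) := by
    rw [hξ]
    field_simp
  refine ⟨(ξ - E.b₂) / 12, ?_⟩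
  have hb := E.b_relation
  have h4 : E.b₄ = (E.b₂ ^ 2 - E.c₄) / 24 := by rw [c₄]; ring
  have h6' : E.b₆ = (-E.b₂ ^ 3 + 36 * E.b₂ * E.b₄ - E.c₆) / 216 := by rw [c₆]; ring
  have hpsi : E.psiThree ((ξ - E.b₂) / 12) =
      (ξ ^ 4 - 6 * E.c₄ * ξ ^ 2 - 8 * E.c₆ * ξ - 3 * E.c₄ ^ 2) / 6912 := by
    have h8 : E.b₈ = (E.b₂ * E.b₆ - E.b₄ ^ 2) / 4 := by linear_combination hb / 4
    rw [psiThree, h8, h6', h4]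
    ring
  rw [hpsi, div_eq_zero_iff]
  left
  have a : ξ ^ 2 = 9 * (t + 1) * E.c₄ / (t + 9) := by rw [eq_div_iff h9, k4]
  have b : E.c₆ * ξ = 3 * E.c₄ ^ 2 * q / (t + 9) ^ 2 := by
    rw [eq_div_iff (pow_ne_zero 2 h9)]
    apply mul_left_cancel₀ (mul_ne_zero three_ne_zero h1)
    linear_combination (t + 9) * ξ * k6 + E.c₄ * q * k4
  have e : ξ ^ 4 - 6 * E.c₄ * ξ ^ 2 - 8 * E.c₆ * ξ - 3 * E.c₄ ^ 2 =
      (ξ ^ 2) ^ 2 - 6 * E.c₄ * ξ ^ 2 - 8 * (E.c₆ * ξ) - 3 * E.c₄ ^ 2 := by ring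
  rw [e, a, b, hq]
  field_simp
  ring

theorem exists_c₄_c₆_of_s (hc₄ : E.c₄ ≠ 0) (hc₆ : E.c₆ ≠ 0) {s : ℚ}
    (hj : E.j = 2 ^ 10 * 3 ^ 3 * s ^ 3 * (1 - 4 * s ^ 3)) :
    ∃ P Q : ℚ, P ^ 3 ≠ Q ^ 3 * E.Δ ∧ E.c₄ = 144 * P * Q * E.Δ ∧
      E.c₆ = 864 * (P ^ 3 * E.Δ + Q ^ 3 * E.Δ ^ 2) := by
  have hΔ : E.Δ ≠ 0 := E.isUnit_Δ.ne_zero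
  have hrel := E.c_relation
  rw [j_eq_div, div_eq_iff hΔ] at hj
  generalize E.Δ = Δ at *
  generalize E.c₄ = c₄ at *
  generalize E.c₆ = c₆ at *
  have hs : s ≠ 0 := by
    rintro rfl
    norm_num at hj
    exact hc₄ hj
  have h6 : c₆ ^ 2 = -1728 * Δ * (1 - 8 * s ^ 3) ^ 2 := by linear_combination hj + hrel
  have h8 : 1 - 8 * s ^ 3 ≠ 0 := by
    intro h0
    rw [h0] at h6
    norm_num at h6
    exact hc₆ h6
  -- From `j - 1728 = -1728 (1 - 8s³)²`, the number `-432 Δ` is a square with root `h`. In the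
  -- converse direction `h` is `1 / (P³ - Q³ Δ)` and `Q = 12 s / h`.
  set h := 864 * Δ * (1 - 8 * s ^ 3) / c₆ with hh
  have h0 : h ≠ 0 := div_ne_zero (mul_ne_zero (mul_ne_zero (by norm_num) hΔ) h8) hc₆
  have hc : c₆ * h = 864 * Δ * (1 - 8 * s ^ 3) := by rw [hh]; field_simp
  have h2 : h ^ 2 = -432 * Δ := by
    apply mul_left_cancel₀ (pow_ne_zero 2 hc₆)
    linear_combination (c₆ * h + 864 * Δ * (1 - 8 * s ^ 3)) * hc + 432 * Δ * h6
  have hΔh : Δ = -h ^ 2 / 432 := by linear_combination h2 / 432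
  have hP : (c₄ / (144 * (12 * s / h) * Δ)) ^ 3 * h = 1 - 4 * s ^ 3 := by
    have : (c₄ / (144 * (12 * s / h) * Δ)) ^ 3 * h = c₄ ^ 3 * h ^ 4 / (144 ^ 3 * 12 ^ 3 * s ^ 3 * Δ ^ 3) := by
      field_simp
    rw [this, hj, show h ^ 4 = (h ^ 2) ^ 2 by ring, h2]
    field_simp
    ring
  have hQ : (12 * s / h) ^ 3 * Δ * h = -4 * s ^ 3 := by
    rw [hΔh]
    field_simp
    ring
  refine ⟨c₄ / (144 * (12 * s / h) * Δ), 12 * s / h, ?_, ?_, ?_⟩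
  · intro heq
    have h1 : (1 : ℚ) = 0 := by linear_combination h * heq - hP + hQ
    exact one_ne_zero h1
  · have : 12 * s / h ≠ 0 := div_ne_zero (mul_ne_zero (by norm_num) hs) h0
    field_simp
  · apply mul_right_cancel₀ h0
    linear_combination hc - 864 * Δ * hP - 864 * Δ * hQ

end Rat
end WeierstrassCurve

theorem levelSix_s_t_of_v {v : ℚ} (hv : v ^ 3 + 1 ≠ 0) :
    ∃ s t : ℚ, t ≠ 0 ∧
      27 * v ^ 3 * (v ^ 3 + 2) * (2 - v ^ 3) ^ 3 * (v ^ 3 + 4) ^ 3 / (v ^ 3 + 1) ^ 6 =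
        2 ^ 10 * 3 ^ 3 * s ^ 3 * (1 - 4 * s ^ 3) ∧
      27 * v ^ 3 * (v ^ 3 + 2) * (2 - v ^ 3) ^ 3 * (v ^ 3 + 4) ^ 3 / (v ^ 3 + 1) ^ 6 =
        27 * (t + 1) * (t + 9) ^ 3 / t ^ 3 := by
  refine ⟨v * (v ^ 3 + 4) / (4 * (v ^ 3 + 1)), -(v ^ 3 + 1) ^ 2, neg_ne_zero.2 (pow_ne_zero 2 hv), ?_, ?_⟩
  · field_simp
    ring
  · field_simp
    ring

/-- Comparing the two formulas for `j - 1728` shows that `-t` is the square of an explicit `r`. Then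
`r - 1` is the cube of `4sr/(r + 3)`. The values `j = 0` and `j = 1728` are excluded because there
`s = 0` or `1 - 8s³ = 0` can occur. -/
theorem levelSix_v_of_s_t {j s t : ℚ} (hj0 : j ≠ 0) (hj1 : j ≠ 1728) (ht : t ≠ 0)
    (hs : j = 2 ^ 10 * 3 ^ 3 * s ^ 3 * (1 - 4 * s ^ 3))
    (htj : j = 27 * (t + 1) * (t + 9) ^ 3 / t ^ 3) :
    ∃ v : ℚ, v ^ 3 + 1 ≠ 0 ∧
      j = 27 * v ^ 3 * (v ^ 3 + 2) * (2 - v ^ 3) ^ 3 * (v ^ 3 + 4) ^ 3 / (v ^ 3 + 1) ^ 6 := by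
  have h8 : 1 - 8 * s ^ 3 ≠ 0 := by
    intro h0
    apply hj1
    rw [hs, show s ^ 3 = 1 / 8 by linear_combination -h0 / 8]
    norm_num
  have hs0 : s ≠ 0 := by
    rintro rfl
    exact hj0 (by rw [hs]; norm_num)
  have hq : (t ^ 2 - 18 * t - 27) ^ 2 = -64 * t ^ 3 * (1 - 8 * s ^ 3) ^ 2 := by
    rw [eq_div_iff (pow_ne_zero 3 ht), hs] at htj
    linear_combination -htj / 27
  set r := (t ^ 2 - 18 * t - 27) / (8 * t * (1 - 8 * s ^ 3)) with hr
  have hr2 : t = -r ^ 2 := by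
    rw [hr, div_pow, hq]
    field_simp
    norm_num
  have hr1 : r * (8 * t * (1 - 8 * s ^ 3)) = t ^ 2 - 18 * t - 27 := by
    rw [hr]
    field_simp
  have hr0 : r ≠ 0 := by
    intro h0
    rw [h0] at hr2
    exact ht (by rw [hr2]; norm_num)
  have hs3 : 64 * s ^ 3 * r ^ 3 = (r - 1) * (r + 3) ^ 3 := by
    rw [hr2] at hr1
    linear_combination hr1
  have hr3 : r + 3 ≠ 0 := by
    intro h0
    rw [h0, zero_pow three_ne_zero, mul_zero] at hs3
    exact mul_ne_zero (mul_ne_zero (by norm_num) (pow_ne_zero 3 hs0)) (pow_ne_zero 3 hr0) hs3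
  have hv : (4 * s * r / (r + 3)) ^ 3 = r - 1 := by
    rw [div_pow, div_eq_iff (pow_ne_zero 3 hr3)]
    linear_combination hs3
  refine ⟨4 * s * r / (r + 3), ?_, ?_⟩
  · rw [hv, sub_add_cancel]
    exact hr0
  · rw [hv, htj, hr2]
    rw [show r - 1 + 1 = r by ring]
    field_simp
    ring

/-! ### Galois descent: the condition on roots in terms of `s` and `t`. -/

namespace WeierstrassCurve

section BaseChange

variable (E : WeierstrassCurve ℚ)

theorem b₂_Qbar : (E⁄Qbar).b₂ = algebraMap ℚ Qbar E.b₂ := E.map_b₂ _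
theorem b₄_Qbar : (E⁄Qbar).b₄ = algebraMap ℚ Qbar E.b₄ := E.map_b₄ _
theorem b₆_Qbar : (E⁄Qbar).b₆ = algebraMap ℚ Qbar E.b₆ := E.map_b₆ _
theorem b₈_Qbar : (E⁄Qbar).b₈ = algebraMap ℚ Qbar E.b₈ := E.map_b₈ _
theorem c₄_Qbar : (E⁄Qbar).c₄ = algebraMap ℚ Qbar E.c₄ := E.map_c₄ _
theorem c₆_Qbar : (E⁄Qbar).c₆ = algebraMap ℚ Qbar E.c₆ := E.map_c₆ _
theorem Δ_Qbar : (E⁄Qbar).Δ = algebraMap ℚ Qbar E.Δ := E.map_Δ _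

theorem Δ_Qbar_ne_zero [E.IsElliptic] : (E⁄Qbar).Δ ≠ 0 := (E⁄Qbar).isUnit_Δ.ne_zero

theorem psiThree_algebraMap (x : ℚ) :
    (E⁄Qbar).psiThree (algebraMap ℚ Qbar x) = algebraMap ℚ Qbar (E.psiThree x) := by
  simp only [psiThree, b₂_Qbar, b₄_Qbar, b₆_Qbar, b₈_Qbar, map_add, map_mul, map_pow, map_ofNat]

theorem map_psiThree (σ : GQ) (x : Qbar) : σ ((E⁄Qbar).psiThree x) = (E⁄Qbar).psiThree (σ x) := by
  simp only [psiThree, b₂_Qbar, b₄_Qbar, b₆_Qbar, b₈_Qbar, map_add, map_mul, map_pow, map_ofNat,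
    AlgEquiv.commutes]

theorem map_cubeRootΔ (σ : GQ) (x₁ : ℚ) (x : Qbar) :
    σ ((E⁄Qbar).cubeRootΔ (algebraMap ℚ Qbar x₁) x) =
      (E⁄Qbar).cubeRootΔ (algebraMap ℚ Qbar x₁) (σ x) := by
  simp only [cubeRootΔ, b₂_Qbar, b₄_Qbar, map_add, map_sub, map_neg, map_mul, map_ofNat,
    AlgEquiv.commutes]

end BaseChange

theorem exists_algebraMap_eq_of_fixed {x : Qbar} (h : ∀ σ : GQ, σ x = x) :
    ∃ q : ℚ, algebraMap ℚ Qbar q = x :=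
  (InfiniteGalois.mem_range_algebraMap_iff_fixed x).2 h

/-- The 3-division polynomial has a rational root, and the Galois actions on its other roots and on
the roots of the 2-division polynomial agree. -/
def IsLevelSix (E : WeierstrassCurve ℚ) : Prop :=
  ∃ (x₁ : ℚ) (X e : ZMod 3 → Qbar), (E⁄Qbar).IsThreeRoots (algebraMap ℚ Qbar x₁) X ∧
    (∀ k, X k ≠ algebraMap ℚ Qbar x₁) ∧ (E⁄Qbar).IsTwoRoots e ∧
    ∀ (σ : GQ) (k l : ZMod 3), σ (X k) = X l → σ (e k) = e l

variable {E : WeierstrassCurve ℚ}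

section Perm

variable {x₁ : ℚ} {X : ZMod 3 → Qbar} (hX : (E⁄Qbar).IsThreeRoots (algebraMap ℚ Qbar x₁) X)
  (hX₁ : ∀ k, X k ≠ algebraMap ℚ Qbar x₁)
include hX

theorem IsThreeRoots.psiThree_root : E.psiThree x₁ = 0 := by
  have h : (E⁄Qbar).psiThree (algebraMap ℚ Qbar x₁) = 0 := hX.psiThree_eq_zero_iff.2 (Or.inl rfl)
  rw [psiThree_algebraMap] at h
  exact (map_eq_zero _).1 h

include hX₁ in
theorem IsThreeRoots.exists_perm (σ : GQ) : ∃ π : ZMod 3 ≃ ZMod 3, ∀ k, σ (X k) = X (π k) := by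
  have hex : ∀ k, ∃ l, σ (X k) = X l := by
    intro k
    have h0 : (E⁄Qbar).psiThree (σ (X k)) = 0 := by
      rw [← map_psiThree, hX.psiThree_eq_zero_iff.2 (Or.inr ⟨k, rfl⟩), map_zero]
    refine (hX.psiThree_eq_zero_iff.1 h0).resolve_left fun h1 => hX₁ k ?_
    rw [← AlgEquiv.commutes σ] at h1
    exact σ.injective h1
  choose f hf using hex
  have hfi : Function.Injective f := fun i j hij =>
    hX.1 (σ.injective (by rw [hf, hf, hij]))
  exact ⟨Equiv.ofBijective f (Finite.injective_iff_bijective.1 hfi), hf⟩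

end Perm

variable [E.IsElliptic]

/-- Since `e k` and `D k` are permuted in the same way, the coefficients that interpolate `e k` by
`1, D k, (D k)²` are Galois invariant sums, hence rational. -/
theorem IsLevelSix.exists_s_t (h : IsLevelSix E) (hc₄ : E.c₄ ≠ 0) :
    ∃ s t : ℚ, t ≠ 0 ∧ E.j = 2 ^ 10 * 3 ^ 3 * s ^ 3 * (1 - 4 * s ^ 3) ∧
      E.j = 27 * (t + 1) * (t + 9) ^ 3 / t ^ 3 := by
  obtain ⟨x₁, X, e, hX, hX₁, he, hσ⟩ := h
  obtain ⟨t, ht, hjt⟩ := exists_t_of_psiThree hc₄ hX.psiThree_root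
  suffices hs : ∃ s : ℚ, E.j = 2 ^ 10 * 3 ^ 3 * s ^ 3 * (1 - 4 * s ^ 3) by
    obtain ⟨s, hs⟩ := hs
    exact ⟨s, t, ht, hs, hjt⟩
  set D : ZMod 3 → Qbar := fun k => (E⁄Qbar).cubeRootΔ (algebraMap ℚ Qbar x₁) (X k) with hD
  have hΔ := E.Δ_Qbar_ne_zero
  obtain ⟨r1, r2, r3⟩ := hX.cubeRootΔ_relations
  have hD3 : ∀ k, D k ^ 3 = (E⁄Qbar).Δ := hX.cubeRootΔ_pow_three
  change D 0 + D 1 + D 2 = 0 at r1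
  change D 0 * D 1 + D 0 * D 2 + D 1 * D 2 = 0 at r2
  change D 0 * D 1 * D 2 = (E⁄Qbar).Δ at r3
  have hfix : ∀ g : ZMod 3 → Qbar, (∀ (σ : GQ) k l, σ (X k) = X l → σ (g k) = g l) →
      ∃ q : ℚ, algebraMap ℚ Qbar q = ∑ k, g k := by
    intro g hg
    refine exists_algebraMap_eq_of_fixed fun σ => ?_
    obtain ⟨π, hπ⟩ := hX.exists_perm hX₁ σ
    rw [map_sum, ← Equiv.sum_comp π g]
    exact Finset.sum_congr rfl fun k _ => hg σ k _ (hπ k)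
  have hDσ : ∀ (σ : GQ) k l, σ (X k) = X l → σ (D k) = D l := by
    intro σ k l hkl
    simp only [hD, map_cubeRootΔ, hkl]
  obtain ⟨A, hA⟩ := hfix (fun k => e k / 3) fun σ k l hkl => by
    rw [map_div₀, hσ σ k l hkl, map_ofNat]
  obtain ⟨P, hP⟩ := hfix (fun k => e k * D k ^ 2 / (3 * (E⁄Qbar).Δ)) fun σ k l hkl => by
    rw [map_div₀, map_mul, map_pow, hσ σ k l hkl, hDσ σ k l hkl, map_mul, map_ofNat, Δ_Qbar,
      AlgEquiv.commutes]
  obtain ⟨Q, hQ⟩ := hfix (fun k => e k * D k / (3 * (E⁄Qbar).Δ)) fun σ k l hkl => by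
    rw [map_div₀, map_mul, hσ σ k l hkl, hDσ σ k l hkl, map_mul, map_ofNat, Δ_Qbar,
      AlgEquiv.commutes]
  have heq : ∀ k, e k = algebraMap ℚ Qbar A + algebraMap ℚ Qbar P * D k +
      algebraMap ℚ Qbar Q * D k ^ 2 := by
    intro k
    have hcalc : algebraMap ℚ Qbar A + algebraMap ℚ Qbar P * D k + algebraMap ℚ Qbar Q * D k ^ 2 =
        ∑ l, e l * ((E⁄Qbar).Δ + D l ^ 2 * D k + D l * D k ^ 2) / (3 * (E⁄Qbar).Δ) := by
      rw [hA, hP, hQ, Finset.sum_mul, Finset.sum_mul, ← Finset.sum_add_distrib,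
        ← Finset.sum_add_distrib]
      refine Finset.sum_congr rfl fun l _ => ?_
      field_simp
    -- With `a + b + c = 0` and `abc = Δ` one has `Δ + a²b + ab² = ab(a + b + c)`; this is
    -- orthogonality of the cube roots.
    have hl : ∀ l, l ≠ k → (E⁄Qbar).Δ + D l ^ 2 * D k + D l * D k ^ 2 = 0 := by
      have key : ∀ a b c : Qbar, a + b + c = 0 → a * b * c = (E⁄Qbar).Δ →
          (E⁄Qbar).Δ + a ^ 2 * b + a * b ^ 2 = 0 := by
        intro a b c h1 h2
        linear_combination a * b * h1 - h2
      intro l hlk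
      fin_cases l <;> fin_cases k
      · exact absurd rfl hlk
      · exact key (D 0) (D 1) (D 2) r1 r3
      · exact key (D 0) (D 2) (D 1) (by linear_combination r1) (by linear_combination r3)
      · exact key (D 1) (D 0) (D 2) (by linear_combination r1) (by linear_combination r3)
      · exact absurd rfl hlk
      · exact key (D 1) (D 2) (D 0) (by linear_combination r1) (by linear_combination r3)
      · exact key (D 2) (D 0) (D 1) (by linear_combination r1) (by linear_combination r3)
      · exact key (D 2) (D 1) (D 0) (by linear_combination r1) (by linear_combination r3)
      · exact absurd rfl hlk
    rw [hcalc, Finset.sum_eq_single k (fun l _ hlk => by rw [hl l hlk, mul_zero, zero_div])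
      (fun h => absurd (Finset.mem_univ k) h)]
    field_simp
    linear_combination -2 * e k * hD3 k
  obtain ⟨h4, h6⟩ := c₄_c₆_of_isTwoRoots r1 r2 hD3 heq he
  rw [c₄_Qbar, Δ_Qbar] at h4
  rw [c₆_Qbar, Δ_Qbar] at h6
  refine exists_s_of_c₄_c₆ (P := P) (Q := Q) ?_ ?_
  · apply (algebraMap ℚ Qbar).injective
    rw [h4]
    simp only [map_mul, map_ofNat]
  · apply (algebraMap ℚ Qbar).injective
    rw [h6]
    simp only [map_mul, map_ofNat, map_add, map_pow]

theorem isLevelSix_of_s_t (hc₄ : E.c₄ ≠ 0) (hc₆ : E.c₆ ≠ 0) {s t : ℚ} (ht : t ≠ 0)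
    (hs : E.j = 2 ^ 10 * 3 ^ 3 * s ^ 3 * (1 - 4 * s ^ 3))
    (htj : E.j = 27 * (t + 1) * (t + 9) ^ 3 / t ^ 3) : IsLevelSix E := by
  obtain ⟨x₁, hx₁⟩ := exists_psiThree_of_t hc₄ hc₆ ht htj
  obtain ⟨P, Q, hPQ, h4, h6⟩ := exists_c₄_c₆_of_s hc₄ hc₆ hs
  have hΔ := E.Δ_Qbar_ne_zero
  obtain ⟨X, hX, hX₁⟩ := exists_isThreeRoots hΔ (x₁ := algebraMap ℚ Qbar x₁)
    (by rw [psiThree_algebraMap, hx₁, map_zero])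
  obtain ⟨r1, r2, r3⟩ := hX.cubeRootΔ_relations
  refine ⟨x₁, X, _, hX, hX₁, isTwoRoots_of_c₄_c₆ (P := algebraMap ℚ Qbar P) (Q := algebraMap ℚ Qbar Q)
    (hX.cubeRootΔ_injective hΔ) r1 r2 hX.cubeRootΔ_pow_three ?_ ?_ ?_, ?_⟩
  · rw [Δ_Qbar, ← map_pow, ← map_pow, ← map_mul]
    exact (algebraMap ℚ Qbar).injective.ne hPQ
  · rw [c₄_Qbar, Δ_Qbar, h4]
    simp only [map_mul, map_ofNat]
  · rw [c₆_Qbar, Δ_Qbar, h6]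
    simp only [map_mul, map_ofNat, map_add, map_pow]
  · intro σ k l hkl
    simp only [b₂_Qbar, map_add, map_div₀, map_neg, map_mul, map_pow, map_ofNat, AlgEquiv.commutes,
      map_cubeRootΔ, hkl]

end WeierstrassCurve

/-! ### Homomorphisms from the Borel subgroup -/

theorem ZMod.matrix_two_mulVec_ne (t : Matrix (Fin 2) (Fin 2) (ZMod 2)) (ht : t * t * t = 1)
    (h1 : t ≠ 1) (v : Fin 2 → ZMod 2) (hv : v ≠ 0) : t.mulVec v ≠ v := by
  revert t v
  decide

theorem ZMod.matrix_two_exists_mulVec_eq (s : Matrix (Fin 2) (Fin 2) (ZMod 2)) (hs : s * s = 1) :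
    ∃ v : Fin 2 → ZMod 2, v ≠ 0 ∧ s.mulVec v = v := by
  revert s
  decide

theorem ZMod.matrix_two_eq_one_of_commute (n : Matrix (Fin 2) (Fin 2) (ZMod 2))
    (h1 : n * !![1, 1; 0, 1] = !![1, 1; 0, 1] * n) (h2 : n * !![1, 0; 1, 1] = !![1, 0; 1, 1] * n)
    (h0 : n ≠ 0) : n = 1 := by
  revert n
  decide

theorem ZMod.three_mul_self_eq_one {a : ZMod 3} (ha : a ≠ 0) : a * a = 1 := by
  revert a
  decide

theorem borel3_apply (g : borel3) : g.1 1 0 = 0 := g.2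

theorem borel3_diag_ne_zero (g : borel3) : g.1 0 0 ≠ 0 ∧ g.1 1 1 ≠ 0 := by
  have h := (Matrix.isUnit_iff_isUnit_det _).1 g.1.isUnit
  rw [Matrix.det_fin_two, borel3_apply, mul_zero, sub_zero] at h
  exact ⟨left_ne_zero_of_mul h.ne_zero, right_ne_zero_of_mul h.ne_zero⟩

/-- The element `(a b; 0 d)` of the Borel subgroup. -/
def borel3Mk (a b d : ZMod 3) (ha : a ≠ 0) (hd : d ≠ 0) : borel3 :=
  ⟨⟨!![a, b; 0, d], !![a, -(a * b * d); 0, d], by revert a b d; decide,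
    by revert a b d; decide⟩, rfl⟩

theorem borel3Mk_apply (a b d : ZMod 3) (ha : a ≠ 0) (hd : d ≠ 0) :
    (borel3Mk a b d ha hd).1.1 = !![a, b; 0, d] := rfl

theorem borel3_ext {g h : borel3} (h₀ : g.1 0 0 = h.1 0 0) (h₁ : g.1 0 1 = h.1 0 1)
    (h₂ : g.1 1 1 = h.1 1 1) : g = h := by
  apply Subtype.ext
  apply Units.ext
  ext i j
  fin_cases i <;> fin_cases j
  · exact h₀
  · exact h₁
  · exact (borel3_apply g).trans (borel3_apply h).symm
  · exact h₂

theorem borel3_mul_apply (g h : borel3) : (g * h).1 0 0 = g.1 0 0 * h.1 0 0 ∧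
    (g * h).1 0 1 = g.1 0 0 * h.1 0 1 + g.1 0 1 * h.1 1 1 ∧
    (g * h).1 1 1 = g.1 1 1 * h.1 1 1 := by
  have hh := borel3_apply h
  have hg := borel3_apply g
  refine ⟨?_, ?_, ?_⟩ <;> simp [Matrix.mul_apply, Fin.sum_univ_two, hg, hh]

/-- The action of upper triangular matrices on `𝔽₃` by affine maps. -/
def borelAct (g : GL (Fin 2) (ZMod 3)) (k : ZMod 3) : ZMod 3 := (g 0 0 * k + g 0 1) * g 1 1

theorem borelAct_mul (g h : borel3) (k : ZMod 3) :
    borelAct (g * h).1 k = borelAct g.1 (borelAct h.1 k) := by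
  obtain ⟨e0, e1, e2⟩ := borel3_mul_apply g h
  have hd := ZMod.three_mul_self_eq_one (borel3_diag_ne_zero h).2
  simp only [borelAct]
  rw [e0, e1, e2]
  have hd' : ((h.1 1 1 : ZMod 3)) * h.1 1 1 = 1 := hd
  linear_combination (g.1 0 1 * g.1 1 1) * hd'

theorem borelAct_one (k : ZMod 3) : borelAct 1 k = k := by simp [borelAct]

-- The kernel of the action of `B(3)` on the three lines is `{±1}`.
set_option synthInstance.maxHeartbeats 200000 in
set_option synthInstance.maxSize 1000 in
theorem borelAct_eq_iff {g h : borel3} : (∀ k, borelAct g.1 k = borelAct h.1 k) ↔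
    g = h ∨ ∀ i j, g.1 i j = - h.1 i j := by
  have key : ∀ a b d a' b' d' : ZMod 3, a ≠ 0 → d ≠ 0 → a' ≠ 0 → d' ≠ 0 →
      ((∀ k, (a * k + b) * d = (a' * k + b') * d') ↔
        (a = a' ∧ b = b' ∧ d = d') ∨ (a = -a' ∧ b = -b' ∧ d = -d')) := by decide
  have h' := key (g.1 0 0) (g.1 0 1) (g.1 1 1) (h.1 0 0) (h.1 0 1) (h.1 1 1)
    (borel3_diag_ne_zero g).1 (borel3_diag_ne_zero g).2 (borel3_diag_ne_zero h).1
    (borel3_diag_ne_zero h).2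
  simp only [borelAct]
  rw [h']
  constructor
  · rintro (⟨h0, h1, h2⟩ | ⟨h0, h1, h2⟩)
    · exact Or.inl (borel3_ext h0 h1 h2)
    · right
      simp only [Fin.forall_fin_two]
      refine ⟨⟨h0, h1⟩, ?_, h2⟩
      rw [borel3_apply, borel3_apply, neg_zero]
  · rintro (rfl | h0)
    · simp
    · exact Or.inr ⟨h0 0 0, h0 0 1, h0 1 1⟩

/-- The three nonzero vectors of `𝔽₂²`. -/
def vecTwo (k : ZMod 3) : Fin 2 → ZMod 2 :=
  if k = 0 then ![1, 0] else if k = 1 then ![0, 1] else ![1, 1]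

/-- The central element `-1` goes to the trivial centre of `GL₂(𝔽₂)`. So diagonal matrices act
through one involution `θ S`, and `T 1` goes to an element of order 3. Take a vector fixed by `θ S`
and its translates under `θ (T k)`. -/
theorem exists_equivariant_of_surjective {θ : borel3 →* GL (Fin 2) (ZMod 2)}
    (hθ : Function.Surjective θ) : ∃ v : ZMod 3 → (Fin 2 → ZMod 2), Function.Injective v ∧
      (∀ k, v k ≠ 0) ∧ ∀ g k, (θ g).1.mulVec (v k) = v (borelAct g.1 k) := by
  have h10 : (1 : ZMod 3) ≠ 0 := by decide
  set T : ZMod 3 → borel3 := fun k => borel3Mk 1 k 1 h10 h10 with hT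
  have hTadd : ∀ k l, T k * T l = T (k + l) := by
    intro k l
    obtain ⟨e0, e1, e2⟩ := borel3_mul_apply (T k) (T l)
    apply borel3_ext
    · rw [e0]; simp [T, borel3Mk_apply]
    · rw [e1]; simp [T, borel3Mk_apply, add_comm]
    · rw [e2]; simp [T, borel3Mk_apply]
  have hT0 : T 0 = 1 := by
    apply borel3_ext <;> simp [T, borel3Mk_apply]
  -- The stabilizer of `0` in the action on `𝔽₃` is the group of diagonal matrices.
  have hdiag : ∀ g k, g * T k = T (borelAct g.1 k) *
      borel3Mk (g.1 0 0) 0 (g.1 1 1) (borel3_diag_ne_zero g).1 (borel3_diag_ne_zero g).2 := by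
    intro g k
    have hd := ZMod.three_mul_self_eq_one (borel3_diag_ne_zero g).2
    obtain ⟨e0, e1, e2⟩ := borel3_mul_apply g (T k)
    obtain ⟨f0, f1, f2⟩ := borel3_mul_apply (T (borelAct g.1 k))
      (borel3Mk (g.1 0 0) 0 (g.1 1 1) (borel3_diag_ne_zero g).1 (borel3_diag_ne_zero g).2)
    apply borel3_ext
    · rw [e0, f0]; simp [T, borel3Mk_apply]
    · rw [e1, f1]
      simp only [T, borel3Mk_apply, Matrix.of_apply, Matrix.cons_val', Matrix.cons_val_zero,
        Matrix.cons_val_one, Matrix.cons_val_fin_one, mul_zero, mul_one, zero_add, borelAct]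
      have hd' : ((g.1 1 1 : ZMod 3)) * g.1 1 1 = 1 := hd
      linear_combination (-(g.1 0 0 * k + g.1 0 1)) * hd'
    · rw [e2, f2]; simp [T, borel3Mk_apply]
  have hm1 : (-1 : ZMod 3) ≠ 0 := by decide
  -- `θ (-1) = 1`
  have hneg : θ (borel3Mk (-1) 0 (-1) hm1 hm1) = 1 := by
    set N := borel3Mk (-1) 0 (-1) hm1 hm1
    have hcomm : ∀ g, N * g = g * N := by
      intro g
      obtain ⟨e0, e1, e2⟩ := borel3_mul_apply N g
      obtain ⟨f0, f1, f2⟩ := borel3_mul_apply g N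
      apply borel3_ext
      · rw [e0, f0]; simp [N, borel3Mk_apply]
      · rw [e1, f1]; simp [N, borel3Mk_apply]
      · rw [e2, f2]; simp [N, borel3Mk_apply]
    have hcomm' : ∀ m, θ N * m = m * θ N := by
      intro m
      obtain ⟨g, rfl⟩ := hθ m
      rw [← map_mul, hcomm, map_mul]
    apply Units.ext
    apply ZMod.matrix_two_eq_one_of_commute
    · have := hcomm' ⟨!![1, 1; 0, 1], !![1, 1; 0, 1], by decide, by decide⟩
      exact congrArg Units.val this
    · have := hcomm' ⟨!![1, 0; 1, 1], !![1, 0; 1, 1], by decide, by decide⟩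
      exact congrArg Units.val this
    · exact Units.ne_zero _
  set S := borel3Mk (-1) 0 1 hm1 h10 with hS
  have hSS : S * S = 1 := by
    obtain ⟨e0, e1, e2⟩ := borel3_mul_apply S S
    apply borel3_ext
    · rw [e0]; simp [S, borel3Mk_apply]
    · rw [e1]; simp [S, borel3Mk_apply]
    · rw [e2]; simp [S, borel3Mk_apply]
  have hdiagS : ∀ a d (ha : a ≠ 0) (hd : d ≠ 0), θ (borel3Mk a 0 d ha hd) = 1 ∨
      θ (borel3Mk a 0 d ha hd) = θ S := by
    have key : ∀ a d : ZMod 3, a ≠ 0 → d ≠ 0 → (a = 1 ∧ d = 1) ∨ (a = -1 ∧ d = -1) ∨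
      (a = -1 ∧ d = 1) ∨ (a = 1 ∧ d = -1) := by decide
    intro a d ha hd
    rcases key a d ha hd with ⟨rfl, rfl⟩ | ⟨rfl, rfl⟩ | ⟨rfl, rfl⟩ | ⟨rfl, rfl⟩
    · left
      have : borel3Mk 1 0 1 ha hd = 1 := hT0
      rw [this, map_one]
    · exact Or.inl hneg
    · exact Or.inr rfl
    · right
      have : borel3Mk 1 0 (-1) ha hd = S * borel3Mk (-1) 0 (-1) hm1 hm1 := by
        obtain ⟨e0, e1, e2⟩ := borel3_mul_apply S (borel3Mk (-1) 0 (-1) hm1 hm1)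
        apply borel3_ext
        · rw [e0]; simp [S, borel3Mk_apply]
        · rw [e1]; simp [S, borel3Mk_apply]
        · rw [e2]; simp [S, borel3Mk_apply]
      rw [this, map_mul, hneg, mul_one]
  -- `θ (T 1) ≠ 1`
  have hT1 : θ (T 1) ≠ 1 := by
    intro h1
    have hTk : ∀ k, θ (T k) = 1 := by
      have : ∀ k : ZMod 3, k = 0 ∨ k = 1 ∨ k = 1 + 1 := by decide
      intro k
      rcases this k with rfl | rfl | rfl
      · rw [hT0, map_one]
      · exact h1
      · rw [← hTadd, map_mul, h1, one_mul]
    have him : ∀ m, m = 1 ∨ m = θ S := by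
      intro m
      obtain ⟨g, rfl⟩ := hθ m
      have h2 := congrArg θ (hdiag g 0)
      rw [map_mul, map_mul, hTk, hTk, mul_one, one_mul] at h2
      rw [h2]
      exact hdiagS _ _ _ _
    have h3 := him ⟨!![1, 1; 0, 1], !![1, 1; 0, 1], by decide, by decide⟩
    have h4 := him ⟨!![1, 0; 1, 1], !![1, 0; 1, 1], by decide, by decide⟩
    have h5 : (!![1, 1; 0, 1] : Matrix (Fin 2) (Fin 2) (ZMod 2)) ≠ 1 := by decide
    have h6 : (!![1, 0; 1, 1] : Matrix (Fin 2) (Fin 2) (ZMod 2)) ≠ 1 := by decide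
    have h7 : (!![1, 0; 1, 1] : Matrix (Fin 2) (Fin 2) (ZMod 2)) ≠ !![1, 1; 0, 1] := by decide
    rcases h3 with h3 | h3
    · exact h5 (congrArg Units.val h3)
    rcases h4 with h4 | h4
    · exact h6 (congrArg Units.val h4)
    exact h7 (congrArg Units.val (h4.trans h3.symm))
  obtain ⟨v₀, hv₀, hSv⟩ := ZMod.matrix_two_exists_mulVec_eq (θ S).1 (by
    have := congrArg (fun x => (θ x).1) hSS
    simpa using this)
  have hv : ∀ g k, (θ g).1.mulVec ((θ (T k)).1.mulVec v₀) =
      (θ (T (borelAct g.1 k))).1.mulVec v₀ := by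
    intro g k
    rw [Matrix.mulVec_mulVec]
    have h2 := congrArg (fun x => (θ x).1) (hdiag g k)
    simp only [map_mul, Units.val_mul] at h2
    rw [h2, ← Matrix.mulVec_mulVec]
    congr 1
    rcases hdiagS _ _ (borel3_diag_ne_zero g).1 (borel3_diag_ne_zero g).2 with h | h <;> rw [h]
    · simp
    · exact hSv
  have hT3 : ∀ k, k ≠ 0 → ∀ w : Fin 2 → ZMod 2, w ≠ 0 → (θ (T k)).1.mulVec w ≠ w := by
    intro k hk w hw
    refine ZMod.matrix_two_mulVec_ne _ ?_ ?_ w hw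
    · rw [← Units.val_mul, ← Units.val_mul, ← map_mul, ← map_mul, hTadd, hTadd]
      have : k + k + k = 0 := by revert k; decide
      rw [this, hT0, map_one, Units.val_one]
    · intro h
      have h' : θ (T k) = 1 := Units.ext h
      apply hT1
      have key : ∀ k : ZMod 3, k ≠ 0 → k = 1 ∨ k + k = 1 := by decide
      rcases key k hk with rfl | h2
      · exact h'
      · rw [← h2, ← hTadd, map_mul, h', one_mul]
  refine ⟨fun k => (θ (T k)).1.mulVec v₀, ?_, ?_, hv⟩
  · intro k l hkl
    by_contra hne
    have hkl' : (θ (T k)).1.mulVec v₀ = (θ (T l)).1.mulVec v₀ := hkl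
    apply hT3 (k - l) (sub_ne_zero.2 hne) ((θ (T l)).1.mulVec v₀)
    · intro h
      apply hv₀
      have := congrArg ((θ (T l))⁻¹.1.mulVec) h
      rw [Matrix.mulVec_mulVec, ← Units.val_mul, inv_mul_cancel] at this
      simpa using this
    · rw [Matrix.mulVec_mulVec, ← Units.val_mul, ← map_mul, hTadd, sub_add_cancel]
      exact hkl'
  · intro k h
    apply hv₀
    have := congrArg ((θ (T k))⁻¹.1.mulVec) h
    rw [Matrix.mulVec_mulVec, ← Units.val_mul, inv_mul_cancel] at this
    simpa using this

/-- The matrix over `𝔽₂` that permutes the nonzero vectors as `g` permutes `𝔽₃`. -/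
def borelMatrixTwo (g : GL (Fin 2) (ZMod 3)) : Matrix (Fin 2) (Fin 2) (ZMod 2) :=
  Matrix.of fun i j => vecTwo (borelAct g (if j = 0 then 0 else 1)) i

theorem borelMatrixTwo_mulVec (g : borel3) (k : ZMod 3) :
    (borelMatrixTwo g.1).mulVec (vecTwo k) = vecTwo (borelAct g.1 k) := by
  have key : ∀ a b d : ZMod 3, a ≠ 0 → d ≠ 0 → ∀ k : ZMod 3,
    (Matrix.of fun i j : Fin 2 => vecTwo ((a * (if j = 0 then 0 else 1) + b) * d) i).mulVec
      (vecTwo k) = vecTwo ((a * k + b) * d) := by decide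
  exact key _ _ _ (borel3_diag_ne_zero g).1 (borel3_diag_ne_zero g).2 k

theorem matrix_two_ext_vecTwo {M N : Matrix (Fin 2) (Fin 2) (ZMod 2)}
    (h : ∀ k, M.mulVec (vecTwo k) = N.mulVec (vecTwo k)) : M = N := by
  revert M N
  decide

theorem exists_surjective_borel3 : ∃ θ : borel3 →* GL (Fin 2) (ZMod 2),
    Function.Surjective θ := by
  let f : borel3 →* Matrix (Fin 2) (Fin 2) (ZMod 2) :=
    { toFun := fun g => borelMatrixTwo g.1
      map_one' := by
        apply matrix_two_ext_vecTwo
        intro k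
        rw [borelMatrixTwo_mulVec]
        simp [borelAct_one]
      map_mul' := fun g h => by
        apply matrix_two_ext_vecTwo
        intro k
        rw [borelMatrixTwo_mulVec, borelAct_mul, ← Matrix.mulVec_mulVec, borelMatrixTwo_mulVec,
          borelMatrixTwo_mulVec] }
  refine ⟨f.toHomUnits, fun N => ?_⟩
  have key : ∀ N M : Matrix (Fin 2) (Fin 2) (ZMod 2), M * N = 1 → ∃ a b : ZMod 3, a ≠ 0 ∧
      (Matrix.of fun i j : Fin 2 => vecTwo ((a * (if j = 0 then 0 else 1) + b) * 1) i) = N := by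
    decide
  obtain ⟨a, b, ha, h⟩ := key N.1 N⁻¹.1 (by simp)
  exact ⟨borel3Mk a b 1 ha one_ne_zero, Units.ext h⟩

/-! ### Subgroups of the Borel subgroup -/

theorem exists_generators_of_no_fixedPoint {S : Set (ZMod 3 × ZMod 3)}
    (hmul : ∀ p ∈ S, ∀ q ∈ S, (p.1 * q.1, p.1 * q.2 + p.2) ∈ S)
    (hrefl : ∃ c, (-1, c) ∈ S) (h0 : ∀ p ∈ S, p.1 ≠ 0)
    (hfix : ∀ k, ∃ p ∈ S, p.1 * k + p.2 ≠ k) : ∀ p : ZMod 3 × ZMod 3, p.1 ≠ 0 → p ∈ S := by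
  obtain ⟨c, hc⟩ := hrefl
  -- The reflection `x ↦ -x + c` fixes `-c`. An element moving `-c` is a translation or another
  -- reflection, and in the latter case the product is a nontrivial translation.
  obtain ⟨⟨α, β⟩, hp, hk⟩ := hfix (-c)
  have hα := h0 _ hp
  -- a nontrivial translation
  have ht : ∃ t, t ≠ 0 ∧ ((1, t) : ZMod 3 × ZMod 3) ∈ S := by
    have key : ∀ α : ZMod 3, α ≠ 0 → α = 1 ∨ α = -1 := by decide
    rcases key α hα with rfl | rfl
    · exact ⟨β, fun h => hk (by simp [h]), hp⟩
    · refine ⟨-β + c, fun h => hk ?_, by simpa using hmul _ hc _ hp⟩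
      have h' : ∀ β c : ZMod 3, -β + c = 0 → -1 * -c + β = -c := by decide
      exact h' β c h
  obtain ⟨t, ht0, ht⟩ := ht
  have htt : ((1, t + t) : ZMod 3 × ZMod 3) ∈ S := by simpa using hmul _ ht _ ht
  have httt : ((1, t + t + t) : ZMod 3 × ZMod 3) ∈ S := by
    simpa [add_assoc] using hmul _ htt _ ht
  have htr : ∀ k, ((1, k) : ZMod 3 × ZMod 3) ∈ S := by
    have key : ∀ t k : ZMod 3, t ≠ 0 → k = t ∨ k = t + t ∨ k = t + t + t := by decide
    intro k
    rcases key t k ht0 with h | h | h <;> rw [h] <;> assumption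
  rintro ⟨a, b⟩ ha
  have key : ∀ α : ZMod 3, α ≠ 0 → α = 1 ∨ α = -1 := by decide
  rcases key a ha with rfl | rfl
  · exact htr b
  · simpa using hmul _ (htr (b - c)) _ hc

theorem borelAct_eq (g : GL (Fin 2) (ZMod 3)) (k : ZMod 3) :
    borelAct g k = (g 0 0 * g 1 1) * k + g 0 1 * g 1 1 := by
  rw [borelAct]
  ring

/-- A subgroup of the Borel subgroup without fixed point on `𝔽₃` that contains a reflection
acts on `𝔽₃` through all affine maps. -/
theorem exists_borelAct_eq {G : Subgroup (GL (Fin 2) (ZMod 3))} (hG : G ≤ borel3)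
    (hrefl : ∃ g ∈ G, g 0 0 * g 1 1 = -1) (hfix : ∀ k, ∃ g ∈ G, borelAct g k ≠ k)
    (h : borel3) : ∃ g ∈ G, ∀ k, borelAct g k = borelAct h.1 k := by
  have := exists_generators_of_no_fixedPoint
    (S := {p | ∃ g ∈ G, p = (g 0 0 * g 1 1, g 0 1 * g 1 1)}) ?_ ?_ ?_ ?_
    (h.1 0 0 * h.1 1 1, h.1 0 1 * h.1 1 1)
    (mul_ne_zero (borel3_diag_ne_zero h).1 (borel3_diag_ne_zero h).2)
  · obtain ⟨g, hg, hp⟩ := this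
    refine ⟨g, hg, fun k => ?_⟩
    obtain ⟨h1, h2⟩ := Prod.mk.inj hp
    rw [borelAct_eq, borelAct_eq, h1, h2]
  · rintro _ ⟨g, hg, rfl⟩ _ ⟨g', hg', rfl⟩
    refine ⟨g * g', mul_mem hg hg', ?_⟩
    obtain ⟨e0, e1, e2⟩ := borel3_mul_apply ⟨g, hG hg⟩ ⟨g', hG hg'⟩
    have hd : (g' 1 1 : ZMod 3) * g' 1 1 = 1 :=
      ZMod.three_mul_self_eq_one (borel3_diag_ne_zero ⟨g', hG hg'⟩).2
    have e0' : (g * g') 0 0 = _ := e0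
    have e1' : (g * g') 0 1 = _ := e1
    have e2' : (g * g') 1 1 = _ := e2
    rw [e0', e1', e2']
    ext
    · simp only; ring
    · simp only
      linear_combination (-(g 0 1 * g 1 1)) * hd
  · obtain ⟨g, hg, h⟩ := hrefl
    exact ⟨g 0 1 * g 1 1, g, hg, by rw [h]⟩
  · rintro _ ⟨g, hg, rfl⟩
    exact mul_ne_zero (borel3_diag_ne_zero ⟨g, hG hg⟩).1 (borel3_diag_ne_zero ⟨g, hG hg⟩).2
  · intro k
    obtain ⟨g, hg, h⟩ := hfix k
    exact ⟨_, ⟨g, hg, rfl⟩, by rwa [borelAct_eq] at h⟩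

theorem mem_of_borelAct_eq {G : Subgroup (GL (Fin 2) (ZMod 3))} (hG : G ≤ borel3)
    (hact : ∀ h : borel3, ∃ g ∈ G, ∀ k, borelAct g k = borelAct h.1 k) (h : borel3) :
    h.1 ∈ G ∨ -h.1 ∈ G := by
  obtain ⟨g, hg, hgk⟩ := hact h
  rcases (borelAct_eq_iff (g := ⟨g, hG hg⟩)).1 hgk with e | e
  · left
    rw [← e]
    exact hg
  · right
    have : -h.1 = g := by
      apply Units.ext
      ext i j
      rw [e i j]
      rfl
    rwa [this]

/-- Up to sign `G` contains every element of `B(3)`. If `-1 ∉ G`, it contains exactly one of `±h`;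
unipotent elements belong to `G`, and the choice between `diag(1, -1)` and its negative decides
which subgroup occurs. -/
theorem borel3_eq_or {G : Subgroup (GL (Fin 2) (ZMod 3))} (hG : G ≤ borel3)
    (hact : ∀ h : borel3, ∃ g ∈ G, ∀ k, borelAct g k = borelAct h.1 k) :
    G = borel3 ∨ (-1 ∉ G ∧ (G = borel3Left ∨ G = borel3Right)) := by
  have hm := mem_of_borelAct_eq hG hact
  by_cases h1 : -1 ∈ G
  · left
    refine le_antisymm hG fun h hh => ?_
    rcases hm ⟨h, hh⟩ with h | h
    · exact h
    · simpa using mul_mem h1 h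
  refine Or.inr ⟨h1, ?_⟩
  have h10 : (1 : ZMod 3) ≠ 0 := by decide
  have hm10 : (-1 : ZMod 3) ≠ 0 := by decide
  have hT : ∀ b, (borel3Mk 1 b 1 h10 h10).1 ∈ G := by
    intro b
    rcases hm (borel3Mk 1 b 1 h10 h10) with h | h
    · exact h
    · have h4 := pow_mem h 4
      -- The fourth power removes the sign, and a unipotent element has order dividing 3.
      have : (-(borel3Mk 1 b 1 h10 h10).1) ^ 4 = (borel3Mk 1 b 1 h10 h10).1 := by
        apply Units.ext
        rw [Units.val_pow_eq_pow_val, Units.val_neg, borel3Mk_apply]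
        clear h h4
        revert b
        decide
      rwa [this] at h4
  have hnot : ∀ g ∈ G, -g ∉ G := by
    intro g hg hg'
    apply h1
    have := mul_mem hg' (inv_mem hg)
    simpa using this
  rcases hm (borel3Mk 1 0 (-1) h10 hm10) with hS | hS
  · left
    have hall : ∀ b d (hd : d ≠ 0), (borel3Mk 1 b d h10 hd).1 ∈ G := by
      intro b d hd
      have key : ∀ d : ZMod 3, d ≠ 0 → d = 1 ∨ d = -1 := by decide
      rcases key d hd with rfl | rfl
      · exact hT b
      · have := mul_mem (hT (-b)) hS
        have e : (borel3Mk 1 (-b) 1 h10 h10).1 * (borel3Mk 1 0 (-1) h10 hm10).1 =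
            (borel3Mk 1 b (-1) h10 hd).1 := by
          apply Units.ext
          rw [Units.val_mul, borel3Mk_apply, borel3Mk_apply, borel3Mk_apply]
          clear this hd
          revert b
          decide
        rwa [e] at this
    have hle : borel3Left ≤ G := by
      rintro g ⟨hg, hg1⟩
      have hd := borel3_diag_ne_zero ⟨g, hg⟩
      have e : (borel3Mk 1 (g 0 1) (g 1 1) h10 hd.2) = ⟨g, hg⟩ := by
        apply borel3_ext
        · exact hg1.symm
        · rfl
        · rfl
      have := hall (g 0 1) (g 1 1) hd.2
      rwa [e] at this
    refine le_antisymm (fun g hg => ⟨hG hg, ?_⟩) hle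
    have key : ∀ d : ZMod 3, d ≠ 0 → d = 1 ∨ d = -1 := by decide
    rcases key _ (borel3_diag_ne_zero ⟨g, hG hg⟩).1 with h | h
    · exact h
    · refine absurd (hle ⟨?_, ?_⟩) (hnot g hg)
      · have := borel3_apply ⟨g, hG hg⟩
        simpa using this
      · have h' : g 0 0 = -1 := h
        simp [h']
  · right
    have hall : ∀ a b (ha : a ≠ 0), (borel3Mk a b 1 ha h10).1 ∈ G := by
      intro a b ha
      have key : ∀ d : ZMod 3, d ≠ 0 → d = 1 ∨ d = -1 := by decide
      rcases key a ha with rfl | rfl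
      · exact hT b
      · have := mul_mem (hT b) hS
        have e : (borel3Mk 1 b 1 h10 h10).1 * -(borel3Mk 1 0 (-1) h10 hm10).1 =
            (borel3Mk (-1) b 1 ha h10).1 := by
          apply Units.ext
          rw [Units.val_mul, Units.val_neg, borel3Mk_apply, borel3Mk_apply, borel3Mk_apply]
          clear this ha
          revert b
          decide
        rwa [e] at this
    have hle : borel3Right ≤ G := by
      rintro g ⟨hg, hg1⟩
      have hd := borel3_diag_ne_zero ⟨g, hg⟩
      have e : (borel3Mk (g 0 0) (g 0 1) 1 hd.1 h10) = ⟨g, hg⟩ := by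
        apply borel3_ext
        · rfl
        · rfl
        · exact hg1.symm
      have := hall (g 0 0) (g 0 1) hd.1
      rwa [e] at this
    refine le_antisymm (fun g hg => ⟨hG hg, ?_⟩) hle
    have key : ∀ d : ZMod 3, d ≠ 0 → d = 1 ∨ d = -1 := by decide
    rcases key _ (borel3_diag_ne_zero ⟨g, hG hg⟩).2 with h | h
    · exact h
    · refine absurd (hle ⟨?_, ?_⟩) (hnot g hg)
      · have := borel3_apply ⟨g, hG hg⟩
        simpa using this
      · have h' : g 1 1 = -1 := h
        simp [h']

namespace WeierstrassCurve

open Affine.Point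

variable {E : WeierstrassCurve ℚ}

/-! ### The `x`-coordinates of torsion points -/

/-- The `x`-coordinate of a point, with junk value `0` at infinity. -/
def pointX : QbarPoints E → Qbar
  | .zero => 0
  | .some x _ _ => x

theorem exists_eq_some {P : QbarPoints E} (hP : P ≠ 0) :
    ∃ y h, P = some (pointX P) y h := by
  rcases P with _ | ⟨x, y, h⟩
  · exact absurd rfl hP
  · exact ⟨y, h, rfl⟩

theorem pointX_eq_iff {P Q : QbarPoints E} (hP : P ≠ 0) (hQ : Q ≠ 0) :
    pointX P = pointX Q ↔ P = Q ∨ P = -Q := by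
  rcases P with _ | ⟨x, y, h⟩
  · exact absurd rfl hP
  rcases Q with _ | ⟨x', y', h'⟩
  · exact absurd rfl hQ
  exact X_eq_iff (W := (E⁄Qbar).toAffine)

theorem pointX_galPoint (σ : GQ) (P : QbarPoints E) :
    pointX (galPoint E σ P) = σ (pointX P) := by
  rcases P with _ | ⟨x, y, h⟩
  · exact (map_zero σ).symm
  · rfl

theorem exists_pointX_eq [E.IsElliptic] (x : Qbar) : ∃ P : QbarPoints E, P ≠ 0 ∧ pointX P = x := by
  obtain ⟨z, hz⟩ := IsAlgClosed.exists_pow_nat_eq ((E⁄Qbar).psiTwoSq x) (n := 2) two_pos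
  have h := Affine.equation_of_sq_eq (W := E⁄Qbar) two_ne_zero (x := x)
    (y := (z - (E⁄Qbar).a₁ * x - (E⁄Qbar).a₃) / 2) (by rw [← hz]; ring)
  exact ⟨some x _ (Affine.equation_iff_nonsingular.1 h), some_ne_zero _, rfl⟩

theorem mem_tors_three_iff [E.IsElliptic] {P : QbarPoints E} (hP : P ≠ 0) :
    P ∈ Tors E 3 ↔ (E⁄Qbar).psiThree (pointX P) = 0 := by
  obtain ⟨y, h, he⟩ := exists_eq_some hP
  rw [AddSubgroup.torsionBy.nsmul_iff, ← three_nsmul_some_eq_zero_iff E.Δ_Qbar_ne_zero h, ← he]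

theorem mem_tors_two_iff {P : QbarPoints E} (hP : P ≠ 0) :
    P ∈ Tors E 2 ↔ (E⁄Qbar).psiTwoSq (pointX P) = 0 := by
  obtain ⟨y, h, he⟩ := exists_eq_some hP
  rw [AddSubgroup.torsionBy.nsmul_iff, ← two_nsmul_some_eq_zero_iff h, ← he]

section Coordinates

variable {n : ℕ} (b : Module.Basis (Fin 2) (ZMod n) (Tors E n))

/-- The `n`-torsion point with given coordinates. -/
def torsPoint (w : Fin 2 → ZMod n) : Tors E n := b.equivFun.symm w

/-- The `x`-coordinate of the `n`-torsion point with given coordinates. -/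
def torsX (w : Fin 2 → ZMod n) : Qbar := pointX (torsPoint b w).1

theorem torsPoint_neg (w : Fin 2 → ZMod n) : torsPoint b (-w) = -torsPoint b w :=
  map_neg b.equivFun.symm w

theorem torsPoint_injective : Function.Injective (torsPoint b) := b.equivFun.symm.injective

theorem torsPoint_eq_zero_iff {w : Fin 2 → ZMod n} : torsPoint b w = 0 ↔ w = 0 :=
  b.equivFun.symm.map_eq_zero_iff

theorem torsPoint_coe_ne_zero {w : Fin 2 → ZMod n} (hw : w ≠ 0) :
    (torsPoint b w : QbarPoints E) ≠ 0 := by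
  intro h
  exact hw ((torsPoint_eq_zero_iff b).1 (Subtype.ext h))

theorem torsX_eq_iff {v w : Fin 2 → ZMod n} (hv : v ≠ 0) (hw : w ≠ 0) :
    torsX b v = torsX b w ↔ v = w ∨ v = -w := by
  rw [torsX, torsX, pointX_eq_iff (torsPoint_coe_ne_zero b hv) (torsPoint_coe_ne_zero b hw)]
  refine or_congr ?_ ?_
  · rw [← (torsPoint_injective b).eq_iff]
    exact ⟨fun h => Subtype.ext h, fun h => congrArg _ h⟩
  · rw [← (torsPoint_injective b).eq_iff, torsPoint_neg]
    exact ⟨fun h => Subtype.ext h, fun h => congrArg Subtype.val h⟩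

theorem galTors_torsPoint (σ : GQ) (w : Fin 2 → ZMod n) :
    galTors E n σ (torsPoint b w) = torsPoint b ((galRep E n b σ).1.mulVec w) := by
  have h := LinearMap.toMatrix_mulVec_repr b b (galRepLin E n σ) (torsPoint b w)
  have h2 : (b.repr (torsPoint b w) : Fin 2 → ZMod n) = w := b.equivFun.apply_symm_apply w
  rw [h2] at h
  have h3 : (galRep E n b σ).1 = LinearMap.toMatrix b b (galRepLin E n σ) := rfl
  rw [h3, h]
  exact (b.equivFun.symm_apply_apply _).symm

theorem map_torsX (σ : GQ) (w : Fin 2 → ZMod n) :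
    σ (torsX b w) = torsX b ((galRep E n b σ).1.mulVec w) := by
  rw [torsX, torsX, ← galTors_torsPoint, ← pointX_galPoint]
  rfl

theorem galRep_eq_one_iff (σ : GQ) : galRep E n b σ = 1 ↔ galRepLin E n σ = 1 := by
  have h3 : (galRep E n b σ).1 = LinearMap.toMatrixAlgEquiv b (galRepLin E n σ) := rfl
  rw [← Units.val_inj, h3, Units.val_one]
  exact (LinearMap.toMatrixAlgEquiv b).map_eq_one_iff

theorem galRep_eq_neg_one_iff (σ : GQ) : galRep E n b σ = -1 ↔ galRepLin E n σ = -1 := by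
  have h3 : (galRep E n b σ).1 = LinearMap.toMatrixAlgEquiv b (galRepLin E n σ) := rfl
  rw [← Units.val_inj, h3, Units.val_neg, Units.val_one]
  constructor
  · intro h
    apply (LinearMap.toMatrixAlgEquiv b).injective
    rw [h, map_neg, map_one]
  · intro h
    rw [h, map_neg, map_one]

end Coordinates

section Three

variable (b : Module.Basis (Fin 2) (ZMod 3) (Tors E 3))

/-- The vector `g (k, 1)` spans the line of `(borelAct g k, 1)`, and `x` depends only on the line.
-/
theorem torsX_mulVec {g : GL (Fin 2) (ZMod 3)} (hg : g ∈ borel3) (k : ZMod 3) :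
    torsX b (g.1.mulVec ![k, 1]) = torsX b ![borelAct g k, 1] := by
  have hne : ∀ k : ZMod 3, (![k, 1] : Fin 2 → ZMod 3) ≠ 0 := by decide
  have key : ∀ a b d k : ZMod 3, a ≠ 0 → d ≠ 0 →
      (!![a, b; 0, d].mulVec ![k, 1] ≠ 0 ∧ (!![a, b; 0, d].mulVec ![k, 1] = ![(a * k + b) * d, 1] ∨
        !![a, b; 0, d].mulVec ![k, 1] = -![(a * k + b) * d, 1])) := by decide
  have e : g.1 = !![g 0 0, g 0 1; 0, g 1 1] := by
    have := borel3_apply ⟨g, hg⟩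
    have h' : g 1 0 = 0 := this
    rw [← h']
    exact Matrix.eta_fin_two g.1
  have hd := borel3_diag_ne_zero ⟨g, hg⟩
  obtain ⟨h1, h2⟩ := key (g 0 0) (g 0 1) (g 1 1) k hd.1 hd.2
  rw [← e] at h1 h2
  exact (torsX_eq_iff b h1 (hne _)).2 h2

variable [E.IsElliptic]

theorem psiThree_torsX {w : Fin 2 → ZMod 3} (hw : w ≠ 0) : (E⁄Qbar).psiThree (torsX b w) = 0 :=
  (mem_tors_three_iff (torsPoint_coe_ne_zero b hw)).1 (torsPoint b w).2

theorem isThreeRoots_torsX : (E⁄Qbar).IsThreeRoots (torsX b ![1, 0]) fun k => torsX b ![k, 1] := by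
  have hne : ∀ k : ZMod 3, (![k, 1] : Fin 2 → ZMod 3) ≠ 0 := by decide
  have hne1 : (![1, 0] : Fin 2 → ZMod 3) ≠ 0 := by decide
  refine isThreeRoots_of_injective E.Δ_Qbar_ne_zero (fun k l h => ?_) (psiThree_torsX b hne1)
    (fun k h => ?_) fun k => psiThree_torsX b (hne k)
  · have key : ∀ k l : ZMod 3, (![k, 1] : Fin 2 → ZMod 3) = ![l, 1] ∨
      (![k, 1] : Fin 2 → ZMod 3) = -![l, 1] → k = l := by decide
    exact key k l ((torsX_eq_iff b (hne k) (hne l)).1 h)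
  · have key : ∀ k : ZMod 3, ¬ ((![k, 1] : Fin 2 → ZMod 3) = ![1, 0] ∨
      (![k, 1] : Fin 2 → ZMod 3) = -![1, 0]) := by decide
    exact key k ((torsX_eq_iff b (hne k) hne1).1 h)

omit [E.IsElliptic] in
theorem torsX_ne (k : ZMod 3) : torsX b ![k, 1] ≠ torsX b ![1, 0] := by
  have hne : ∀ k : ZMod 3, (![k, 1] : Fin 2 → ZMod 3) ≠ 0 := by decide
  have hne1 : (![1, 0] : Fin 2 → ZMod 3) ≠ 0 := by decide
  intro h
  have key : ∀ k : ZMod 3, ¬ ((![k, 1] : Fin 2 → ZMod 3) = ![1, 0] ∨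
      (![k, 1] : Fin 2 → ZMod 3) = -![1, 0]) := by decide
  exact key k ((torsX_eq_iff b (hne k) hne1).1 h)

end Three

section Two

variable (b : Module.Basis (Fin 2) (ZMod 2) (Tors E 2))

theorem torsX_two_eq_iff {v w : Fin 2 → ZMod 2} (hv : v ≠ 0) (hw : w ≠ 0) :
    torsX b v = torsX b w ↔ v = w := by
  rw [torsX_eq_iff b hv hw]
  have key : ∀ v w : Fin 2 → ZMod 2, v = w ∨ v = -w ↔ v = w := by decide
  exact key v w

theorem isTwoRoots_torsX [E.IsElliptic] {v : ZMod 3 → (Fin 2 → ZMod 2)} (hv : Function.Injective v)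
    (hv0 : ∀ k, v k ≠ 0) : (E⁄Qbar).IsTwoRoots fun k => torsX b (v k) := by
  refine isTwoRoots_of_injective E.Δ_Qbar_ne_zero (fun k l h => ?_) fun k =>
    (mem_tors_two_iff (torsPoint_coe_ne_zero b (hv0 k))).1 (torsPoint b (v k)).2
  exact hv ((torsX_two_eq_iff b (hv0 k) (hv0 l)).1 h)

end Two

/-! ### From the image in the graph to the division polynomials -/

section Graph

variable [E.IsElliptic] {θ : borel3 →* GL (Fin 2) (ZMod 2)}
  {b₂ : Module.Basis (Fin 2) (ZMod 2) (Tors E 2)} {b₃ : Module.Basis (Fin 2) (ZMod 3) (Tors E 3)}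
  (h : ((galRep E 2 b₂).prod (galRep E 3 b₃)).range ≤ graphSubgroup θ)
include h

omit [E.IsElliptic] in
theorem galRep_mem_borel3 (σ : GQ) : ∃ hσ : galRep E 3 b₃ σ ∈ borel3,
    θ ⟨_, hσ⟩ = galRep E 2 b₂ σ := by
  obtain ⟨g, hg⟩ := h ⟨σ, rfl⟩
  obtain ⟨h1, h2⟩ := Prod.ext_iff.1 hg
  have h2' : g.1 = galRep E 3 b₃ σ := h2
  have h1' : θ g = galRep E 2 b₂ σ := h1
  refine ⟨h2' ▸ g.2, ?_⟩
  rw [← h1']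
  congr 1
  exact Subtype.ext h2'.symm

omit [E.IsElliptic] in
theorem exists_torsX_eq_algebraMap : ∃ x₁ : ℚ, algebraMap ℚ Qbar x₁ = torsX b₃ ![1, 0] := by
  refine exists_algebraMap_eq_of_fixed fun σ => ?_
  obtain ⟨hσ, -⟩ := galRep_mem_borel3 h σ
  rw [map_torsX]
  have hne1 : (![1, 0] : Fin 2 → ZMod 3) ≠ 0 := by decide
  have e : (galRep E 3 b₃ σ).1 = !![galRep E 3 b₃ σ 0 0, galRep E 3 b₃ σ 0 1; 0,
      galRep E 3 b₃ σ 1 1] := by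
    have h' : galRep E 3 b₃ σ 1 0 = 0 := hσ
    rw [← h']
    exact Matrix.eta_fin_two _
  have key : ∀ a b d : ZMod 3, a ≠ 0 → (!![a, b; 0, d].mulVec ![1, 0] ≠ 0 ∧
    (!![a, b; 0, d].mulVec ![1, 0] = ![1, 0] ∨ !![a, b; 0, d].mulVec ![1, 0] = -![1, 0])) := by
    decide
  obtain ⟨h1, h2⟩ := key _ (galRep E 3 b₃ σ 0 1) (galRep E 3 b₃ σ 1 1)
    (borel3_diag_ne_zero ⟨_, hσ⟩).1
  rw [e]
  exact (torsX_eq_iff b₃ h1 hne1).2 h2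

omit [E.IsElliptic] in
theorem map_torsX_three (σ : GQ) (k : ZMod 3) :
    σ (torsX b₃ ![k, 1]) = torsX b₃ ![borelAct (galRep E 3 b₃ σ) k, 1] := by
  rw [map_torsX, torsX_mulVec b₃ (galRep_mem_borel3 h σ).1]

omit [E.IsElliptic] in
theorem map_torsX_two {v : ZMod 3 → (Fin 2 → ZMod 2)}
    (hθv : ∀ g k, (θ g).1.mulVec (v k) = v (borelAct g.1 k)) (σ : GQ) (k : ZMod 3) :
    σ (torsX b₂ (v k)) = torsX b₂ (v (borelAct (galRep E 3 b₃ σ) k)) := by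
  obtain ⟨hσ, e⟩ := galRep_mem_borel3 h σ
  rw [map_torsX, ← e, hθv]

theorem isLevelSix_of_range_le (hθ : Function.Surjective θ) : IsLevelSix E := by
  obtain ⟨v, hv, hv0, hθv⟩ := exists_equivariant_of_surjective hθ
  obtain ⟨x₁, hx₁⟩ := exists_torsX_eq_algebraMap h
  have hX := isThreeRoots_torsX b₃
  have hX' := torsX_ne b₃
  rw [← hx₁] at hX hX'
  refine ⟨x₁, _, _, hX, hX', isTwoRoots_torsX b₂ hv hv0, fun σ k l hkl => ?_⟩
  have : l = borelAct (galRep E 3 b₃ σ) k := by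
    rw [map_torsX_three h] at hkl
    exact (hX.1 hkl).symm
  rw [this, map_torsX_two h hθv]

end Graph

end WeierstrassCurve

/-! ### Bases of `E[2]` and `E[3]` with prescribed `x`-coordinates. -/

namespace WeierstrassCurve

variable {E : WeierstrassCurve ℚ}

section Bases

variable [E.IsElliptic]

theorem exists_tors_three_pointX {x : Qbar} (hx : (E⁄Qbar).psiThree x = 0) :
    ∃ P : Tors E 3, P ≠ 0 ∧ pointX P.1 = x := by
  obtain ⟨P, hP, rfl⟩ := exists_pointX_eq (E := E) x
  exact ⟨⟨P, (mem_tors_three_iff hP).2 hx⟩, fun h => hP (congrArg Subtype.val h), rfl⟩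

theorem exists_tors_two_pointX {x : Qbar} (hx : (E⁄Qbar).psiTwoSq x = 0) :
    ∃ P : Tors E 2, P ≠ 0 ∧ pointX P.1 = x := by
  obtain ⟨P, hP, rfl⟩ := exists_pointX_eq (E := E) x
  exact ⟨⟨P, (mem_tors_two_iff hP).2 hx⟩, fun h => hP (congrArg Subtype.val h), rfl⟩

omit [E.IsElliptic] in
theorem tors_pointX_eq_iff {n : ℕ} {P Q : Tors E n} (hP : P ≠ 0) (hQ : Q ≠ 0) :
    pointX P.1 = pointX Q.1 ↔ P = Q ∨ P = -Q := by
  rw [pointX_eq_iff (fun h => hP (Subtype.ext h)) (fun h => hQ (Subtype.ext h))]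
  refine or_congr ?_ ?_
  · exact ⟨fun h => Subtype.ext h, fun h => congrArg _ h⟩
  · exact ⟨fun h => Subtype.ext h, fun h => congrArg Subtype.val h⟩

/-- Two `3`-torsion points with prescribed `x`-coordinates of them and of their sum. -/
theorem exists_points_three {x₁ : Qbar} {X : ZMod 3 → Qbar} (hX : (E⁄Qbar).IsThreeRoots x₁ X)
    (hX₁ : ∀ k, X k ≠ x₁) : ∃ P Q : Tors E 3, P ≠ 0 ∧ pointX P.1 = x₁ ∧
      ∀ k : ZMod 3, k • P + Q ≠ 0 ∧ pointX (k • P + Q).1 = X k := by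
  obtain ⟨P, hP, hPx⟩ := exists_tors_three_pointX (hX.psiThree_eq_zero_iff.2 (Or.inl rfl))
  obtain ⟨Q, hQ, hQx⟩ := exists_tors_three_pointX
    (hX.psiThree_eq_zero_iff.2 (Or.inr ⟨0, rfl⟩))
  have h3P : P + P = -P := by
    have : (3 : ℕ) • P = 0 := by
      have := P.2
      rw [AddSubgroup.torsionBy.nsmul_iff] at this
      exact Subtype.ext this
    rw [eq_neg_iff_add_eq_zero, ← this]
    abel
  have hQP : Q ≠ P ∧ Q ≠ -P := by
    have : ¬ (Q = P ∨ Q = -P) := by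
      rw [← tors_pointX_eq_iff hQ hP, hPx, hQx]
      exact hX₁ 0
    exact not_or.1 this
  have hPN : P ≠ -P := by
    intro h
    apply hP
    exact add_eq_left.1 (h3P.trans h.symm)
  have hQ2 : Q + Q = -Q := by
    have : (3 : ℕ) • Q = 0 := by
      have := Q.2
      rw [AddSubgroup.torsionBy.nsmul_iff] at this
      exact Subtype.ext this
    rw [eq_neg_iff_add_eq_zero, ← this]
    abel
  have hr : ∀ R : Tors E 3, R ≠ 0 → R ≠ P → R ≠ -P → R ≠ Q → R ≠ -Q →
      pointX R.1 = X 1 ∨ pointX R.1 = X 2 := by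
    intro R hR h1 h2 h3 h4
    have h := (mem_tors_three_iff (fun h => hR (Subtype.ext h))).1 R.2
    rcases hX.psiThree_eq_zero_iff.1 h with h | ⟨k, hk⟩
    · rw [← hPx, tors_pointX_eq_iff hR hP] at h
      exact absurd h (not_or.2 ⟨h1, h2⟩)
    · have k3 : ∀ k : ZMod 3, k = 0 ∨ k = 1 ∨ k = 2 := by decide
      rcases k3 k with rfl | rfl | rfl
      · rw [← hQx, tors_pointX_eq_iff hR hQ] at hk
        exact absurd hk (not_or.2 ⟨h3, h4⟩)
      · exact Or.inl hk
      · exact Or.inr hk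
  have main : ∀ P : Tors E 3, P ≠ 0 → pointX P.1 = x₁ → P + P = -P → Q ≠ P → Q ≠ -P →
      pointX (P + Q).1 = X 1 → pointX (-P + Q).1 = X 2 → ∃ P Q : Tors E 3, P ≠ 0 ∧
      pointX P.1 = x₁ ∧ ∀ k : ZMod 3, k • P + Q ≠ 0 ∧ pointX (k • P + Q).1 = X k := by
    intro P hP hPx h3P h1 h2 h3 h4
    refine ⟨P, Q, hP, hPx, fun k => ?_⟩
    have k3 : ∀ k : ZMod 3, k = 0 ∨ k = 1 ∨ k = -1 := by decide
    rcases k3 k with rfl | rfl | rfl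
    · rw [zero_smul, zero_add]
      exact ⟨hQ, hQx⟩
    · rw [one_smul]
      exact ⟨fun h => h2 (eq_neg_of_add_eq_zero_right h), h3⟩
    · rw [neg_smul, one_smul]
      exact ⟨fun h => h1 (by rw [eq_neg_of_add_eq_zero_right h, neg_neg]), h4⟩
  have a0 : P + Q ≠ 0 := fun h => hQP.2 (eq_neg_of_add_eq_zero_right h)
  have a1 : P + Q ≠ P := fun h => hQ (add_eq_left.1 h)
  have a2 : P + Q ≠ -P := by
    intro h
    rw [← h3P] at h
    exact hQP.1 (add_left_cancel h)
  have a3 : P + Q ≠ Q := fun h => hP (add_eq_right.1 h)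
  have a4 : P + Q ≠ -Q := by
    intro h
    rw [← hQ2] at h
    exact hQP.1 (add_right_cancel h).symm
  have b0 : -P + Q ≠ 0 := fun h => hQP.1 (by rw [eq_neg_of_add_eq_zero_right h, neg_neg])
  have b1 : -P + Q ≠ P := by
    intro h
    apply hQP.2
    rw [← h3P]
    rw [neg_add_eq_iff_eq_add] at h
    exact h
  have b2 : -P + Q ≠ -P := fun h => hQ (add_eq_left.1 h)
  have b3 : -P + Q ≠ Q := fun h => hP (neg_eq_zero.1 (add_eq_right.1 h))
  have b4 : -P + Q ≠ -Q := by
    intro h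
    rw [← hQ2] at h
    exact hQP.2 (add_right_cancel h).symm
  have hne : pointX (P + Q).1 ≠ pointX (-P + Q).1 := by
    rw [Ne, tors_pointX_eq_iff a0 b0, not_or]
    refine ⟨fun h => hPN (add_right_cancel h), fun h => hQ ?_⟩
    have h5 : P + Q + (-P + Q) = 0 := by rw [h]; abel
    have h6 : Q + Q = 0 := by rw [← h5]; abel
    rw [hQ2] at h6
    exact neg_eq_zero.1 h6
  rcases hr _ a0 a1 a2 a3 a4 with h1 | h1 <;> rcases hr _ b0 b1 b2 b3 b4 with h2 | h2
  · exact absurd (h1.trans h2.symm) hne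
  · exact main P hP hPx h3P hQP.1 hQP.2 h1 h2
  -- Replacing `P` by `-P` exchanges `X 1` and `X 2` and preserves `x₁` and `X 0`.
  · refine main (-P) (neg_ne_zero.2 hP) ?_ ?_ hQP.2 (by rw [neg_neg]; exact hQP.1) h2
      (by rw [neg_neg]; exact h1)
    · rw [← hPx, tors_pointX_eq_iff (neg_ne_zero.2 hP) hP]
      exact Or.inr rfl
    · rw [← neg_add, h3P]
  · exact absurd (h1.trans h2.symm) hne

theorem exists_basis_three {x₁ : Qbar} {X : ZMod 3 → Qbar} (hX : (E⁄Qbar).IsThreeRoots x₁ X)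
    (hX₁ : ∀ k, X k ≠ x₁) : ∃ b : Module.Basis (Fin 2) (ZMod 3) (Tors E 3),
      torsX b ![1, 0] = x₁ ∧ ∀ k, torsX b ![k, 1] = X k := by
  obtain ⟨P, Q, hP, hPx, hPQ⟩ := exists_points_three hX hX₁
  have hm : ∀ a : ZMod 3, a = 0 ∨ a = 1 ∨ a = -1 := by decide
  have hli : LinearIndependent (ZMod 3) ![P, Q] := by
    rw [LinearIndependent.pair_iff]
    intro s t hst
    have key : ∀ a : ZMod 3, a • P + Q = 0 → False := fun a h => (hPQ a).1 h
    rcases hm t with rfl | rfl | rfl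
    · rw [zero_smul, add_zero] at hst
      refine ⟨?_, rfl⟩
      rcases hm s with rfl | rfl | rfl
      · rfl
      · rw [one_smul] at hst
        exact absurd hst hP
      · rw [neg_smul, one_smul, neg_eq_zero] at hst
        exact absurd hst hP
    · rw [one_smul] at hst
      exact (key _ hst).elim
    · refine (key (-s) ?_).elim
      rw [neg_smul, one_smul] at hst
      rw [neg_smul, ← neg_eq_zero, ← hst]
      abel
  have hsp : ⊤ ≤ Submodule.span (ZMod 3) (Set.range ![P, Q]) := by
    intro R _
    rw [Matrix.range_cons, Matrix.range_cons, Matrix.range_empty, Set.union_empty,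
      Set.singleton_union, Submodule.mem_span_pair]
    by_cases hR : R = 0
    · exact ⟨0, 0, by rw [hR, zero_smul, zero_smul, zero_add]⟩
    have h := (mem_tors_three_iff (fun h => hR (Subtype.ext h))).1 R.2
    rcases hX.psiThree_eq_zero_iff.1 h with h | ⟨k, hk⟩
    · rw [← hPx, tors_pointX_eq_iff hR hP] at h
      rcases h with rfl | rfl
      · exact ⟨1, 0, by rw [one_smul, zero_smul, add_zero]⟩
      · exact ⟨-1, 0, by rw [neg_smul, one_smul, zero_smul, add_zero]⟩
    · rw [← (hPQ k).2, tors_pointX_eq_iff hR (hPQ k).1] at hk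
      rcases hk with rfl | rfl
      · exact ⟨k, 1, by rw [one_smul]⟩
      · exact ⟨-k, -1, by rw [neg_smul, neg_smul, one_smul, neg_add]⟩
  refine ⟨Module.Basis.mk hli hsp, ?_, fun k => ?_⟩
  · rw [torsX, torsPoint, Module.Basis.equivFun_symm_apply, ← hPx]
    simp [Fin.sum_univ_two]
  · rw [torsX, torsPoint, Module.Basis.equivFun_symm_apply, ← (hPQ k).2]
    simp [Fin.sum_univ_two]

theorem exists_basis_vecTwo {e : ZMod 3 → Qbar} (he : (E⁄Qbar).IsTwoRoots e) :
    ∃ b : Module.Basis (Fin 2) (ZMod 2) (Tors E 2), ∀ k, torsX b (vecTwo k) = e k := by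
  obtain ⟨P, hP, hPx⟩ := exists_tors_two_pointX (he.psiTwoSq_eq_zero_iff.2 ⟨0, rfl⟩)
  obtain ⟨Q, hQ, hQx⟩ := exists_tors_two_pointX (he.psiTwoSq_eq_zero_iff.2 ⟨1, rfl⟩)
  have hneg : ∀ R : Tors E 2, -R = R := by
    intro R
    have : (2 : ℕ) • R = 0 := by
      have := R.2
      rw [AddSubgroup.torsionBy.nsmul_iff] at this
      exact Subtype.ext this
    rw [neg_eq_iff_add_eq_zero, ← two_nsmul, this]
  have hiff : ∀ {R S : Tors E 2}, R ≠ 0 → S ≠ 0 → (pointX R.1 = pointX S.1 ↔ R = S) := by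
    intro R S hR hS
    rw [tors_pointX_eq_iff hR hS, hneg, or_self]
  have hPQ : P ≠ Q := by
    rw [Ne, ← hiff hP hQ, hPx, hQx]
    exact he.1.ne (by decide)
  have hPQ0 : P + Q ≠ 0 := by
    intro h
    rw [add_eq_zero_iff_eq_neg, hneg] at h
    exact hPQ h
  have k3 : ∀ k : ZMod 3, k = 0 ∨ k = 1 ∨ k = 2 := by decide
  have hcl : ∀ R : Tors E 2, R ≠ 0 → R = P ∨ R = Q ∨ pointX R.1 = e 2 := by
    intro R hR
    have h := (mem_tors_two_iff (fun h => hR (Subtype.ext h))).1 R.2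
    obtain ⟨k, hk⟩ := he.psiTwoSq_eq_zero_iff.1 h
    rcases k3 k with rfl | rfl | rfl
    · rw [← hPx, hiff hR hP] at hk
      exact Or.inl hk
    · rw [← hQx, hiff hR hQ] at hk
      exact Or.inr (Or.inl hk)
    · exact Or.inr (Or.inr hk)
  have hPQx : pointX (P + Q).1 = e 2 := by
    rcases hcl _ hPQ0 with h | h | h
    · exact absurd (add_eq_left.1 h) hQ
    · exact absurd (add_eq_right.1 h) hP
    · exact h
  have hm : ∀ a : ZMod 2, a = 0 ∨ a = 1 := by decide
  have hli : LinearIndependent (ZMod 2) ![P, Q] := by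
    rw [LinearIndependent.pair_iff]
    intro s t hst
    rcases hm s with rfl | rfl <;> rcases hm t with rfl | rfl
    · exact ⟨rfl, rfl⟩
    · rw [zero_smul, one_smul, zero_add] at hst
      exact absurd hst hQ
    · rw [zero_smul, one_smul, add_zero] at hst
      exact absurd hst hP
    · rw [one_smul, one_smul] at hst
      exact absurd hst hPQ0
  have hsp : ⊤ ≤ Submodule.span (ZMod 2) (Set.range ![P, Q]) := by
    intro R _
    rw [Matrix.range_cons, Matrix.range_cons, Matrix.range_empty, Set.union_empty,
      Set.singleton_union, Submodule.mem_span_pair]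
    by_cases hR : R = 0
    · exact ⟨0, 0, by rw [hR, zero_smul, zero_smul, zero_add]⟩
    rcases hcl R hR with rfl | rfl | h
    · exact ⟨1, 0, by rw [one_smul, zero_smul, add_zero]⟩
    · exact ⟨0, 1, by rw [one_smul, zero_smul, zero_add]⟩
    · rw [← hPQx, hiff hR hPQ0] at h
      exact ⟨1, 1, by rw [one_smul, one_smul, h]⟩
  refine ⟨Module.Basis.mk hli hsp, fun k => ?_⟩
  rw [torsX, torsPoint, Module.Basis.equivFun_symm_apply]
  rcases k3 k with rfl | rfl | rfl
  · rw [← hPx]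
    simp [Fin.sum_univ_two, vecTwo]
  · rw [← hQx]
    simp [Fin.sum_univ_two, vecTwo]
  · rw [← hPQx]
    have h2 : (2 : ZMod 3) ≠ 0 := by decide
    have h2' : (2 : ZMod 3) ≠ 1 := by decide
    simp [Fin.sum_univ_two, vecTwo, h2, h2']

/-- The matrix that maps `vecTwo` to `v`. -/
def vecTwoMatrix (v : ZMod 3 → (Fin 2 → ZMod 2)) : Matrix (Fin 2) (Fin 2) (ZMod 2) :=
  !![v 0 0, v 1 0; v 0 1, v 1 1]

set_option synthInstance.maxHeartbeats 200000 in
set_option synthInstance.maxSize 1000 in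
theorem vecTwoMatrix_spec {v : ZMod 3 → (Fin 2 → ZMod 2)} (hv : Function.Injective v)
    (hv0 : ∀ k, v k ≠ 0) : (vecTwoMatrix v).adjugate * vecTwoMatrix v = 1 ∧
      vecTwoMatrix v * (vecTwoMatrix v).adjugate = 1 ∧
      ∀ k, (vecTwoMatrix v).mulVec (vecTwo k) = v k := by
  have key : ∀ w₀ w₁ w₂ : Fin 2 → ZMod 2, w₀ ≠ w₁ → w₀ ≠ w₂ → w₁ ≠ w₂ → w₀ ≠ 0 → w₁ ≠ 0 → w₂ ≠ 0 →
      !![w₁ 1, -w₁ 0; -w₀ 1, w₀ 0] * !![w₀ 0, w₁ 0; w₀ 1, w₁ 1] = 1 ∧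
      !![w₀ 0, w₁ 0; w₀ 1, w₁ 1] * !![w₁ 1, -w₁ 0; -w₀ 1, w₀ 0] = 1 ∧
      !![w₀ 0, w₁ 0; w₀ 1, w₁ 1].mulVec (vecTwo 0) = w₀ ∧
      !![w₀ 0, w₁ 0; w₀ 1, w₁ 1].mulVec (vecTwo 1) = w₁ ∧
      !![w₀ 0, w₁ 0; w₀ 1, w₁ 1].mulVec (vecTwo 2) = w₂ := by decide
  obtain ⟨h1, h2, h3, h4, h5⟩ := key (v 0) (v 1) (v 2) (hv.ne (by decide)) (hv.ne (by decide))
    (hv.ne (by decide)) (hv0 0) (hv0 1) (hv0 2)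
  have ha : (vecTwoMatrix v).adjugate = !![v 1 1, -v 1 0; -v 0 1, v 0 0] := by
    rw [vecTwoMatrix, Matrix.adjugate_fin_two_of]
  refine ⟨ha ▸ h1, ha ▸ h2, fun k => ?_⟩
  have k3 : ∀ k : ZMod 3, k = 0 ∨ k = 1 ∨ k = 2 := by decide
  rcases k3 k with rfl | rfl | rfl
  · exact h3
  · exact h4
  · exact h5

theorem matrix_two_ext {v : ZMod 3 → (Fin 2 → ZMod 2)} (hv : Function.Injective v)
    (hv0 : ∀ k, v k ≠ 0) {M N : Matrix (Fin 2) (Fin 2) (ZMod 2)}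
    (h : ∀ k, M.mulVec (v k) = N.mulVec (v k)) : M = N := by
  obtain ⟨h1, h2, h3⟩ := vecTwoMatrix_spec hv hv0
  have : M * vecTwoMatrix v = N * vecTwoMatrix v := by
    apply matrix_two_ext_vecTwo
    intro k
    rw [← Matrix.mulVec_mulVec, ← Matrix.mulVec_mulVec, h3, h]
  rw [← mul_one M, ← h2, ← mul_assoc, this, mul_assoc, h2, mul_one]

theorem exists_basis_two {e : ZMod 3 → Qbar} (he : (E⁄Qbar).IsTwoRoots e)
    {v : ZMod 3 → (Fin 2 → ZMod 2)} (hv : Function.Injective v) (hv0 : ∀ k, v k ≠ 0) :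
    ∃ b : Module.Basis (Fin 2) (ZMod 2) (Tors E 2), ∀ k, torsX b (v k) = e k := by
  obtain ⟨b, hb⟩ := exists_basis_vecTwo he
  obtain ⟨h1, h2, h3⟩ := vecTwoMatrix_spec hv hv0
  let L : (Fin 2 → ZMod 2) ≃ₗ[ZMod 2] (Fin 2 → ZMod 2) := Matrix.toLin'OfInv h1 h2
  refine ⟨Module.Basis.ofEquivFun (b.equivFun.trans L), fun k => ?_⟩
  rw [← hb, torsX, torsX]
  congr 2
  rw [torsPoint, torsPoint, Module.Basis.equivFun_ofEquivFun, LinearEquiv.trans_symm,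
    LinearEquiv.trans_apply]
  congr 1
  rw [LinearEquiv.symm_apply_eq, ← h3]
  exact (Matrix.toLin'_apply _ _).symm

/-- Choose bases in which line `k` of `E[3]` has `x`-coordinate `X k` and `v k` has `x`-coordinate
`e k`. Rationality of `x₁` makes the mod 3 matrices triangular, and the compatibility of the
permutations identifies the mod 2 matrix with `θ` of the mod 3 matrix. -/
theorem exists_bases_of_isThreeRoots {θ : borel3 →* GL (Fin 2) (ZMod 2)}
    (hθ : Function.Surjective θ) {x₁ : ℚ} {X e : ZMod 3 → Qbar}
    (hX : (E⁄Qbar).IsThreeRoots (algebraMap ℚ Qbar x₁) X)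
    (hX₁ : ∀ k, X k ≠ algebraMap ℚ Qbar x₁) (he : (E⁄Qbar).IsTwoRoots e)
    (hσ : ∀ (σ : GQ) (k l : ZMod 3), σ (X k) = X l → σ (e k) = e l) :
    ∃ (b₂ : Module.Basis (Fin 2) (ZMod 2) (Tors E 2))
      (b₃ : Module.Basis (Fin 2) (ZMod 3) (Tors E 3)),
      ((galRep E 2 b₂).prod (galRep E 3 b₃)).range ≤ graphSubgroup θ ∧
        torsX b₃ ![1, 0] = algebraMap ℚ Qbar x₁ := by
  obtain ⟨v, hv, hv0, hθv⟩ := exists_equivariant_of_surjective hθ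
  obtain ⟨b₃, hb₃, hb₃'⟩ := exists_basis_three hX hX₁
  obtain ⟨b₂, hb₂⟩ := exists_basis_two he hv hv0
  refine ⟨b₂, b₃, ?_, hb₃⟩
  rintro _ ⟨σ, rfl⟩
  have hmem : galRep E 3 b₃ σ ∈ borel3 := by
    have h1 : σ (torsX b₃ ![1, 0]) = torsX b₃ ![1, 0] := by rw [hb₃, AlgEquiv.commutes]
    have hne1 : (![1, 0] : Fin 2 → ZMod 3) ≠ 0 := by decide
    rw [map_torsX, torsX_eq_iff b₃ _ hne1] at h1
    · rcases h1 with h1 | h1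
      · have := congrFun h1 1
        have h3 : galRep E 3 b₃ σ 1 0 = 0 := by
          simpa [Matrix.mulVec, dotProduct, Fin.sum_univ_two] using this
        exact h3
      · have := congrFun h1 1
        have h3 : galRep E 3 b₃ σ 1 0 = 0 := by
          simpa [Matrix.mulVec, dotProduct, Fin.sum_univ_two] using this
        exact h3
    · intro h
      apply hne1
      have h2 := congrArg ((galRep E 3 b₃ σ)⁻¹.1.mulVec) h
      rwa [Matrix.mulVec_mulVec, ← Units.val_mul, inv_mul_cancel, Units.val_one, Matrix.one_mulVec,
        Matrix.mulVec_zero] at h2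
  refine ⟨⟨_, hmem⟩, Prod.ext ?_ rfl⟩
  change θ ⟨_, hmem⟩ = galRep E 2 b₂ σ
  apply Units.ext
  apply matrix_two_ext hv hv0
  intro k
  rw [hθv]
  have h2 : σ (X k) = X (borelAct (galRep E 3 b₃ σ) k) := by
    rw [← hb₃', map_torsX, torsX_mulVec b₃ hmem, hb₃']
  have h3 := hσ σ _ _ h2
  rw [← hb₂, ← hb₂, map_torsX, torsX_two_eq_iff b₂ _ (hv0 _)] at h3
  · exact h3.symm
  · intro h
    apply hv0 k
    have h2 := congrArg ((galRep E 2 b₂ σ)⁻¹.1.mulVec) h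
    rw [Matrix.mulVec_mulVec, ← Units.val_mul, inv_mul_cancel] at h2
    simpa using h2

theorem compositeImageConjLE_iff {θ : borel3 →* GL (Fin 2) (ZMod 2)}
    (hθ : Function.Surjective θ) : CompositeImageConjLE E (graphSubgroup θ) ↔ IsLevelSix E := by
  constructor
  · rintro ⟨b₂, b₃, h⟩
    exact isLevelSix_of_range_le h hθ
  · rintro ⟨x₁, X, e, hX, hX₁, he, hσ⟩
    obtain ⟨b₂, b₃, h, -⟩ := exists_bases_of_isThreeRoots hθ hX hX₁ he hσ
    exact ⟨b₂, b₃, h⟩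

end Bases

end WeierstrassCurve

/-! ### The size of the images, and the intersection of the division fields. -/

theorem IntermediateField.mem_fixingSubgroup_adjoin_iff {S : Set Qbar} {σ : GQ} :
    σ ∈ (IntermediateField.adjoin ℚ S).fixingSubgroup ↔ ∀ x ∈ S, σ x = x := by
  constructor
  · intro h x hx
    exact (IntermediateField.mem_fixingSubgroup_iff _ _).1 h x
      (IntermediateField.subset_adjoin ℚ S hx)
  · intro h
    rw [← Subgroup.zpowers_le, ← IntermediateField.le_iff_le, IntermediateField.adjoin_le_iff]
    intro x hx
    rw [SetLike.mem_coe, IntermediateField.mem_fixedField_iff]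
    intro f hf
    have hle : Subgroup.zpowers σ ≤ MulAction.stabilizer GQ x :=
      Subgroup.zpowers_le.2 (h x hx)
    exact hle hf

theorem IntermediateField.adjoin_eq_fixedField {S : Set Qbar} {K : Subgroup GQ}
    (h : ∀ σ, σ ∈ K ↔ ∀ x ∈ S, σ x = x) :
    IntermediateField.adjoin ℚ S = IntermediateField.fixedField K := by
  have : K = (IntermediateField.adjoin ℚ S).fixingSubgroup := by
    ext σ
    rw [h, mem_fixingSubgroup_adjoin_iff]
  rw [this, InfiniteGalois.fixedField_fixingSubgroup]

/-- `g⁴ + 8g³ + 8g - 8` has no rational root, as it has none modulo 5. -/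
theorem Rat.quartic_ne_zero (g : ℚ) : g ^ 4 + 8 * g ^ 3 + 8 * g - 8 ≠ 0 := by
  intro h
  have hq : (g.den : ℚ) ≠ 0 := by exact_mod_cast g.den_nz
  have hg : g = g.num / g.den := (Rat.num_div_den g).symm
  rw [hg] at h
  field_simp at h
  have hz : g.num ^ 4 + 8 * g.num ^ 3 * g.den + 8 * g.num * g.den ^ 3 - 8 * (g.den : ℤ) ^ 4 = 0 := by
    have : ((g.num ^ 4 + 8 * g.num ^ 3 * g.den + 8 * g.num * g.den ^ 3 - 8 * (g.den : ℤ) ^ 4 : ℤ) :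
        ℚ) = 0 := by
      push_cast
      linear_combination h
    exact_mod_cast this
  have h5 := congrArg (Int.cast : ℤ → ZMod 5) hz
  push_cast at h5
  have key : ∀ p q : ZMod 5, p ^ 4 + 8 * p ^ 3 * q + 8 * p * q ^ 3 - 8 * q ^ 4 = 0 →
      p = 0 ∧ q = 0 := by decide
  obtain ⟨h1, h2⟩ := key _ _ h5
  have hp : (5 : ℤ) ∣ g.num := (ZMod.intCast_zmod_eq_zero_iff_dvd g.num 5).1 h1
  have hd : 5 ∣ g.den := (ZMod.natCast_eq_zero_iff g.den 5).1 h2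
  have hc := g.reduced
  have := Nat.dvd_gcd (Int.natAbs_dvd_natAbs.2 hp) hd
  rw [hc] at this
  norm_num at this

namespace WeierstrassCurve

variable {E : WeierstrassCurve ℚ}

/-- If `Δ = g³`, then `j` is the cube of `x = c₄ / g`, and the formula in `s` gives a rational point
on `Y² = X³ + 1` with `X = -x/12`. -/
theorem Δ_ne_cube_of_s_t [E.IsElliptic] (hc₄ : E.c₄ ≠ 0) (hc₆ : E.c₆ ≠ 0) {s t : ℚ} (ht : t ≠ 0)
    (hs : E.j = 2 ^ 10 * 3 ^ 3 * s ^ 3 * (1 - 4 * s ^ 3))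
    (htj : E.j = 27 * (t + 1) * (t + 9) ^ 3 / t ^ 3) (g : ℚ) : g ^ 3 ≠ E.Δ := by
  intro hg
  have hΔ : E.Δ ≠ 0 := E.isUnit_Δ.ne_zero
  have hg0 : g ≠ 0 := by
    rintro rfl
    apply hΔ
    rw [← hg]
    norm_num
  obtain ⟨x, hx⟩ : ∃ x, x = E.c₄ / g := ⟨_, rfl⟩
  have hj : E.j = x ^ 3 := by rw [j_eq_div, hx, div_pow, hg]
  have hcx : E.c₄ = x * g := by rw [hx]; field_simp
  have hsq : (-x / 12) ^ 3 + 1 = (1 - 8 * s ^ 3) ^ 2 := by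
    rw [hj] at hs
    linear_combination (-1 / 1728) * hs
  have hrel := E.c_relation
  rcases Rat.eq_of_cube_add_one_eq_sq hsq with h | h | h
  · have hx' : x = 12 := by linarith
    apply hc₆
    have h0 : E.c₆ ^ 2 = 0 := by
      rw [hcx, hx', ← hg] at hrel
      linear_combination hrel
    exact (pow_eq_zero_iff two_ne_zero).1 h0
  · apply hc₄
    have hx' : x = 0 := by linarith
    rw [hcx, hx', zero_mul]
  · have hx' : x = -24 := by linarith
    rw [hj, hx'] at htj
    have ht9 : t + 9 ≠ 0 := by
      intro h0
      rw [h0] at htj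
      norm_num at htj
    rw [eq_div_iff (pow_ne_zero 3 ht)] at htj
    -- For `j = (-24)³` the formula in `t` reads `t + 1 = (-8t/(t + 9))³`; eliminating `t` leaves a
    -- quartic in `u`.
    obtain ⟨u, hu⟩ : ∃ u, u = -8 * t / (t + 9) := ⟨_, rfl⟩
    have hu1 : u * (t + 9) = -8 * t := by rw [hu]; field_simp
    have hu3 : u ^ 3 = t + 1 := by
      have : (u ^ 3 - (t + 1)) * (t + 9) ^ 3 = 0 := by
        have h3 : (u * (t + 9)) ^ 3 = (-8 * t) ^ 3 := by rw [hu1]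
        linear_combination h3 + htj / 27
      exact sub_eq_zero.1 ((mul_eq_zero.1 this).resolve_right (pow_ne_zero 3 ht9))
    refine Rat.quartic_ne_zero u ?_
    have ht' : t = u ^ 3 - 1 := by linarith
    rw [ht'] at hu1
    linear_combination hu1

section Graph

variable [E.IsElliptic] {θ : borel3 →* GL (Fin 2) (ZMod 2)}
  {b₂ : Module.Basis (Fin 2) (ZMod 2) (Tors E 2)} {b₃ : Module.Basis (Fin 2) (ZMod 3) (Tors E 3)}
  (h : ((galRep E 2 b₂).prod (galRep E 3 b₃)).range ≤ graphSubgroup θ)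

/-- The cube roots of the discriminant. -/
def discCubeRoot (b₃ : Module.Basis (Fin 2) (ZMod 3) (Tors E 3)) (k : ZMod 3) : Qbar :=
  (E⁄Qbar).cubeRootΔ (torsX b₃ ![1, 0]) (torsX b₃ ![k, 1])

/-- A square root of `-27 Δ²`. -/
def discRoot (b₃ : Module.Basis (Fin 2) (ZMod 3) (Tors E 3)) : Qbar :=
  (discCubeRoot b₃ 0 - discCubeRoot b₃ 1) * (discCubeRoot b₃ 1 - discCubeRoot b₃ 2) *
    (discCubeRoot b₃ 2 - discCubeRoot b₃ 0)

theorem discCubeRoot_injective : Function.Injective (discCubeRoot b₃) :=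
  (isThreeRoots_torsX b₃).cubeRootΔ_injective E.Δ_Qbar_ne_zero

theorem discCubeRoot_pow (k : ZMod 3) : discCubeRoot b₃ k ^ 3 = algebraMap ℚ Qbar E.Δ := by
  rw [← Δ_Qbar]
  exact (isThreeRoots_torsX b₃).cubeRootΔ_pow_three k

theorem discCubeRoot_ne_zero (k : ZMod 3) : discCubeRoot b₃ k ≠ 0 := by
  intro h
  have := discCubeRoot_pow (b₃ := b₃) k
  rw [h, ← Δ_Qbar] at this
  exact E.Δ_Qbar_ne_zero (by rw [← this]; norm_num)

theorem pow_three_eq_Δ_iff {z : Qbar} :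
    z ^ 3 = algebraMap ℚ Qbar E.Δ ↔ ∃ k, z = discCubeRoot b₃ k := by
  constructor
  · intro hz
    obtain ⟨r1, r2, r3⟩ := (isThreeRoots_torsX b₃).cubeRootΔ_relations
    change discCubeRoot b₃ 0 + discCubeRoot b₃ 1 + discCubeRoot b₃ 2 = 0 at r1
    change discCubeRoot b₃ 0 * discCubeRoot b₃ 1 + discCubeRoot b₃ 0 * discCubeRoot b₃ 2 +
      discCubeRoot b₃ 1 * discCubeRoot b₃ 2 = 0 at r2
    change discCubeRoot b₃ 0 * discCubeRoot b₃ 1 * discCubeRoot b₃ 2 = (E⁄Qbar).Δ at r3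
    rw [Δ_Qbar] at r3
    have : (z - discCubeRoot b₃ 0) * (z - discCubeRoot b₃ 1) * (z - discCubeRoot b₃ 2) = 0 := by
      linear_combination hz - z ^ 2 * r1 + z * r2 - r3
    rcases mul_eq_zero.1 this with h | h
    · rcases mul_eq_zero.1 h with h | h
      · exact ⟨0, sub_eq_zero.1 h⟩
      · exact ⟨1, sub_eq_zero.1 h⟩
    · exact ⟨2, sub_eq_zero.1 h⟩
  · rintro ⟨k, rfl⟩
    exact discCubeRoot_pow k

theorem discRoot_sq : discRoot b₃ ^ 2 = -27 * algebraMap ℚ Qbar E.Δ ^ 2 := by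
  obtain ⟨r1, r2, r3⟩ := (isThreeRoots_torsX b₃).cubeRootΔ_relations
  change discCubeRoot b₃ 0 + discCubeRoot b₃ 1 + discCubeRoot b₃ 2 = 0 at r1
  change discCubeRoot b₃ 0 * discCubeRoot b₃ 1 + discCubeRoot b₃ 0 * discCubeRoot b₃ 2 +
    discCubeRoot b₃ 1 * discCubeRoot b₃ 2 = 0 at r2
  change discCubeRoot b₃ 0 * discCubeRoot b₃ 1 * discCubeRoot b₃ 2 = (E⁄Qbar).Δ at r3
  rw [Δ_Qbar] at r3
  rw [discRoot]
  set x := discCubeRoot b₃ 0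
  set y := discCubeRoot b₃ 1
  set z := discCubeRoot b₃ 2
  linear_combination ((x + y + z) * (x * y + x * z + y * z) ^ 2 -
    4 * (x + y + z) ^ 2 * (x * y * z) + 18 * (x * y + x * z + y * z) * (x * y * z)) * r1 -
    4 * (x * y + x * z + y * z) ^ 2 * r2 - 27 * (x * y * z + algebraMap ℚ Qbar E.Δ) * r3

include h

omit [E.IsElliptic] in
theorem map_discCubeRoot (σ : GQ) (k : ZMod 3) :
    σ (discCubeRoot b₃ k) = discCubeRoot b₃ (borelAct (galRep E 3 b₃ σ) k) := by
  obtain ⟨x₁, hx₁⟩ := exists_torsX_eq_algebraMap h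
  rw [discCubeRoot, ← hx₁, map_cubeRootΔ, hx₁, map_torsX_three h]
  rfl

omit [E.IsElliptic] in
-- A Vandermonde product changes by the sign of the permutation, and `k ↦ (ad) k + bd` is even
-- exactly when `ad = 1`.
theorem map_discRoot (σ : GQ) :
    (galRep E 3 b₃ σ 0 0 * galRep E 3 b₃ σ 1 1 = 1 ∧ σ (discRoot b₃) = discRoot b₃) ∨
    (galRep E 3 b₃ σ 0 0 * galRep E 3 b₃ σ 1 1 = -1 ∧ σ (discRoot b₃) = -discRoot b₃) := by
  obtain ⟨hσ, -⟩ := galRep_mem_borel3 h σ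
  have key : ∀ a d : ZMod 3, a ≠ 0 → d ≠ 0 → a * d = 1 ∨ a * d = -1 := by decide
  have h3 : ∀ a : ZMod 3, a = 0 ∨ a = 1 ∨ a = 2 := by decide
  have z1 : (1 : ZMod 3) + 1 = 2 := by decide
  have z2 : (1 : ZMod 3) + 2 = 0 := by decide
  have z3 : (2 : ZMod 3) + 1 = 0 := by decide
  have z4 : (2 : ZMod 3) + 2 = 1 := by decide
  have z5 : (-1 : ZMod 3) = 2 := by decide
  have z6 : (2 : ZMod 3) * 2 = 1 := by decide
  rcases key _ _ (borel3_diag_ne_zero ⟨_, hσ⟩).1 (borel3_diag_ne_zero ⟨_, hσ⟩).2 with had | had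
  · refine Or.inl ⟨had, ?_⟩
    simp only [discRoot, map_mul, map_sub, map_discCubeRoot h, borelAct_eq]
    have had' : galRep E 3 b₃ σ 0 0 * galRep E 3 b₃ σ 1 1 = 1 := had
    rw [had']
    rcases h3 (galRep E 3 b₃ σ 0 1 * galRep E 3 b₃ σ 1 1) with hb | hb | hb <;> rw [hb] <;>
      simp only [mul_zero, mul_one, one_mul, zero_add, add_zero, z1, z2, z3, z4] <;> ring
  · refine Or.inr ⟨had, ?_⟩
    simp only [discRoot, map_mul, map_sub, map_discCubeRoot h, borelAct_eq]
    have had' : galRep E 3 b₃ σ 0 0 * galRep E 3 b₃ σ 1 1 = -1 := had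
    rw [had', z5]
    rcases h3 (galRep E 3 b₃ σ 0 1 * galRep E 3 b₃ σ 1 1) with hb | hb | hb <;> rw [hb] <;>
      simp only [mul_zero, mul_one, zero_add, add_zero, z1, z2, z3, z4, z6] <;> ring

/-- Otherwise `discRoot` would be rational, with negative square `-27 Δ²`. -/
theorem exists_reflection : ∃ g ∈ (galRep E 3 b₃).range, g 0 0 * g 1 1 = -1 := by
  by_contra hcon
  push Not at hcon
  have hfix : ∀ σ : GQ, σ (discRoot b₃) = discRoot b₃ := by
    intro σ
    rcases map_discRoot h σ with h | h
    · exact h.2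
    · exact absurd h.1 (hcon _ ⟨σ, rfl⟩)
  obtain ⟨q, hq⟩ := exists_algebraMap_eq_of_fixed hfix
  have hsq := discRoot_sq (b₃ := b₃)
  rw [← hq] at hsq
  have hsq' : q ^ 2 = -27 * E.Δ ^ 2 := by
    apply (algebraMap ℚ Qbar).injective
    rw [map_pow, hsq, map_mul, map_neg, map_ofNat, map_pow]
  have hΔ : 0 < E.Δ ^ 2 := by
    have := E.isUnit_Δ.ne_zero
    positivity
  nlinarith [sq_nonneg q]

variable (hΔ : ∀ g : ℚ, g ^ 3 ≠ E.Δ)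
include hΔ

theorem exists_borelAct_ne (k : ZMod 3) : ∃ g ∈ (galRep E 3 b₃).range, borelAct g k ≠ k := by
  by_contra hcon
  push Not at hcon
  have hfix : ∀ σ : GQ, σ (discCubeRoot b₃ k) = discCubeRoot b₃ k := by
    intro σ
    rw [map_discCubeRoot h, hcon _ ⟨σ, rfl⟩]
  obtain ⟨q, hq⟩ := exists_algebraMap_eq_of_fixed hfix
  apply hΔ q
  apply (algebraMap ℚ Qbar).injective
  rw [map_pow, hq, discCubeRoot_pow]

theorem range_le_borel3_and_surjective : (galRep E 3 b₃).range ≤ borel3 ∧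
    ∀ g : borel3, ∃ g' ∈ (galRep E 3 b₃).range, ∀ k, borelAct g' k = borelAct g.1 k := by
  have hle : (galRep E 3 b₃).range ≤ borel3 := by
    rintro _ ⟨σ, rfl⟩
    exact (galRep_mem_borel3 h σ).1
  exact ⟨hle, exists_borelAct_eq hle (exists_reflection h) (exists_borelAct_ne h hΔ)⟩

variable (hθ : Function.Surjective θ)
include hθ

theorem galRep_two_surjective : Function.Surjective (galRep E 2 b₂) := by
  obtain ⟨v, hv, hv0, hθv⟩ := exists_equivariant_of_surjective hθ
  intro m
  obtain ⟨g, rfl⟩ := hθ m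
  obtain ⟨_, ⟨σ, rfl⟩, hg⟩ := (range_le_borel3_and_surjective h hΔ).2 g
  refine ⟨σ, ?_⟩
  obtain ⟨hσ, e⟩ := galRep_mem_borel3 h σ
  rw [← e]
  apply Units.ext
  apply matrix_two_ext hv hv0
  intro k
  rw [hθv, hθv, hg]

omit hΔ [E.IsElliptic] in
theorem mem_ker_galRepLin_two_iff (σ : GQ) : σ ∈ (galRepLin E 2).ker ↔
    ∀ k, borelAct (galRep E 3 b₃ σ) k = k := by
  obtain ⟨v, hv, hv0, hθv⟩ := exists_equivariant_of_surjective hθ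
  obtain ⟨hσ, e⟩ := galRep_mem_borel3 h σ
  rw [MonoidHom.mem_ker, ← galRep_eq_one_iff b₂, ← e]
  constructor
  · intro h1 k
    apply hv
    have := hθv ⟨_, hσ⟩ k
    rw [h1, Units.val_one, Matrix.one_mulVec] at this
    exact this.symm
  · intro h1
    apply Units.ext
    apply matrix_two_ext hv hv0
    intro k
    rw [hθv, h1, Units.val_one, Matrix.one_mulVec]

omit hΔ in
theorem mem_ker_galRepLin_two_iff_discCubeRoot (σ : GQ) : σ ∈ (galRepLin E 2).ker ↔
    ∀ k, σ (discCubeRoot b₃ k) = discCubeRoot b₃ k := by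
  rw [mem_ker_galRepLin_two_iff h hθ]
  refine forall_congr' fun k => ?_
  rw [map_discCubeRoot h, discCubeRoot_injective.eq_iff]

omit hΔ [E.IsElliptic] in
-- Both conditions say that `σ` fixes the three lines, the kernel of whose action is `{±1}`.
theorem mem_ker_galRepLin_two_iff_three (σ : GQ) : σ ∈ (galRepLin E 2).ker ↔
    galRepLin E 3 σ = 1 ∨ galRepLin E 3 σ = -1 := by
  obtain ⟨hσ, -⟩ := galRep_mem_borel3 h σ
  rw [mem_ker_galRepLin_two_iff h hθ, ← galRep_eq_one_iff b₃, ← galRep_eq_neg_one_iff b₃]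
  have h1 := borelAct_eq_iff (g := ⟨_, hσ⟩) (h := 1)
  have e1 : (∀ k, borelAct (galRep E 3 b₃ σ) k = k) ↔
      ∀ k, borelAct (⟨_, hσ⟩ : borel3).1 k = borelAct (1 : borel3).1 k :=
    forall_congr' fun k => by rw [OneMemClass.coe_one, borelAct_one]
  rw [e1, h1]
  refine or_congr ?_ ?_
  · rw [← Subtype.coe_inj]
    rfl
  · constructor
    · intro h2
      apply Units.ext
      ext i j
      exact h2 i j
    · intro h2 i j
      change galRep E 3 b₃ σ i j = _
      rw [h2]
      rfl

omit hΔ in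
-- A cube root of unity times a cube root of `Δ` is again a cube root of `Δ`, so fixing the latter
-- fixes `ζ₃`.
theorem mem_ker_galRepLin_two_iff_zeta (σ : GQ) : σ ∈ (galRepLin E 2).ker ↔
    ∀ x ∈ {z : Qbar | IsPrimitiveRoot z 3} ∪ {d : Qbar | d ^ 3 = algebraMap ℚ Qbar E.Δ},
      σ x = x := by
  rw [mem_ker_galRepLin_two_iff_discCubeRoot h hθ]
  constructor
  · intro h1 x hx
    have h2 : ∀ z, z ^ 3 = algebraMap ℚ Qbar E.Δ → σ z = z := by
      intro z hz
      obtain ⟨k, rfl⟩ := (pow_three_eq_Δ_iff (b₃ := b₃)).1 hz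
      exact h1 k
    rcases hx with hx | hx
    · have hx3 : x ^ 3 = 1 := IsPrimitiveRoot.pow_eq_one hx
      have h3 := h2 (x * discCubeRoot b₃ 0) (by rw [mul_pow, hx3, one_mul, discCubeRoot_pow])
      rw [map_mul, h1] at h3
      exact mul_right_cancel₀ (discCubeRoot_ne_zero 0) h3
    · exact h2 x hx
  · intro h1 k
    exact h1 _ (Or.inr (discCubeRoot_pow k))

omit hΔ in
theorem zetaCubeRootField_eq : zetaCubeRootField E = divisionField E 2 :=
  IntermediateField.adjoin_eq_fixedField (mem_ker_galRepLin_two_iff_zeta h hθ)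

omit hΔ in
theorem xDivisionField_eq : xDivisionField E 3 = divisionField E 2 := by
  refine IntermediateField.adjoin_eq_fixedField fun σ => ?_
  have hne : ∀ k : ZMod 3, (![k, 1] : Fin 2 → ZMod 3) ≠ 0 := by decide
  have hX := isThreeRoots_torsX b₃
  rw [mem_ker_galRepLin_two_iff h hθ]
  constructor
  · rintro h1 x ⟨y, hns, hmem⟩
    have h0 := (mem_tors_three_iff (Affine.Point.some_ne_zero hns)).1 hmem
    rcases hX.psiThree_eq_zero_iff.1 h0 with h2 | ⟨k, h2⟩
    · have h2' : x = _ := h2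
      obtain ⟨x₁, hx₁⟩ := exists_torsX_eq_algebraMap h
      rw [h2', ← hx₁, AlgEquiv.commutes]
    · have h2' : x = _ := h2
      rw [h2', map_torsX_three h, h1]
  · intro h1 k
    have hP := torsPoint_coe_ne_zero b₃ (hne k)
    obtain ⟨y, hns, he⟩ := exists_eq_some hP
    have h2 : σ (torsX b₃ ![k, 1]) = torsX b₃ ![k, 1] :=
      h1 _ ⟨y, hns, he ▸ (torsPoint b₃ ![k, 1]).2⟩
    rw [map_torsX_three h] at h2
    exact hX.1 h2

omit hΔ [E.IsElliptic] in
theorem divisionField_inf : divisionField E 2 ⊓ divisionField E 3 = divisionField E 2 := by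
  refine inf_eq_left.2 (IntermediateField.fixedField_antitone fun σ hσ => ?_)
  rw [mem_ker_galRepLin_two_iff_three h hθ]
  exact Or.inl hσ

omit hΔ [E.IsElliptic] in
theorem divisionField_two_eq_three (hneg : ∀ σ, galRepLin E 3 σ ≠ -1) :
    divisionField E 2 = divisionField E 3 := by
  have : (galRepLin E 2).ker = (galRepLin E 3).ker := by
    ext σ
    rw [mem_ker_galRepLin_two_iff_three h hθ, MonoidHom.mem_ker]
    exact or_iff_left (hneg σ)
  rw [divisionField, divisionField, this]

omit hΔ in
theorem fixingSubgroup_divisionField_two :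
    (divisionField E 2).fixingSubgroup = (galRepLin E 2).ker := by
  ext σ
  rw [← zetaCubeRootField_eq h hθ, zetaCubeRootField,
    IntermediateField.mem_fixingSubgroup_adjoin_iff, mem_ker_galRepLin_two_iff_zeta h hθ]

omit hΔ in
theorem isGalois_divisionField_two : IsGalois ℚ (divisionField E 2) := by
  have h1 := (InfiniteGalois.normal_iff_isGalois (divisionField E 2)).1 (by
    rw [fixingSubgroup_divisionField_two h hθ]
    infer_instance)
  convert h1
  exact Subsingleton.elim _ _

theorem exists_not_commute : ∃ σ τ : divisionField E 2 ≃ₐ[ℚ] divisionField E 2,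
    σ * τ ≠ τ * σ := by
  have := isGalois_divisionField_two h hθ
  have hsurj := galRep_two_surjective h hΔ hθ
  obtain ⟨σ, hσ⟩ := hsurj ⟨!![1, 1; 0, 1], !![1, 1; 0, 1], by decide, by decide⟩
  obtain ⟨τ, hτ⟩ := hsurj ⟨!![1, 0; 1, 1], !![1, 0; 1, 1], by decide, by decide⟩
  refine ⟨AlgEquiv.restrictNormalHom (divisionField E 2) σ,
    AlgEquiv.restrictNormalHom (divisionField E 2) τ, fun hc => ?_⟩
  rw [← map_mul, ← map_mul] at hc
  have hker : (τ * σ)⁻¹ * (σ * τ) ∈ (galRepLin E 2).ker := by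
    rw [← fixingSubgroup_divisionField_two h hθ, IntermediateField.mem_fixingSubgroup_iff]
    intro x hx
    rw [AlgEquiv.mul_apply]
    have h1 := AlgEquiv.restrictNormal_commutes (σ * τ) (divisionField E 2) ⟨x, hx⟩
    have h2 := AlgEquiv.restrictNormal_commutes (τ * σ) (divisionField E 2) ⟨x, hx⟩
    have h3 : (σ * τ) x = (τ * σ) x :=
      h1.symm.trans ((congrArg (fun f => algebraMap (divisionField E 2) Qbar (f ⟨x, hx⟩)) hc).trans h2)
    rw [h3]
    exact (τ * σ).symm_apply_apply x
  rw [MonoidHom.mem_ker, ← galRep_eq_one_iff b₂, map_mul, map_inv, inv_mul_eq_one, map_mul,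
    map_mul, hσ, hτ] at hker
  have hval := congrArg Units.val hker
  revert hval
  decide

end Graph

end WeierstrassCurve

/-! ### The criterion for non-CM curves, and curves with full image. -/

namespace WeierstrassCurve

section NonCM

variable {E : WeierstrassCurve ℚ} [E.IsElliptic] (hE : ¬ HasCM E)
include hE

theorem j_ne_zero_of_not_hasCM : E.j ≠ 0 := fun h => hE (hasCM_of_j_eq_zero E h)

theorem c₄_ne_zero_of_not_hasCM : E.c₄ ≠ 0 := fun h =>
  j_ne_zero_of_not_hasCM hE (by rw [j_eq_div, h]; norm_num)

theorem c₆_ne_zero_of_not_hasCM : E.c₆ ≠ 0 := fun h => hE (hasCM_of_c₆_eq_zero E h)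

theorem j_ne_1728_of_not_hasCM : E.j ≠ 1728 := by
  intro h
  apply c₆_ne_zero_of_not_hasCM hE
  rw [j_eq_div, div_eq_iff E.isUnit_Δ.ne_zero] at h
  have h0 : E.c₆ ^ 2 = 0 := by linear_combination h + E.c_relation
  exact (pow_eq_zero_iff two_ne_zero).1 h0

theorem compositeImageConjLE_iff_s_t {θ : borel3 →* GL (Fin 2) (ZMod 2)}
    (hθ : Function.Surjective θ) : CompositeImageConjLE E (graphSubgroup θ) ↔
      ∃ s t : ℚ, t ≠ 0 ∧ E.j = 2 ^ 10 * 3 ^ 3 * s ^ 3 * (1 - 4 * s ^ 3) ∧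
        E.j = 27 * (t + 1) * (t + 9) ^ 3 / t ^ 3 := by
  rw [compositeImageConjLE_iff hθ]
  constructor
  · exact fun h => h.exists_s_t (c₄_ne_zero_of_not_hasCM hE)
  · rintro ⟨s, t, ht, hs, htj⟩
    exact isLevelSix_of_s_t (c₄_ne_zero_of_not_hasCM hE) (c₆_ne_zero_of_not_hasCM hE) ht hs htj

theorem compositeImageConjLE_iff_v {θ : borel3 →* GL (Fin 2) (ZMod 2)}
    (hθ : Function.Surjective θ) : CompositeImageConjLE E (graphSubgroup θ) ↔
      ∃ v : ℚ, v ^ 3 + 1 ≠ 0 ∧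
        E.j = 27 * v ^ 3 * (v ^ 3 + 2) * (2 - v ^ 3) ^ 3 * (v ^ 3 + 4) ^ 3 / (v ^ 3 + 1) ^ 6 := by
  rw [compositeImageConjLE_iff_s_t hE hθ]
  constructor
  · rintro ⟨s, t, ht, hs, htj⟩
    exact levelSix_v_of_s_t (j_ne_zero_of_not_hasCM hE) (j_ne_1728_of_not_hasCM hE) ht hs htj
  · rintro ⟨v, hv, hj⟩
    obtain ⟨s, t, ht, hs, htj⟩ := levelSix_s_t_of_v hv
    exact ⟨s, t, ht, hj.trans hs, hj.trans htj⟩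

theorem Δ_ne_cube_of_compositeImageConjLE {θ : borel3 →* GL (Fin 2) (ZMod 2)}
    (hθ : Function.Surjective θ) (h : CompositeImageConjLE E (graphSubgroup θ)) (g : ℚ) :
    g ^ 3 ≠ E.Δ := by
  obtain ⟨s, t, ht, hs, htj⟩ := (compositeImageConjLE_iff_s_t hE hθ).1 h
  exact Δ_ne_cube_of_s_t (c₄_ne_zero_of_not_hasCM hE) (c₆_ne_zero_of_not_hasCM hE) ht hs htj g

end NonCM

section Graph

variable {E : WeierstrassCurve ℚ} {θ : borel3 →* GL (Fin 2) (ZMod 2)}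
  {b₂ : Module.Basis (Fin 2) (ZMod 2) (Tors E 2)} {b₃ : Module.Basis (Fin 2) (ZMod 3) (Tors E 3)}

/-- An element of a graph is determined by its `B(3)` component, so surjectivity onto `B(3)`
suffices. -/
theorem range_prod_eq_graphSubgroup
    (h : ((galRep E 2 b₂).prod (galRep E 3 b₃)).range ≤ graphSubgroup θ)
    (h3 : (galRep E 3 b₃).range = borel3) :
    ((galRep E 2 b₂).prod (galRep E 3 b₃)).range = graphSubgroup θ := by
  refine le_antisymm h ?_
  rintro _ ⟨g, rfl⟩
  have hg : g.1 ∈ (galRep E 3 b₃).range := by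
    rw [h3]
    exact g.2
  obtain ⟨σ, hσ⟩ := hg
  refine ⟨σ, Prod.ext ?_ hσ⟩
  obtain ⟨hmem, e⟩ := galRep_mem_borel3 h σ
  change galRep E 2 b₂ σ = θ g
  rw [← e]
  congr 1
  exact Subtype.ext hσ

theorem galPoint_torsPoint (h : ((galRep E 2 b₂).prod (galRep E 3 b₃)).range ≤ graphSubgroup θ)
    (σ : GQ) : (galRep E 3 b₃ σ 0 0 = 1 ∧
      galPoint E σ (torsPoint b₃ ![1, 0]) = (torsPoint b₃ ![1, 0] : QbarPoints E)) ∨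
    (galRep E 3 b₃ σ 0 0 = -1 ∧
      galPoint E σ (torsPoint b₃ ![1, 0]) = -(torsPoint b₃ ![1, 0] : QbarPoints E)) := by
  obtain ⟨hσ, -⟩ := galRep_mem_borel3 h σ
  have e : (galRep E 3 b₃ σ).1 = !![galRep E 3 b₃ σ 0 0, galRep E 3 b₃ σ 0 1; 0,
      galRep E 3 b₃ σ 1 1] := by
    have h' : galRep E 3 b₃ σ 1 0 = 0 := hσ
    rw [← h']
    exact Matrix.eta_fin_two _
  have ht := congrArg Subtype.val (galTors_torsPoint b₃ σ ![1, 0])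
  have ht' : galPoint E σ (torsPoint b₃ ![1, 0]) =
    (torsPoint b₃ ((galRep E 3 b₃ σ).1.mulVec ![1, 0]) : QbarPoints E) := ht
  rw [ht', e]
  have key : ∀ a b d : ZMod 3, a ≠ 0 → (a = 1 ∧ !![a, b; 0, d].mulVec ![1, 0] = ![1, 0]) ∨
    (a = -1 ∧ !![a, b; 0, d].mulVec ![1, 0] = -![1, 0]) := by decide
  rcases key _ (galRep E 3 b₃ σ 0 1) (galRep E 3 b₃ σ 1 1)
    (borel3_diag_ne_zero ⟨_, hσ⟩).1 with ⟨h1, h2⟩ | ⟨h1, h2⟩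
  · exact Or.inl ⟨h1, by rw [h2]⟩
  · refine Or.inr ⟨h1, ?_⟩
    rw [h2, torsPoint_neg]
    rfl

end Graph

/-! ### A family with full image -/

section Family

variable {E : WeierstrassCurve ℚ} [E.IsElliptic] {b : ℚ}

/-- The stable line is spanned by `(0, y)` with `y² = 2b²`. The left subgroup would make `y`
rational; the right one would make `y · discRoot` rational, with square `-54 (b Δ)²`. -/
theorem range_eq_borel3_of_nodalCurve {θ : borel3 →* GL (Fin 2) (ZMod 2)}
    {b₂ : Module.Basis (Fin 2) (ZMod 2) (Tors E 2)}
    {b₃ : Module.Basis (Fin 2) (ZMod 3) (Tors E 3)} (hE : E = nodalCurve 2 b) (hb : b ≠ 0)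
    (h : ((galRep E 2 b₂).prod (galRep E 3 b₃)).range ≤ graphSubgroup θ)
    (hΔ : ∀ g : ℚ, g ^ 3 ≠ E.Δ) : (galRep E 3 b₃).range = borel3 := by
  obtain ⟨hle, hact⟩ := range_le_borel3_and_surjective h hΔ
  have hne1 : (![1, 0] : Fin 2 → ZMod 3) ≠ 0 := by decide
  have hX := isThreeRoots_torsX b₃
  -- the rational root of the 3-division polynomial is `0`
  have hx0 : torsX b₃ ![1, 0] = 0 := by
    have h0 : (E⁄Qbar).psiThree 0 = 0 := by
      have := E.psiThree_algebraMap 0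
      rw [map_zero] at this
      rw [this, hE]
      rw [map_eq_zero]
      simp only [psiThree, nodalCurve.b₂_eq, nodalCurve.b₄_eq, nodalCurve.b₆_eq, nodalCurve.b₈_eq]
      ring
    rcases hX.psiThree_eq_zero_iff.1 h0 with h1 | ⟨k, hk⟩
    · exact h1.symm
    · obtain ⟨_, ⟨σ, rfl⟩, hne⟩ := exists_borelAct_ne h hΔ k
      refine absurd (hX.1 ?_) hne
      change torsX b₃ ![_, 1] = torsX b₃ ![k, 1]
      have hk' : 0 = torsX b₃ ![k, 1] := hk
      rw [← map_torsX_three h, ← hk', map_zero]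
  obtain ⟨x, y, hns, hP, hx⟩ : ∃ x y hns, (torsPoint b₃ ![1, 0] : QbarPoints E) = .some x y hns ∧
      x = 0 := by
    obtain ⟨y, hns, hP⟩ := exists_eq_some (torsPoint_coe_ne_zero b₃ hne1)
    exact ⟨_, y, hns, hP, hx0⟩
  have hmap : E⁄Qbar = nodalCurve 2 (algebraMap ℚ Qbar b) := by
    rw [hE, ← map_ofNat (algebraMap ℚ Qbar) 2]
    exact nodalCurve.map_eq (algebraMap ℚ Qbar) 2 b
  have hy : y ^ 2 = 2 * algebraMap ℚ Qbar b ^ 2 := by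
    have heq := hns.1
    rw [hmap, nodalCurve.equation_iff, hx] at heq
    rw [heq]
    ring
  have hy0 : y ≠ 0 := by
    rintro rfl
    have : algebraMap ℚ Qbar b ≠ 0 := (map_ne_zero _).2 hb
    exact mul_ne_zero two_ne_zero (pow_ne_zero 2 this) (by rw [← hy]; norm_num)
  have hσy : ∀ σ : GQ, (galRep E 3 b₃ σ 0 0 = 1 ∧ σ y = y) ∨
      (galRep E 3 b₃ σ 0 0 = -1 ∧ σ y = -y) := by
    intro σ
    rcases galPoint_torsPoint h σ with ⟨h1, h2⟩ | ⟨h1, h2⟩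
    · rw [hP] at h2
      exact Or.inl ⟨h1, (Affine.Point.some.inj h2).2⟩
    · rw [hP] at h2
      refine Or.inr ⟨h1, (Affine.Point.some.inj h2).2.trans ?_⟩
      rw [hmap, nodalCurve.negY_eq]
  rcases borel3_eq_or hle hact with h3 | ⟨-, h3 | h3⟩
  · exact h3
  · exfalso
    have hfix : ∀ σ : GQ, σ y = y := by
      intro σ
      have hmem : galRep E 3 b₃ σ ∈ borel3Left := h3 ▸ ⟨σ, rfl⟩
      have h1 : galRep E 3 b₃ σ 0 0 = 1 := hmem.2
      rcases hσy σ with h | h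
      · exact h.2
      · rw [h1] at h
        exact absurd h.1 (by decide)
    obtain ⟨q, hq⟩ := exists_algebraMap_eq_of_fixed hfix
    have hq2 : q ^ 2 = 2 * b ^ 2 := by
      apply (algebraMap ℚ Qbar).injective
      rw [map_pow, hq, hy, map_mul, map_pow, map_ofNat]
    have hsq : IsSquare (2 : ℚ) := ⟨q / b, by field_simp; linear_combination -hq2⟩
    rw [show (2 : ℚ) = ((2 : ℕ) : ℚ) by norm_num, Rat.isSquare_natCast_iff] at hsq
    exact Nat.prime_two.not_isSquare hsq
  · exfalso
    -- When `d = 1`, the signs by which `σ` acts on `y` and on `discRoot` are both equal to the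
    -- entry `a`.
    have hfix : ∀ σ : GQ, σ (y * discRoot b₃) = y * discRoot b₃ := by
      intro σ
      have hmem : galRep E 3 b₃ σ ∈ borel3Right := h3 ▸ ⟨σ, rfl⟩
      have h1 : galRep E 3 b₃ σ 1 1 = 1 := hmem.2
      have h2 := map_discRoot h σ
      rw [h1, mul_one] at h2
      rcases hσy σ with h | h <;> rcases h2 with h2 | h2
      · rw [map_mul, h.2, h2.2]
      · rw [h.1] at h2
        exact absurd h2.1 (by decide)
      · rw [h.1] at h2
        exact absurd h2.1 (by decide)
      · rw [map_mul, h.2, h2.2, neg_mul_neg]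
    obtain ⟨q, hq⟩ := exists_algebraMap_eq_of_fixed hfix
    have hq2 : q ^ 2 = -54 * (b * E.Δ) ^ 2 := by
      apply (algebraMap ℚ Qbar).injective
      rw [map_pow, hq, mul_pow, hy, discRoot_sq]
      simp only [map_mul, map_pow, map_neg, map_ofNat]
      ring
    have : 0 < (b * E.Δ) ^ 2 := by
      have := E.isUnit_Δ.ne_zero
      positivity
    nlinarith [sq_nonneg q]

/-- The curve with parameter `r = v³ + 1`. -/
def familyCurve (r : ℚ) : WeierstrassCurve ℚ := nodalCurve 2 (8 * r ^ 2 / (27 * (r ^ 2 - 1)))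

theorem familyCurve_Δ {r : ℚ} (hr : r ^ 2 - 1 ≠ 0) :
    (familyCurve r).Δ = -262144 * r ^ 6 / (19683 * (r ^ 2 - 1) ^ 4) := by
  rw [familyCurve, nodalCurve.Δ_eq]
  field_simp
  ring

theorem familyCurve_c₄ {r : ℚ} (hr : r ^ 2 - 1 ≠ 0) :
    (familyCurve r).c₄ = 64 * (r ^ 2 - 9) / (9 * (r ^ 2 - 1)) := by
  rw [familyCurve, nodalCurve.c₄_eq]
  field_simp
  ring

theorem familyCurve_isElliptic {r : ℚ} (hr : r ^ 2 - 1 ≠ 0) (hr0 : r ≠ 0) :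
    (familyCurve r).IsElliptic := by
  refine ⟨isUnit_iff_ne_zero.2 ?_⟩
  rw [familyCurve_Δ hr]
  have : (-262144 : ℚ) ≠ 0 := by norm_num
  have h2 : (19683 : ℚ) ≠ 0 := by norm_num
  positivity

/-- This is `27(t + 1)(t + 9)³ / t³` at `t = -r²`, written so that its monotonicity in `r²` is
visible. -/
theorem familyCurve_j {r : ℚ} (hr : r ^ 2 - 1 ≠ 0) (hr0 : r ≠ 0) [(familyCurve r).IsElliptic] :
    (familyCurve r).j = -27 * ((r ^ 2 - 1) * (1 - 9 / r ^ 2) ^ 3) := by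
  rw [j_eq_div, familyCurve_c₄ hr, familyCurve_Δ hr]
  field_simp
  ring

/-- As `5 ∣ r`, the denominator `27(r² - 1)` is a 5-adic unit and `|b|₅ < 1`, so the reduction at 5
is a node. -/
theorem not_hasCM_familyCurve {r : ℤ} (hr0 : r ≠ 0) (h5 : 5 ∣ r) : ¬ HasCM (familyCurve r) := by
  have hsq : (5 : ℤ) ∣ r ^ 2 := Dvd.dvd.pow h5 two_ne_zero
  have hn : ¬ (5 : ℤ) ∣ 27 * (r ^ 2 - 1) := by omega
  have hn0 : 27 * (r ^ 2 - 1) ≠ 0 := fun h => hn (h ▸ dvd_zero _)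
  have : Fact (Nat.Prime 5) := ⟨by norm_num⟩
  have hb : (8 * (r : ℚ) ^ 2 / (27 * (r ^ 2 - 1))) =
      ((8 * r ^ 2 : ℤ) : ℚ) / ((27 * (r ^ 2 - 1) : ℤ) : ℚ) := by push_cast; rfl
  refine not_hasCM_of_eq_nodalCurve rfl 5 (by norm_num) ?_ ?_ ?_
  · rw [hb]
    refine div_ne_zero (Int.cast_ne_zero.2 (mul_ne_zero (by norm_num) (pow_ne_zero 2 hr0)))
      (Int.cast_ne_zero.2 hn0)
  · exact (padicNorm.int_eq_one_iff 2).2 (by norm_num)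
  · rw [hb, padicNorm.div, (padicNorm.int_eq_one_iff _).2 hn, div_one]
    exact (padicNorm.int_lt_one_iff _).2 (Dvd.dvd.mul_left hsq 8)

theorem compositeImageConj_familyCurve {θ : borel3 →* GL (Fin 2) (ZMod 2)}
    (hθ : Function.Surjective θ) {v : ℤ} (hv : v ^ 3 + 1 ≠ 0) (h5 : (5 : ℤ) ∣ v ^ 3 + 1)
    [(familyCurve (v ^ 3 + 1 : ℤ)).IsElliptic] (hr : ((v ^ 3 + 1 : ℤ) : ℚ) ^ 2 - 1 ≠ 0) :
    CompositeImageConj (familyCurve (v ^ 3 + 1 : ℤ)) (graphSubgroup θ) := by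
  have hCM := not_hasCM_familyCurve hv h5
  have hv' : ((v ^ 3 + 1 : ℤ) : ℚ) ≠ 0 := by exact_mod_cast hv
  have hle : CompositeImageConjLE (familyCurve (v ^ 3 + 1 : ℤ)) (graphSubgroup θ) := by
    refine (compositeImageConjLE_iff_v hCM hθ).2 ⟨v, by exact_mod_cast hv, ?_⟩
    rw [familyCurve_j hr hv']
    push_cast at hv' ⊢
    field_simp
    ring
  obtain ⟨b₂, b₃, h⟩ := id hle
  refine ⟨b₂, b₃, range_prod_eq_graphSubgroup h (range_eq_borel3_of_nodalCurve rfl ?_ h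
    (Δ_ne_cube_of_compositeImageConjLE hCM hθ hle))⟩
  have : (27 : ℚ) ≠ 0 := by norm_num
  have : (8 : ℚ) ≠ 0 := by norm_num
  positivity

theorem strictMonoOn_jFamily : StrictMonoOn (fun u : ℚ => (u - 1) * (1 - 9 / u) ^ 3) (Set.Ioi 9) := by
  intro x hx y hy hxy
  have hx : 9 < x := hx
  have hy : 9 < y := hy
  have h1 : 9 / y < 9 / x := by gcongr
  have h2 : 9 / x < 1 := by rw [div_lt_one (by linarith)]; exact hx
  have h3 : (1 - 9 / x) ^ 3 < (1 - 9 / y) ^ 3 := by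
    gcongr
  have h4 : 0 < (1 - 9 / x) ^ 3 := pow_pos (by linarith) 3
  exact mul_lt_mul'' (by linarith) h3 (by linarith) h4.le

theorem infinite_j_compositeImageConj {θ : borel3 →* GL (Fin 2) (ZMod 2)}
    (hθ : Function.Surjective θ) :
    {j : ℚ | ∃ (E : WeierstrassCurve ℚ) (_ : E.IsElliptic),
      ¬ HasCM E ∧ CompositeImageConj E (graphSubgroup θ) ∧ E.j = j}.Infinite := by
  -- The class `v ≡ 4` modulo 5 makes `v³ + 1` divisible by 5.
  let v : ℕ → ℤ := fun m => 5 * m + 4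
  let r : ℕ → ℤ := fun m => v m ^ 3 + 1
  have hv4 : ∀ m, 4 ≤ v m := fun m => by simp only [v]; omega
  have hr65 : ∀ m, 65 ≤ r m := fun m => by
    have := pow_le_pow_left₀ (by norm_num) (hv4 m) 3
    simp only [r]
    linarith
  have hr5 : ∀ m, 5 ∣ r m := fun m =>
    ⟨25 * m ^ 3 + 60 * m ^ 2 + 48 * m + 13, by simp only [r, v]; ring⟩
  have hr0 : ∀ m, r m ≠ 0 := fun m => by have := hr65 m; omega
  have hrq : ∀ m, (65 : ℚ) ≤ r m := fun m => by exact_mod_cast hr65 m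
  have hr1 : ∀ m, (r m : ℚ) ^ 2 - 1 ≠ 0 := fun m => by nlinarith [hrq m]
  have hr9 : ∀ m, (r m : ℚ) ^ 2 ∈ Set.Ioi (9 : ℚ) := fun m => by
    have := hrq m
    rw [Set.mem_Ioi]
    nlinarith
  have hmono : StrictMono v := fun m n hmn => by simp only [v]; omega
  refine Set.infinite_of_injective_forall_mem
    (f := fun m : ℕ => -27 * (((r m : ℚ) ^ 2 - 1) * (1 - 9 / (r m : ℚ) ^ 2) ^ 3)) ?_ ?_
  · intro m n hmn
    have h1 := strictMonoOn_jFamily.injOn (hr9 m) (hr9 n) (mul_left_cancel₀ (by norm_num) hmn)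
    have h2 : (r m : ℚ) = r n := by
      refine (pow_left_inj₀ ?_ ?_ two_ne_zero).1 h1
      · linarith [hrq m]
      · linarith [hrq n]
    have h3 : r m = r n := by exact_mod_cast h2
    have h4 : v m ^ 3 = v n ^ 3 := add_right_cancel h3
    exact hmono.injective ((pow_left_inj₀ (by linarith [hv4 m]) (by linarith [hv4 n])
      three_ne_zero).1 h4)
  · intro m
    have hr0' : (r m : ℚ) ≠ 0 := by exact_mod_cast hr0 m
    have hell := familyCurve_isElliptic (hr1 m) hr0'
    exact ⟨familyCurve (r m), hell, not_hasCM_familyCurve (hr0 m) (hr5 m),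
      compositeImageConj_familyCurve hθ (hr0 m) (hr5 m) (hr1 m), familyCurve_j (hr1 m) hr0'⟩

end Family

end WeierstrassCurve

theorem mainTheorem5 :
    (∃ θ : borel3 →* GL (Fin 2) (ZMod 2), Function.Surjective θ) ∧
    Nonempty (LevelSixFunctionField ≃ₐ[ℚ] RatFunc ℚ) ∧
    ∀ θ : borel3 →* GL (Fin 2) (ZMod 2), Function.Surjective θ →
      {j : ℚ | ∃ (E : WeierstrassCurve ℚ) (_ : E.IsElliptic),
          ¬ HasCM E ∧ CompositeImageConj E (graphSubgroup θ) ∧ E.j = j}.Infinite ∧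
      ∀ (E : WeierstrassCurve ℚ) [E.IsElliptic], ¬ HasCM E →
        (CompositeImageConjLE E (graphSubgroup θ) ↔
          ∃ s t : ℚ, t ≠ 0 ∧
            E.j = 2 ^ 10 * 3 ^ 3 * s ^ 3 * (1 - 4 * s ^ 3) ∧
            E.j = 27 * (t + 1) * (t + 9) ^ 3 / t ^ 3) ∧
        (CompositeImageConjLE E (graphSubgroup θ) ↔
          ∃ v : ℚ, v ^ 3 + 1 ≠ 0 ∧
            E.j = 27 * v ^ 3 * (v ^ 3 + 2) * (2 - v ^ 3) ^ 3 * (v ^ 3 + 4) ^ 3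
              / (v ^ 3 + 1) ^ 6) ∧
        (CompositeImageConjLE E (graphSubgroup θ) →
          ModImageConj E 2 ⊤ ∧
          (ModImageConj E 3 borel3 ∨ ModImageConj E 3 borel3Left ∨
            ModImageConj E 3 borel3Right) ∧
          divisionField E 2 ⊓ divisionField E 3 = zetaCubeRootField E ∧
          IsGalois ℚ (divisionField E 2 ⊓ divisionField E 3 : IntermediateField ℚ Qbar) ∧
          (∃ σ τ : (divisionField E 2 ⊓ divisionField E 3 : IntermediateField ℚ Qbar) ≃ₐ[ℚ]
              (divisionField E 2 ⊓ divisionField E 3 : IntermediateField ℚ Qbar),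
            σ * τ ≠ τ * σ) ∧
          (ModImageConj E 3 borel3 →
            divisionField E 2 ⊓ divisionField E 3 = xDivisionField E 3) ∧
          (ModImageConj E 3 borel3Left ∨ ModImageConj E 3 borel3Right →
            divisionField E 2 ⊓ divisionField E 3 = divisionField E 3)) := by
  open WeierstrassCurve in
  refine ⟨exists_surjective_borel3, LevelSix.nonempty_functionField_algEquiv, fun θ hθ =>
    ⟨infinite_j_compositeImageConj hθ, fun E _ hE => ⟨compositeImageConjLE_iff_s_t hE hθ,
      compositeImageConjLE_iff_v hE hθ, fun hle => ?_⟩⟩⟩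
  have hΔ := Δ_ne_cube_of_compositeImageConjLE hE hθ hle
  obtain ⟨b₂, b₃, h⟩ := hle
  rw [divisionField_inf h hθ]
  refine ⟨⟨b₂, MonoidHom.range_eq_top.2 (galRep_two_surjective h hΔ hθ)⟩, ?_,
    (zetaCubeRootField_eq h hθ).symm, isGalois_divisionField_two h hθ,
    exists_not_commute h hΔ hθ, fun _ => (xDivisionField_eq h hθ).symm, fun h3 => ?_⟩
  · obtain ⟨hle, hact⟩ := range_le_borel3_and_surjective h hΔ
    rcases borel3_eq_or hle hact with h3 | ⟨-, h3 | h3⟩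
    · exact Or.inl ⟨b₃, h3⟩
    · exact Or.inr (Or.inl ⟨b₃, h3⟩)
    · exact Or.inr (Or.inr ⟨b₃, h3⟩)
  -- Neither subgroup contains `-1`. The basis in the hypothesis need not be `b₃`, but acting as
  -- `-1` does not depend on the basis.
  · refine divisionField_two_eq_three h hθ fun σ hσ => ?_
    rcases h3 with ⟨b, hb⟩ | ⟨b, hb⟩
    · have hm : galRep E 3 b σ ∈ borel3Left := hb ▸ ⟨σ, rfl⟩
      rw [(galRep_eq_neg_one_iff b σ).2 hσ] at hm
      exact absurd hm.2 (by decide)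
    · have hm : galRep E 3 b σ ∈ borel3Right := hb ▸ ⟨σ, rfl⟩
      rw [(galRep_eq_neg_one_iff b σ).2 hσ] at hm
      exact absurd hm.2 (by decide)

end
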